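/- Let $k$ be a field of characteristic zero. A DG Lie algebra $\mathfrak g=\bigoplus_{i\in\mathbb Z}\mathfrak g^i$ over $k$ (differential $\partial$ of degree $1$, graded Lie bracket of degree $0$) is *pro-nilpotent* if it is equipped with a decreasing filtration $\mathfrak g=L_1\mathfrak g\supset L_2\mathfrak g\supset\cdots$ by graded subspaces with $\partial(L_r\mathfrak g)\subset L_r\mathfrak g$ and $[L_r\mathfrak g,L_s\mathfrak g]\subset L_{r+s}\mathfrak g$, which is complete: $\mathfrak g^i\to\varprojlim_r \mathfrak g^i/L_r\mathfrak g^i$ is bijective for every $i$. Put $MC(\mathfrak g)=\{\alpha\in\mathfrak g^1 : \partial\alpha+\tfrac12[\alpha,\alpha]=0\}$. For $\gamma\in\mathfrak g^0$ let $$\exp(\gamma)(\alpha)=\alpha+\sum_{n\ge0}\frac{1}{(n+1)!}(\mathrm{ad}\,\gamma)^n\big([\gamma,\alpha]-\partial\gamma\big)$$ be the time-one flow of the vector field $\alpha\mapsto-\partial\gamma+[\gamma,\alpha]$. Call $\alpha,\beta\in MC(\mathfrak g)$ *equivalent*, $\alpha\sim\beta$, if $\beta=\exp(\gamma)(\alpha)$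 for some $\gamma\in\mathfrak g^0$. For a permutation $\sigma\in S_n$ and homogeneous $\xi_1,\dots,\xi_n$ let $\chi(\sigma)=\operatorname{sgn}(\sigma)\,\epsilon(\sigma)$, where $\xi_1\wedge\dots\wedge \xi_n=\epsilon(\sigma)\,\xi_{\sigma(1)}\wedge\dots\wedge \xi_{\sigma(n)}$ in the free graded commutative algebra. An *$L_\infty$-morphism* $\Phi:\mathfrak g\to\mathfrak h$ of DG Lie algebras is a sequence of multilinear maps $\Phi^n:\mathfrak g^{\otimes n}\to\mathfrak h$ of degree $1-n$, $n\ge1$, with $\Phi^n(\xi_1,\dots,\xi_n)=\chi(\sigma)\Phi^n(\xi_{\sigma(1)},\dots,\xi_{\sigma(n)})$ and $$\begin{aligned}&\partial\Phi^n(\xi_1,\dots,\xi_n)+\frac{(-1)^n}{(n-1)!}\sum_{\sigma\in S_n}\chi(\sigma)\Phi^n(\partial\xi_{\sigma(1)},\xi_{\sigma(2)},\dots,\xi_{\sigma(n)})\\&-\frac{1}{2!(n-2)!}\sum_{\sigma\in S_n}\chi(\sigma)\Phi^{n-1}([\xi_{\sigma(1)},\xi_{\sigma(2)}],\xi_{\sigma(3)},\dots,\xi_{\sigma(n)})\\&+\frac12\sum_{\substack{s+t=n\\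 s,t\ge1}}\frac{1}{s!\,t!}\sum_{\tau\in S_n}\chi(\tau)(-1)^{s-1}(-1)^{(t-1)\sum_{p=1}^s|\xi_{\tau(p)}|}\big[\Phi^s(\xi_{\tau(1)},\dots,\xi_{\tau(s)}),\Phi^t(\xi_{\tau(s+1)},\dots,\xi_{\tau(n)})\big]=0\end{aligned}$$ for all $n\ge1$ and all homogeneous $\xi_1,\dots,\xi_n\in\mathfrak g$ (the third term is absent for $n=1$). For pro-nilpotent $\mathfrak g,\mathfrak h$, it is *filtered* if $\Phi^n(L_{r_1}\mathfrak g\otimes\cdots\otimes L_{r_n}\mathfrak g)\subset L_{r_1+\cdots+r_n}\mathfrak h$ for all $n,r_1,\dots,r_n\ge 1$, and a *filtered $L_\infty$-quasi-isomorphism* if moreover the morphisms of complexes $L_r\mathfrak g/L_{r+1}\mathfrak g\to L_r\mathfrak h/L_{r+1}\mathfrak h$ induced by $\Phi^1$ are quasi-isomorphisms for all $r\ge1$. **Lemma 2.6.** Let $\Phi:\mathfrak g\to\mathfrak h$ be a filtered $L_\infty$-quasi-isomorphism of pro-nilpotent DG Lie algebras over $k$. Then $\sim$ is an equivalence relation on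 $MC(\mathfrak g)$ and on $MC(\mathfrak h)$, and for every $\alpha\in MC(\mathfrak g)$ the series $$\Phi_*(\alpha)=\sum_{n\ge1}\frac{(-1)^{(n-1)(n-2)/2}}{n!}\,\Phi^n(\alpha,\dots,\alpha)$$ converges, for the filtration of $\mathfrak h$, to an element of $MC(\mathfrak h)$. The map $\Phi_*$ sends equivalent elements to equivalent elements, and the induced map $MC(\mathfrak g)/{\sim}\to MC(\mathfrak h)/{\sim}$ is a bijection. -/

import Mathlib

open scoped Nat

universe u v w

/-- A (`ℤ`-graded) DG Lie algebra over `𝕜`, with underlying vector space `G = ⨁ i, gr i`,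
differential `d` of degree `1` and graded Lie bracket of degree `0`. -/
structure DGLieAlgebra (𝕜 : Type u) (G : Type v) [Field 𝕜] [AddCommGroup G] [Module 𝕜 G] where
  gr : ℤ → Submodule 𝕜 G
  isInternal : DirectSum.IsInternal gr
  d : G →ₗ[𝕜] G
  bracket : G →ₗ[𝕜] G →ₗ[𝕜] G
  d_mem : ∀ (i : ℤ) (x : G), x ∈ gr i → d x ∈ gr (i + 1)
  d_d : ∀ x : G, d (d x) = 0
  bracket_mem : ∀ (i j : ℤ) (x y : G), x ∈ gr i → y ∈ gr j → bracket x y ∈ gr (i + j)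
  bracket_symm : ∀ (i j : ℤ) (x y : G), x ∈ gr i → y ∈ gr j →
    bracket x y = -((i * j).negOnePow • bracket y x)
  leibniz : ∀ (i : ℤ) (x y : G), x ∈ gr i →
    d (bracket x y) = bracket (d x) y + i.negOnePow • bracket x (d y)
  jacobi : ∀ (i j : ℤ) (x y z : G), x ∈ gr i → y ∈ gr j →
    bracket x (bracket y z) =
      bracket (bracket x y) z + (i * j).negOnePow • bracket y (bracket x z)

/-- A pro-nilpotent DG Lie algebra: a DG Lie algebra with a complete decreasing filtration
`G = L 1 ⊇ L 2 ⊇ ⋯` by graded subspaces (so `L 0 = G` carries no information), with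
`d (L r) ⊆ L r` and `[L r, L s] ⊆ L (r + s)`. Completeness is that of a filtered graded
space: in every degree `i` the map from `gr i` to the inverse limit of the quotients
`gr i / (L r ∩ gr i)` is injective (`separated`) and surjective (`complete`). -/
structure ProNilpotentDGLieAlgebra (𝕜 : Type u) (G : Type v) [Field 𝕜] [AddCommGroup G]
    [Module 𝕜 G] extends DGLieAlgebra 𝕜 G where
  L : ℕ → Submodule 𝕜 G
  L_one : L 1 = ⊤
  L_antitone : Antitone L
  L_graded : ∀ r : ℕ, L r = ⨆ i : ℤ, L r ⊓ gr i
  d_mem_L : ∀ (r : ℕ) (x : G), x ∈ L r → d x ∈ L r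
  bracket_mem_L : ∀ (r s : ℕ) (x y : G), x ∈ L r → y ∈ L s → bracket x y ∈ L (r + s)
  separated : ∀ x : G, (∀ r : ℕ, x ∈ L r) → x = 0
  complete : ∀ (i : ℤ) (x : ℕ → G), (∀ n, x n ∈ gr i) → (∀ n, x (n + 1) - x n ∈ L n) →
    ∃ y ∈ gr i, ∀ n, y - x n ∈ L n

/-- The Koszul sign `ε(σ; x₁, …, xₙ)` for elements of degrees `deg 1, …, deg n`, determined by
`x₁ ∧ ⋯ ∧ xₙ = ε • x_{σ 1} ∧ ⋯ ∧ x_{σ n}` in the free graded commutative algebra: every pair of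
elements whose order is reversed contributes `(-1)` to the product of the two degrees. -/
def koszulSign {n : ℕ} (σ : Equiv.Perm (Fin n)) (deg : Fin n → ℤ) : ℤˣ :=
  ∏ p : Fin n × Fin n with p.1 < p.2 ∧ σ p.2 < σ p.1,
    (deg (σ p.1) * deg (σ p.2)).negOnePow

/-- The sign `χ(σ) = sgn(σ) ε(σ)`. -/
def chiSign {n : ℕ} (σ : Equiv.Perm (Fin n)) (deg : Fin n → ℤ) : ℤˣ :=
  Equiv.Perm.sign σ * koszulSign σ deg

section LInfty

variable {𝕜 : Type u} {G : Type v} {H : Type w} [Field 𝕜] [AddCommGroup G] [Module 𝕜 G]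
  [AddCommGroup H] [Module 𝕜 H]

/-- `1 / (n-1)! * ∑ σ, χ(σ) Φⁿ(∂ξ_{σ 1}, ξ_{σ 2}, …, ξ_{σ n})`, written for arity `n = m + 1`. -/
noncomputable def lInftyDiffTerm (g : DGLieAlgebra 𝕜 G)
    (Φ : (k : ℕ) → MultilinearMap 𝕜 (fun _ : Fin k => G) H)
    (m : ℕ) (deg : Fin (m + 1) → ℤ) (ξ : Fin (m + 1) → G) : H :=
  ((m ! : ℕ) : 𝕜)⁻¹ • ∑ σ : Equiv.Perm (Fin (m + 1)),
    chiSign σ deg • Φ (m + 1) (Fin.cons (g.d (ξ (σ 0))) (fun i : Fin m => ξ (σ i.succ)))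

/-- `1 / (2! (n-2)!) * ∑ σ, χ(σ) Φⁿ⁻¹([ξ_{σ 1}, ξ_{σ 2}], ξ_{σ 3}, …, ξ_{σ n})`, written for
arity `n = m + 1`; it is absent for `n = 1`. -/
noncomputable def lInftyBracketTerm (g : DGLieAlgebra 𝕜 G)
    (Φ : (k : ℕ) → MultilinearMap 𝕜 (fun _ : Fin k => G) H) :
    (m : ℕ) → (Fin (m + 1) → ℤ) → (Fin (m + 1) → G) → H
  | 0, _, _ => 0
  | m + 1, deg, ξ =>
    ((2 ! * m ! : ℕ) : 𝕜)⁻¹ • ∑ σ : Equiv.Perm (Fin (m + 2)),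
      chiSign σ deg • Φ (m + 1)
        (Fin.cons (g.bracket (ξ (σ 0)) (ξ (σ 1))) (fun i : Fin m => ξ (σ i.succ.succ)))

/-- `1/2 * ∑_{s+t=n} 1 / (s! t!) * ∑ τ, χ(τ) (-1)^{s-1} (-1)^{(t-1)(|ξ_{τ 1}| + ⋯ + |ξ_{τ s}|)}
[Φˢ(ξ_{τ 1}, …, ξ_{τ s}), Φᵗ(ξ_{τ (s+1)}, …, ξ_{τ n})]`. For an `L∞`-morphism `Φ⁰ = 0`, so that
only the terms with `s, t ≥ 1` contribute. -/
noncomputable def lInftyProductTerm (h : DGLieAlgebra 𝕜 H)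
    (Φ : (k : ℕ) → MultilinearMap 𝕜 (fun _ : Fin k => G) H)
    (n : ℕ) (deg : Fin n → ℤ) (ξ : Fin n → G) : H :=
  (2 : 𝕜)⁻¹ • ∑ p : Finset.HasAntidiagonal.antidiagonal n,
    ((p.1.1 ! * p.1.2 ! : ℕ) : 𝕜)⁻¹ • ∑ τ : Equiv.Perm (Fin n),
      let fst : Fin p.1.1 → Fin n := fun i =>
        τ (Fin.cast (Finset.HasAntidiagonal.mem_antidiagonal.mp p.2) (Fin.castAdd p.1.2 i))
      let snd : Fin p.1.2 → Fin n := fun i =>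
        τ (Fin.cast (Finset.HasAntidiagonal.mem_antidiagonal.mp p.2) (Fin.natAdd p.1.1 i))
      (chiSign τ deg * ((p.1.1 : ℤ) - 1).negOnePow
          * (((p.1.2 : ℤ) - 1) * ∑ i, deg (fst i)).negOnePow) •
        h.bracket (Φ p.1.1 (fun i => ξ (fst i))) (Φ p.1.2 (fun i => ξ (snd i)))

/-- An `L∞`-morphism `g → h` of DG Lie algebras: multilinear maps `Φᵏ : G^k → H`, `k ≥ 1`, of
degree `1 - k`, graded antisymmetric, subject to the usual relations. (The value at `k = 0` is
set to `0`.) -/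
structure LInftyMorphism (g : DGLieAlgebra 𝕜 G) (h : DGLieAlgebra 𝕜 H) where
  app : (k : ℕ) → MultilinearMap 𝕜 (fun _ : Fin k => G) H
  app_zero : app 0 = 0
  degree : ∀ (k : ℕ) (deg : Fin k → ℤ) (ξ : Fin k → G), (∀ i, ξ i ∈ g.gr (deg i)) →
    app k ξ ∈ h.gr ((∑ i, deg i) + 1 - k)
  antisymm : ∀ (k : ℕ) (deg : Fin k → ℤ) (ξ : Fin k → G) (σ : Equiv.Perm (Fin k)),
    (∀ i, ξ i ∈ g.gr (deg i)) → app k ξ = chiSign σ deg • app k (fun i => ξ (σ i))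
  relation : ∀ (m : ℕ) (deg : Fin (m + 1) → ℤ) (ξ : Fin (m + 1) → G),
    (∀ i, ξ i ∈ g.gr (deg i)) →
    h.d (app (m + 1) ξ) + (-1 : 𝕜) ^ (m + 1) • lInftyDiffTerm g app m deg ξ
      - lInftyBracketTerm g app m deg ξ + lInftyProductTerm h app (m + 1) deg ξ = 0

/-- The linear part `Φ¹ : G → H`. -/
def LInftyMorphism.linear {g : DGLieAlgebra 𝕜 G} {h : DGLieAlgebra 𝕜 H}
    (Φ : LInftyMorphism g h) : G →ₗ[𝕜] H where
  toFun x := Φ.app 1 (fun _ => x)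
  map_add' x y := by
    have e := (Φ.app 1).map_update_add (fun _ => (0 : G)) 0 x y
    have u : ∀ z : G, Function.update (fun _ : Fin 1 => (0 : G)) 0 z = fun _ => z := by
      intro z; funext i; rw [Subsingleton.elim i 0]; simp
    simpa [u] using e
  map_smul' c x := by
    have e := (Φ.app 1).map_update_smul (fun _ => (0 : G)) 0 c x
    have u : ∀ z : G, Function.update (fun _ : Fin 1 => (0 : G)) 0 z = fun _ => z := by
      intro z; funext i; rw [Subsingleton.elim i 0]; simp
    simpa [u] using e

theorem LInftyMorphism.linear_d {g : DGLieAlgebra 𝕜 G} {h : DGLieAlgebra 𝕜 H}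
    (Φ : LInftyMorphism g h) (x : G) : Φ.linear (g.d x) = h.d (Φ.linear x) := by
  have hx : x ∈ ⨆ i, g.gr i := by
    rw [g.isInternal.submodule_iSup_eq_top]; trivial
  induction hx using Submodule.iSup_induction' with
  | mem i x hx =>
    have hr := Φ.relation 0 (fun _ => i) (fun _ => x) (fun _ => hx)
    have h1 : lInftyDiffTerm g Φ.app 0 (fun _ => i) (fun _ => x) = Φ.linear (g.d x) := by
      have hc : (Fin.cons (g.d x) (fun _ : Fin 0 => x) : Fin 1 → G) = fun _ => g.d x := by
        funext j; rw [Fin.fin_one_eq_zero j]; rfl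
      have hk : koszulSign (1 : Equiv.Perm (Fin 1)) (fun _ => i) = 1 := by
        unfold koszulSign
        apply Finset.prod_eq_one
        intro p hp
        have := (Finset.mem_filter.mp hp).2.1
        exact absurd this (by rw [Fin.fin_one_eq_zero p.1, Fin.fin_one_eq_zero p.2]; exact lt_irrefl _)
      simp [lInftyDiffTerm, chiSign, hc, hk, LInftyMorphism.linear]
    have h3 : lInftyProductTerm h Φ.app 1 (fun _ => i) (fun _ => x) = 0 := by
      unfold lInftyProductTerm
      rw [Finset.sum_eq_zero, smul_zero]
      rintro ⟨⟨s, t⟩, hp⟩ -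
      have hst : s + t = 1 := Finset.HasAntidiagonal.mem_antidiagonal.mp hp
      rw [Finset.sum_eq_zero, smul_zero]
      intro τ _
      rcases Nat.eq_zero_or_pos s with rfl | hs
      · simp [Φ.app_zero]
      · obtain rfl : t = 0 := by omega
        simp [Φ.app_zero]
    replace hr : h.d (Φ.linear x) + (-1 : 𝕜) ^ 1 • lInftyDiffTerm g Φ.app 0 (fun _ => i)
        (fun _ => x) - lInftyBracketTerm g Φ.app 0 (fun _ => i) (fun _ => x)
        + lInftyProductTerm h Φ.app 1 (fun _ => i) (fun _ => x) = 0 := hr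
    rw [h1, h3] at hr
    simp only [lInftyBracketTerm, pow_one, neg_smul, one_smul, sub_zero, add_zero] at hr
    exact (add_neg_eq_zero.mp hr).symm
  | zero => simp
  | add x y _ _ hx hy => simp [hx, hy]

end LInfty

section Cohomology

variable {𝕜 : Type u} {M : Type v} {N : Type w} [Field 𝕜] [AddCommGroup M] [Module 𝕜 M]
  [AddCommGroup N] [Module 𝕜 N]

/-- The (total) cohomology `ker D / im D` of a space with differential `D`. For a graded complex
this is the direct sum of the cohomology groups in all degrees. -/
abbrev TotalCohomology (D : M →ₗ[𝕜] M) : Type v :=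
  LinearMap.ker D ⧸ (LinearMap.range D).submoduleOf (LinearMap.ker D)

/-- The map in cohomology induced by a map commuting with the differentials. -/
def TotalCohomology.map (D : M →ₗ[𝕜] M) (E : N →ₗ[𝕜] N) (f : M →ₗ[𝕜] N)
    (hf : ∀ x, f (D x) = E (f x)) : TotalCohomology D →ₗ[𝕜] TotalCohomology E :=
  Submodule.mapQ _ _
    (f.restrict (p := LinearMap.ker D) (q := LinearMap.ker E) (fun x hx => by
      rw [LinearMap.mem_ker] at hx ⊢
      rw [← hf, hx, map_zero]))
    (by
      rintro ⟨x, hx⟩ ⟨y, hy⟩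
      exact ⟨f y, by rw [← hf, hy]; rfl⟩)

end Cohomology

section ProNilpotent

variable {𝕜 : Type u} {G : Type v} {H : Type w} [Field 𝕜] [AddCommGroup G] [Module 𝕜 G]
  [AddCommGroup H] [Module 𝕜 H]

/-- The subquotient `L r / L (r + 1)`. -/
abbrev ProNilpotentDGLieAlgebra.Gr (g : ProNilpotentDGLieAlgebra 𝕜 G) (r : ℕ) : Type v :=
  g.L r ⧸ (g.L (r + 1)).submoduleOf (g.L r)

/-- The differential of `L r / L (r + 1)`. -/
def ProNilpotentDGLieAlgebra.grD (g : ProNilpotentDGLieAlgebra 𝕜 G) (r : ℕ) :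
    g.Gr r →ₗ[𝕜] g.Gr r :=
  Submodule.mapQ _ _ (g.d.restrict (g.d_mem_L r)) (fun x hx => g.d_mem_L (r + 1) x hx)

/-- An `L∞`-morphism of pro-nilpotent DG Lie algebras is filtered if
`Φᵏ(L r₁ ⊗ ⋯ ⊗ L rₖ) ⊆ L (r₁ + ⋯ + rₖ)`. -/
def LInftyMorphism.IsFiltered {g : ProNilpotentDGLieAlgebra 𝕜 G}
    {h : ProNilpotentDGLieAlgebra 𝕜 H}
    (Φ : LInftyMorphism g.toDGLieAlgebra h.toDGLieAlgebra) : Prop :=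
  ∀ (k : ℕ) (r : Fin k → ℕ) (ξ : Fin k → G), 1 ≤ k → (∀ i, 1 ≤ r i) →
    (∀ i, ξ i ∈ g.L (r i)) → Φ.app k ξ ∈ h.L (∑ i, r i)

theorem LInftyMorphism.IsFiltered.linear_mem {g : ProNilpotentDGLieAlgebra 𝕜 G}
    {h : ProNilpotentDGLieAlgebra 𝕜 H}
    {Φ : LInftyMorphism g.toDGLieAlgebra h.toDGLieAlgebra} (hΦ : Φ.IsFiltered) (r : ℕ) (x : G)
    (hx : x ∈ g.L r) : Φ.linear x ∈ h.L r := by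
  rcases Nat.eq_zero_or_pos r with rfl | hr
  · have : h.L 1 ≤ h.L 0 := h.L_antitone (Nat.zero_le 1)
    exact this (by rw [h.L_one]; trivial)
  · have := hΦ 1 (fun _ => r) (fun _ => x) le_rfl (fun _ => hr) (fun _ => hx)
    simpa [LInftyMorphism.linear] using this

/-- The map `L r 𝔤 / L (r + 1) 𝔤 → L r 𝔥 / L (r + 1) 𝔥` induced by `Φ¹`. -/
def LInftyMorphism.grMap {g : ProNilpotentDGLieAlgebra 𝕜 G} {h : ProNilpotentDGLieAlgebra 𝕜 H}
    (Φ : LInftyMorphism g.toDGLieAlgebra h.toDGLieAlgebra) (hΦ : Φ.IsFiltered) (r : ℕ) :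
    g.Gr r →ₗ[𝕜] h.Gr r :=
  Submodule.mapQ _ _ (Φ.linear.restrict (hΦ.linear_mem r))
    (fun x hx => hΦ.linear_mem (r + 1) x hx)

theorem LInftyMorphism.grMap_grD {g : ProNilpotentDGLieAlgebra 𝕜 G}
    {h : ProNilpotentDGLieAlgebra 𝕜 H}
    (Φ : LInftyMorphism g.toDGLieAlgebra h.toDGLieAlgebra) (hΦ : Φ.IsFiltered) (r : ℕ)
    (x : g.Gr r) : Φ.grMap hΦ r (g.grD r x) = h.grD r (Φ.grMap hΦ r x) := by
  obtain ⟨x, rfl⟩ := Submodule.mkQ_surjective _ x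
  exact congrArg (Submodule.mkQ _) (Subtype.ext (Φ.linear_d x.1))

/-- A filtered `L∞`-quasi-isomorphism: a filtered `L∞`-morphism whose linear part induces
quasi-isomorphisms `L r 𝔤 / L (r + 1) 𝔤 → L r 𝔥 / L (r + 1) 𝔥` for all `r ≥ 1`. -/
def LInftyMorphism.IsFilteredQuasiIso {g : ProNilpotentDGLieAlgebra 𝕜 G}
    {h : ProNilpotentDGLieAlgebra 𝕜 H}
    (Φ : LInftyMorphism g.toDGLieAlgebra h.toDGLieAlgebra) : Prop :=
  ∃ hΦ : Φ.IsFiltered, ∀ r : ℕ, 1 ≤ r →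
    Function.Bijective
      (TotalCohomology.map (g.grD r) (h.grD r) (Φ.grMap hΦ r) (Φ.grMap_grD hΦ r))

/-- `x` is the sum of the series `∑ n, f n` in the topology of the filtration. -/
def ProNilpotentDGLieAlgebra.IsSum (g : ProNilpotentDGLieAlgebra 𝕜 G) (f : ℕ → G) (x : G) :
    Prop :=
  ∀ r : ℕ, ∃ N : ℕ, ∀ n ≥ N, x - ∑ i ∈ Finset.range n, f i ∈ g.L r

/-- Maurer-Cartan elements: `α` of degree `1` with `∂α + 1/2 [α, α] = 0`. -/
def DGLieAlgebra.MC (g : DGLieAlgebra 𝕜 G) : Type v :=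
  {α : G // α ∈ g.gr 1 ∧ g.d α + (2 : 𝕜)⁻¹ • g.bracket α α = 0}

/-- `β = exp(γ)(α)`, the time-one flow of `α` along the affine vector field
`α ↦ -∂γ + [γ, α]`, that is
`β = α + ∑_{n ≥ 0} 1 / (n+1)! * (ad γ)^n ([γ, α] - ∂γ)`. -/
def ProNilpotentDGLieAlgebra.IsGaugeTransform (g : ProNilpotentDGLieAlgebra 𝕜 G) (γ α β : G) :
    Prop :=
  g.IsSum (fun n => (((n + 1)! : ℕ) : 𝕜)⁻¹ • ((g.bracket γ) ^ n) (g.bracket γ α - g.d γ))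
    (β - α)

/-- Two Maurer-Cartan elements are equivalent if they lie in one orbit of the group
`exp(𝔤⁰)`, whose elements are the `exp(γ)` with `γ` of degree `0`. -/
def ProNilpotentDGLieAlgebra.GaugeEquiv (g : ProNilpotentDGLieAlgebra 𝕜 G)
    (α β : g.toDGLieAlgebra.MC) : Prop :=
  ∃ γ ∈ g.gr 0, g.IsGaugeTransform γ α.1 β.1

/-- `β = Φ_*(α) = ∑_{k ≥ 1} (-1)^{(k-1)(k-2)/2} / k! * Φᵏ(α, …, α)`, with the sum indexed by
`j = k - 1` (so that `(k-1)(k-2)/2` is the binomial coefficient `j` over `2`). -/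
def LInftyMorphism.IsPushforward {g : ProNilpotentDGLieAlgebra 𝕜 G}
    {h : ProNilpotentDGLieAlgebra 𝕜 H}
    (Φ : LInftyMorphism g.toDGLieAlgebra h.toDGLieAlgebra) (α : G) (β : H) : Prop :=
  h.IsSum (fun j => ((-1 : 𝕜) ^ (j.choose 2) * (((j + 1)! : ℕ) : 𝕜)⁻¹) •
    Φ.app (j + 1) (fun _ => α)) β

end ProNilpotent

/-! Because the whole algebra is `L 1`, a bracket with any element raises the filtration by at least
one. To leading order `exp(γ)(α)` therefore depends on `γ` through `-∂γ`, the curvature on `α`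
through `∂`, and `Φ_*` on `α` through `Φ¹`. Equations can thus be solved, and identities tested, one
filtration step at a time.

Differential equations replace the Baker-Campbell-Hausdorff formula. Paths are functions on `𝕜` that
are polynomial modulo each `L r`. The path `exp(Γ t)(α)` flows along the gauge field `dexp(Γ)(Γ')`
(`hasDer_gauge`), a flow is determined by its initial value (`IsFlow.eq`), and every path of gauge
fields has the form `dexp(Γ)(Γ')` (`exists_isLogFlow`). So the end point of any flow is a single
exponential applied to its starting point. This gives transitivity of `∼`.

The `L∞` relations on `(α, …, α)` express the curvature of `Φ_*(α)` through that of `α`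
(`isSum_curv_push`), so `Φ_*` preserves Maurer-Cartan elements. The relations on `(γ, α, …, α)` show
that the derivative of `Φ_*` at a Maurer-Cartan element carries gauge fields to gauge fields
(`isSum_linTerm_gaugeField`). Hence `Φ_*` maps the flow `exp(tγ)(α)` to a flow, and preserves `∼`.

Bijectivity is obstruction theory. At step `r` the error of an approximate solution is a cocycle in
the cone of `Φ¹` on `L r / L (r + 1)`; the cone is acyclic (`IsFilteredQuasiIso.exists_lift`), and a
primitive corrects the error modulo `L (r + 1)`. For surjectivity the error consists of the
curvature of `α` and the difference `exp(γ)(β) - Φ_*(α)`. For injectivity it consists of `α' -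
exp(κ)(α)` and the difference of two logarithms of gauge transformations in the target. The degree
`-1` part of the primitive acts there through the stabilizer of `Φ_*(α)` (`gauge_stabilizer`). -/

namespace ProNilpotentDGLieAlgebra

variable {𝕜 : Type u} {G : Type v} [Field 𝕜] [AddCommGroup G] [Module 𝕜 G]
  (g : ProNilpotentDGLieAlgebra 𝕜 G)

/-! ### The projections onto the homogeneous components -/

theorem mem_L_zero (x : G) : x ∈ g.L 0 :=
  g.L_antitone (Nat.zero_le 1) (by rw [g.L_one]; trivial)

theorem mem_L_one (x : G) : x ∈ g.L 1 := by rw [g.L_one]; trivial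

theorem mem_L_of_le {r s : ℕ} (hrs : r ≤ s) {x : G} (hx : x ∈ g.L s) : x ∈ g.L r :=
  g.L_antitone hrs hx

theorem bijective_coeLinearMap : Function.Bijective (DirectSum.coeLinearMap g.gr) :=
  g.isInternal

/-- The projection onto the component of degree `i`. -/
noncomputable def proj (i : ℤ) : G →ₗ[𝕜] G :=
  (g.gr i).subtype ∘ₗ DirectSum.component 𝕜 ℤ (fun j => g.gr j) i ∘ₗ
    (LinearEquiv.ofBijective (DirectSum.coeLinearMap g.gr) g.bijective_coeLinearMap).symm.toLinearMap

theorem proj_mem (i : ℤ) (x : G) : g.proj i x ∈ g.gr i :=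
  SetLike.coe_mem _

theorem proj_of_mem {i : ℤ} (j : ℤ) {x : G} (hx : x ∈ g.gr i) :
    g.proj j x = if i = j then x else 0 := by
  have h : (LinearEquiv.ofBijective (DirectSum.coeLinearMap g.gr) g.bijective_coeLinearMap).symm x =
      DirectSum.lof 𝕜 ℤ (fun j => g.gr j) i ⟨x, hx⟩ := by
    rw [LinearEquiv.symm_apply_eq]
    exact (DirectSum.coeLinearMap_lof g.gr i ⟨x, hx⟩).symm
  simp only [proj, LinearMap.comp_apply, LinearEquiv.coe_coe, h]
  split_ifs with hij
  · subst hij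
    simp [DirectSum.component.lof_self]
  · simp [DirectSum.component.of, hij]

theorem proj_eq_self {i : ℤ} {x : G} (hx : x ∈ g.gr i) : g.proj i x = x := by
  rw [g.proj_of_mem i hx, if_pos rfl]

@[elab_as_elim]
theorem gr_induction {p : G → Prop} (x : G) (mem : ∀ i, ∀ x ∈ g.gr i, p x) (zero : p 0)
    (add : ∀ x y, p x → p y → p (x + y)) : p x := by
  have hx : x ∈ ⨆ i, g.gr i := by
    rw [g.isInternal.submodule_iSup_eq_top]; trivial
  exact Submodule.iSup_induction _ (motive := p) hx mem zero add

theorem proj_mem_L (i : ℤ) (r : ℕ) {x : G} (hx : x ∈ g.L r) : g.proj i x ∈ g.L r := by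
  rw [g.L_graded r] at hx
  induction hx using Submodule.iSup_induction' with
  | mem j x hx =>
    rw [g.proj_of_mem i hx.2]
    split_ifs
    · exact hx.1
    · exact zero_mem _
  | zero => simp
  | add x y _ _ h1 h2 =>
    rw [map_add]
    exact add_mem h1 h2

theorem proj_d (i : ℤ) (x : G) : g.proj (i + 1) (g.d x) = g.d (g.proj i x) := by
  induction x using g.gr_induction with
  | mem j x hx =>
    rw [g.proj_of_mem _ hx, g.proj_of_mem _ (g.d_mem _ _ hx)]
    by_cases h : j = i <;> simp [h]
  | zero => simp
  | add x y hx hy => simp [hx, hy]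

/-! ### Sums of series -/

variable {g}

theorem eq_of_sub_mem {x y : G} (h : ∀ r, x - y ∈ g.L r) : x = y :=
  sub_eq_zero.mp (g.separated _ h)

theorem IsSum.unique {f : ℕ → G} {x y : G} (hx : g.IsSum f x) (hy : g.IsSum f y) : x = y := by
  refine eq_of_sub_mem (g := g) fun r => ?_
  obtain ⟨N, hN⟩ := hx r
  obtain ⟨M, hM⟩ := hy r
  have := sub_mem (hN (max N M) (le_max_left _ _)) (hM (max N M) (le_max_right _ _))
  simpa using this

theorem IsSum.add {f f' : ℕ → G} {x x' : G} (hx : g.IsSum f x) (hx' : g.IsSum f' x') :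
    g.IsSum (fun n => f n + f' n) (x + x') := by
  intro r
  obtain ⟨N, hN⟩ := hx r
  obtain ⟨M, hM⟩ := hx' r
  refine ⟨max N M, fun n hn => ?_⟩
  have := add_mem (hN n (le_of_max_le_left hn)) (hM n (le_of_max_le_right hn))
  rw [Finset.sum_add_distrib]
  convert this using 1
  abel

theorem IsSum.smul {f : ℕ → G} {x : G} (c : 𝕜) (hx : g.IsSum f x) :
    g.IsSum (fun n => c • f n) (c • x) := by
  intro r
  obtain ⟨N, hN⟩ := hx r
  refine ⟨N, fun n hn => ?_⟩
  rw [← Finset.smul_sum, ← smul_sub]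
  exact Submodule.smul_mem _ _ (hN n hn)

theorem IsSum.neg {f : ℕ → G} {x : G} (hx : g.IsSum f x) : g.IsSum (fun n => -f n) (-x) := by
  simpa using hx.smul (-1 : 𝕜)

theorem IsSum.sub {f f' : ℕ → G} {x x' : G} (hx : g.IsSum f x) (hx' : g.IsSum f' x') :
    g.IsSum (fun n => f n - f' n) (x - x') := by
  simpa [sub_eq_add_neg] using hx.add hx'.neg

theorem IsSum.map_d {f : ℕ → G} {x : G} (hx : g.IsSum f x) :
    g.IsSum (fun n => g.d (f n)) (g.d x) := by
  intro r
  obtain ⟨N, hN⟩ := hx r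
  refine ⟨N, fun n hn => ?_⟩
  rw [← map_sum, ← map_sub]
  exact g.d_mem_L _ _ (hN n hn)

theorem IsSum.congr {f f' : ℕ → G} {x : G} (hx : g.IsSum f x) (h : ∀ n, f n = f' n) :
    g.IsSum f' x := by
  rwa [show f' = f from funext fun n => (h n).symm]

theorem IsSum.shift {f f' : ℕ → G} {x : G} (hx : g.IsSum f x) (h0 : f' 0 = 0)
    (hs : ∀ n, f' (n + 1) = f n) : g.IsSum f' x := by
  intro r
  obtain ⟨N, hN⟩ := hx r
  refine ⟨N + 1, fun n hn => ?_⟩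
  obtain ⟨n, rfl⟩ : ∃ k, n = k + 1 := ⟨n - 1, by omega⟩
  rw [Finset.sum_range_succ', h0, add_zero]
  simp only [hs]
  exact hN n (by omega)

/-- Splitting off the first term. -/
theorem IsSum.tail {f : ℕ → G} {x : G} (hx : g.IsSum f x) :
    g.IsSum (fun n => f (n + 1)) (x - f 0) := by
  intro r
  obtain ⟨N, hN⟩ := hx r
  refine ⟨N, fun n hn => ?_⟩
  have := hN (n + 1) (by omega)
  rw [Finset.sum_range_succ'] at this
  convert this using 1
  abel

theorem IsSum.mem_L {f : ℕ → G} {x : G} {r : ℕ} (hx : g.IsSum f x) (hf : ∀ n, f n ∈ g.L r) :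
    x ∈ g.L r := by
  obtain ⟨N, hN⟩ := hx r
  have := add_mem (hN N le_rfl) (sum_mem fun i (_ : i ∈ Finset.range N) => hf i)
  simpa using this

theorem sum_range_sub_mem {f : ℕ → G} (hf : ∀ n, f n ∈ g.L n) {m n : ℕ} (hmn : m ≤ n) :
    ∑ i ∈ Finset.range n, f i - ∑ i ∈ Finset.range m, f i ∈ g.L m := by
  rw [← Finset.sum_Ico_eq_sub _ hmn]
  exact sum_mem fun i hi => g.mem_L_of_le (Finset.mem_Ico.mp hi).1 (hf i)

theorem IsSum.sub_sum_mem {f : ℕ → G} {x : G} (hx : g.IsSum f x) (hf : ∀ n, f n ∈ g.L n)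
    (n : ℕ) : x - ∑ i ∈ Finset.range n, f i ∈ g.L n := by
  obtain ⟨N, hN⟩ := hx n
  have := add_mem (hN (max N n) (le_max_left _ _))
    (sum_range_sub_mem hf (le_max_right N n))
  simpa using this

theorem exists_isSum {i : ℤ} {f : ℕ → G} (hi : ∀ n, f n ∈ g.gr i) (hf : ∀ n, f n ∈ g.L n) :
    ∃ x ∈ g.gr i, g.IsSum f x := by
  obtain ⟨y, hy, h⟩ := g.complete i (fun n => ∑ k ∈ Finset.range n, f k)
    (fun n => sum_mem fun k _ => hi k)
    (fun n => by simpa [Finset.sum_range_succ] using hf n)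
  refine ⟨y, hy, fun r => ⟨r, fun n hn => g.mem_L_of_le hn (h n)⟩⟩

/-- The Cauchy product of two series. -/
theorem IsSum.bracket {f f' : ℕ → G} {x x' : G} (hx : g.IsSum f x) (hx' : g.IsSum f' x')
    (hf : ∀ n, f n ∈ g.L n) (hf' : ∀ n, f' n ∈ g.L n) :
    g.IsSum (fun n => ∑ p ∈ Finset.HasAntidiagonal.antidiagonal n,
      g.bracket (f p.1) (f' p.2)) (g.bracket x x') := by
  refine fun r => ⟨r, fun n hn => g.mem_L_of_le hn ?_⟩
  set s := ∑ i ∈ Finset.range n, f i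
  set s' := ∑ i ∈ Finset.range n, f' i
  have h1 : g.bracket x x' - g.bracket s s' ∈ g.L n := by
    have e : g.bracket x x' - g.bracket s s' =
        g.bracket (x - s) x' + g.bracket s (x' - s') := by simp
    rw [e]
    refine add_mem (g.mem_L_of_le (Nat.le_add_right n 0)
      (g.bracket_mem_L n 0 _ _ (hx.sub_sum_mem hf n) (g.mem_L_zero _))) ?_
    exact g.mem_L_of_le (Nat.le_add_left n 0)
      (g.bracket_mem_L 0 n _ _ (g.mem_L_zero _) (hx'.sub_sum_mem hf' n))
  -- The product of partial sums runs over a square and the Cauchy partial sum over a triangle; the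
  -- remaining indices satisfy `p.1 + p.2 ≥ n`.
  have h2 : g.bracket s s' - ∑ k ∈ Finset.range n, ∑ p ∈ Finset.HasAntidiagonal.antidiagonal k,
      g.bracket (f p.1) (f' p.2) ∈ g.L n := by
    have e1 : g.bracket s s' = ∑ p ∈ Finset.range n ×ˢ Finset.range n,
        g.bracket (f p.1) (f' p.2) := by
      rw [Finset.sum_product]
      simp only [s, s', LinearMap.sum_apply, map_sum]
      exact Finset.sum_comm
    have e2 : ∑ k ∈ Finset.range n, ∑ p ∈ Finset.HasAntidiagonal.antidiagonal k, g.bracket (f p.1) (f' p.2) =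
        ∑ p ∈ (Finset.range n ×ˢ Finset.range n).filter (fun p => p.1 + p.2 < n),
          g.bracket (f p.1) (f' p.2) := by
      rw [← Finset.sum_fiberwise_of_maps_to (s := (Finset.range n ×ˢ Finset.range n).filter
        (fun p => p.1 + p.2 < n)) (t := Finset.range n) (g := fun p => p.1 + p.2)]
      · refine Finset.sum_congr rfl fun k hk => Finset.sum_congr ?_ fun _ _ => rfl
        ext p
        simp only [Finset.HasAntidiagonal.mem_antidiagonal, Finset.mem_filter, Finset.mem_product,
          Finset.mem_range] at hk ⊢
        omega
      · intro p hp
        simpa using (Finset.mem_filter.mp hp).2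
    rw [e1, e2, ← Finset.sum_filter_add_sum_filter_not (Finset.range n ×ˢ Finset.range n)
      (fun p => p.1 + p.2 < n), add_sub_cancel_left]
    refine sum_mem fun p hp => ?_
    have hp' := (Finset.mem_filter.mp hp).2
    exact g.mem_L_of_le (not_lt.mp hp') (g.bracket_mem_L _ _ _ _ (hf _) (hf' _))
  simpa using add_mem h1 h2

end ProNilpotentDGLieAlgebra

/-! ### Polynomial functions with values in a vector space, and their derivatives -/

section PolyDer

variable {𝕜 : Type*} {M N P : Type*} [Field 𝕜] [AddCommGroup M] [Module 𝕜 M]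
  [AddCommGroup N] [Module 𝕜 N] [AddCommGroup P] [Module 𝕜 P]

/-- The pairs `(p, p')` of a polynomial function and its formal derivative. -/
def polyPair (𝕜 M : Type*) [Field 𝕜] [AddCommGroup M] [Module 𝕜 M] :
    Submodule 𝕜 ((𝕜 → M) × (𝕜 → M)) :=
  Submodule.span 𝕜
    {q | ∃ (k : ℕ) (c : M), q = (fun t => t ^ k • c, fun t => ((k : 𝕜) * t ^ (k - 1)) • c)}

/-- `p'` is the formal derivative of the polynomial function `p`. -/
def PolyDer (p p' : 𝕜 → M) : Prop := (p, p') ∈ polyPair 𝕜 M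

theorem PolyDer.monomial (k : ℕ) (c : M) :
    PolyDer (fun t : 𝕜 => t ^ k • c) (fun t => ((k : 𝕜) * t ^ (k - 1)) • c) :=
  Submodule.subset_span ⟨k, c, rfl⟩

theorem PolyDer.zero : PolyDer (fun _ : 𝕜 => (0 : M)) (fun _ => 0) := zero_mem (polyPair 𝕜 M)

theorem PolyDer.add {p p' q q' : 𝕜 → M} (hp : PolyDer p p') (hq : PolyDer q q') :
    PolyDer (fun t => p t + q t) (fun t => p' t + q' t) := add_mem (S := Submodule 𝕜 _) hp hq

theorem PolyDer.smul {p p' : 𝕜 → M} (a : 𝕜) (hp : PolyDer p p') :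
    PolyDer (fun t => a • p t) (fun t => a • p' t) := Submodule.smul_mem (polyPair 𝕜 M) a hp

theorem PolyDer.sub {p p' q q' : 𝕜 → M} (hp : PolyDer p p') (hq : PolyDer q q') :
    PolyDer (fun t => p t - q t) (fun t => p' t - q' t) := sub_mem (S := Submodule 𝕜 _) hp hq

theorem PolyDer.const (c : M) : PolyDer (fun _ : 𝕜 => c) (fun _ => 0) := by
  simpa using PolyDer.monomial (𝕜 := 𝕜) 0 c

theorem PolyDer.congr {p p' q q' : 𝕜 → M} (hp : PolyDer p p') (h : ∀ t, p t = q t)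
    (h' : ∀ t, p' t = q' t) : PolyDer q q' := by
  rwa [← funext h, ← funext h']

@[elab_as_elim]
theorem PolyDer.induction {Q : ∀ p p' : 𝕜 → M, PolyDer p p' → Prop}
    (monomial : ∀ (k : ℕ) (c : M), Q _ _ (.monomial k c)) (zero : Q _ _ .zero)
    (add : ∀ (p p' q q' : 𝕜 → M) (hp : PolyDer p p') (hq : PolyDer q q'),
      Q p p' hp → Q q q' hq → Q _ _ (hp.add hq))
    (smul : ∀ (a : 𝕜) (p p' : 𝕜 → M) (hp : PolyDer p p'), Q p p' hp → Q _ _ (hp.smul a))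
    {p p' : 𝕜 → M} (h : PolyDer p p') : Q p p' h := by
  refine Submodule.span_induction (s := {q | ∃ (k : ℕ) (c : M), q = (fun t => t ^ k • c,
    fun t => ((k : 𝕜) * t ^ (k - 1)) • c)})
    (p := fun x hx => Q x.1 x.2 (show PolyDer x.1 x.2 from hx)) ?_ zero ?_ ?_ h
  · rintro _ ⟨k, c, rfl⟩
    exact monomial k c
  · intro x y hx hy h1 h2
    exact add _ _ _ _ hx hy h1 h2
  · intro a x hx h1
    exact smul _ _ _ hx h1

theorem PolyDer.map (T : M →ₗ[𝕜] N) {p p' : 𝕜 → M} (h : PolyDer p p') :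
    PolyDer (fun t => T (p t)) (fun t => T (p' t)) := by
  induction h using PolyDer.induction with
  | monomial k c => simpa using PolyDer.monomial k (T c)
  | zero => simpa using PolyDer.zero
  | add p p' q q' _ _ hp hq => simpa using hp.add hq
  | smul a p p' _ hp => simpa using hp.smul a

theorem PolyDer.pow_smul (k : ℕ) {p p' : 𝕜 → M} (h : PolyDer p p') :
    PolyDer (fun t => t ^ k • p t) (fun t => ((k : 𝕜) * t ^ (k - 1)) • p t + t ^ k • p' t) := by
  induction h using PolyDer.induction with
  | monomial l c =>
    refine (PolyDer.monomial (k + l) c).congr (fun t => by rw [smul_smul, pow_add]) fun t => ?_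
    rw [smul_smul, smul_smul, ← add_smul]
    congr 1
    -- The truncated exponents `k - 1` and `l - 1` are wrong at zero, where the coefficient `k` or
    -- `l` vanishes anyway.
    rcases k with _ | k
    · simp
    rcases l with _ | l
    · simp
    simp only [Nat.add_sub_cancel, Nat.cast_add, Nat.cast_one,
      show k + 1 + (l + 1) - 1 = k + l + 1 by omega]
    ring
  | zero => simpa using PolyDer.zero
  | add p p' q q' _ _ hp hq =>
    refine (hp.add hq).congr (fun t => by rw [smul_add]) fun t => ?_
    simp only [smul_add]
    abel
  | smul a p p' _ hp =>
    refine (hp.smul a).congr (fun t => by rw [smul_comm]) fun t => ?_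
    rw [smul_add, smul_comm a, smul_comm a]

theorem PolyDer.bilin (B : M →ₗ[𝕜] N →ₗ[𝕜] P) {p p' : 𝕜 → M} {q q' : 𝕜 → N}
    (hp : PolyDer p p') (hq : PolyDer q q') :
    PolyDer (fun t => B (p t) (q t)) (fun t => B (p' t) (q t) + B (p t) (q' t)) := by
  induction hp using PolyDer.induction with
  | monomial k c => simpa using (hq.map (B c)).pow_smul k
  | zero => simpa using PolyDer.zero
  | add p p' r r' _ _ hp hr =>
    refine (hp.add hr).congr (fun t => by simp) fun t => ?_
    simp only [map_add, LinearMap.add_apply]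
    abel
  | smul a p p' _ hp => simpa using hp.smul a

theorem PolyDer.multilinear {n : ℕ} (F : MultilinearMap 𝕜 (fun _ : Fin n => M) N)
    {p p' : Fin n → 𝕜 → M} (h : ∀ i, PolyDer (p i) (p' i)) :
    PolyDer (fun t => F (fun i => p i t))
      (fun t => ∑ j, F (Function.update (fun i => p i t) j (p' j t))) := by
  induction n with
  | zero =>
    refine (PolyDer.const (F Fin.elim0)).congr (fun t => ?_) (fun t => by simp)
    congr 1
    exact Subsingleton.elim _ _
  | succ n ih =>
    -- The first argument is split off by currying. By linearity it may be a monomial, and then the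
    -- product rule with a power of `t` applies to the remaining `n` arguments.
    have key : ∀ f f' : 𝕜 → M, PolyDer f f' →
        PolyDer (fun t => F.curryLeft (f t) (fun i => p i.succ t))
          (fun t => F.curryLeft (f' t) (fun i => p i.succ t) +
            ∑ j : Fin n, F.curryLeft (f t)
              (Function.update (fun i => p i.succ t) j (p' j.succ t))) := by
      intro f f' hf
      induction hf using PolyDer.induction with
      | monomial k c =>
        simpa [Finset.smul_sum] using
          (ih (F.curryLeft c) (fun i => h i.succ)).pow_smul k
      | zero => simpa using PolyDer.zero
      | add p p' r r' _ _ hp hr =>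
        refine (hp.add hr).congr (fun t => by simp) fun t => ?_
        simp only [map_add, add_apply, Finset.sum_add_distrib]
        abel
      | smul a p p' _ hp => simpa [Finset.smul_sum] using hp.smul a
    have hcons : ∀ t, (fun i => p i t) = Fin.cons (p 0 t) (fun i : Fin n => p i.succ t) := by
      intro t
      funext i
      refine Fin.cases ?_ (fun i => ?_) i <;> simp
    refine (key _ _ (h 0)).congr (fun t => ?_) fun t => ?_
    · rw [hcons, MultilinearMap.curryLeft_apply]
    · rw [Fin.sum_univ_succ, hcons, Fin.update_cons_zero, MultilinearMap.curryLeft_apply]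
      congr 1
      refine Finset.sum_congr rfl fun j _ => ?_
      rw [MultilinearMap.curryLeft_apply, Fin.cons_update]

theorem PolyDer.exists_integral [CharZero 𝕜] {p p' : 𝕜 → M} (h : PolyDer p p') :
    ∃ q, PolyDer q p ∧ q 0 = 0 := by
  induction h using PolyDer.induction with
  | monomial k c =>
    refine ⟨_, ((PolyDer.monomial (k + 1) c).smul ((k + 1 : ℕ) : 𝕜)⁻¹).congr (fun _ => rfl)
      fun t => ?_, by simp⟩
    rw [smul_smul, ← mul_assoc, inv_mul_cancel₀ (Nat.cast_ne_zero.mpr k.succ_ne_zero), one_mul,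
      Nat.add_sub_cancel]
  | zero => exact ⟨_, PolyDer.zero, rfl⟩
  | add p p' q q' _ _ hp hq =>
    obtain ⟨_, hp, hp0⟩ := hp
    obtain ⟨_, hq, hq0⟩ := hq
    exact ⟨_, hp.add hq, by simp [hp0, hq0]⟩
  | smul a p p' _ hp =>
    obtain ⟨_, hp, hp0⟩ := hp
    exact ⟨_, hp.smul a, by simp [hp0]⟩

theorem PolyDer.exists_polynomial {p p' : 𝕜 → 𝕜} (h : PolyDer p p') :
    ∃ f : Polynomial 𝕜, ∀ t, p t = f.eval t ∧ p' t = f.derivative.eval t := by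
  induction h using PolyDer.induction with
  | monomial k c =>
    refine ⟨Polynomial.monomial k c, fun t => ⟨?_, ?_⟩⟩
    · simp [mul_comm]
    · simp [Polynomial.derivative_monomial]
      ring
  | zero => exact ⟨0, by simp⟩
  | add p p' q q' _ _ hp hq =>
    obtain ⟨f, hf⟩ := hp
    obtain ⟨f', hf'⟩ := hq
    exact ⟨f + f', fun t => by simp [hf t, hf' t]⟩
  | smul a p p' _ hp =>
    obtain ⟨f, hf⟩ := hp
    exact ⟨a • f, fun t => by simp [hf t]⟩

/-- Functionals on `M / W` separate points. This reduces statements about vector-valued polynomial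
functions to scalar polynomials. -/
theorem mem_of_forall_dual (W : Submodule 𝕜 M) (x : M)
    (h : ∀ ψ : M →ₗ[𝕜] 𝕜, (∀ w ∈ W, ψ w = 0) → ψ x = 0) : x ∈ W := by
  rw [← Submodule.Quotient.mk_eq_zero W, ← Module.forall_dual_apply_eq_zero_iff 𝕜]
  intro ψ
  refine h (ψ ∘ₗ W.mkQ) fun w hw => ?_
  simp [(Submodule.Quotient.mk_eq_zero W).mpr hw]

/-- A functional killing `W` turns `p` into a scalar polynomial whose derivative vanishes at every
point of an infinite field. In characteristic zero such a polynomial is constant. -/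
theorem PolyDer.sub_mem_of_derivative_mem [CharZero 𝕜] (W : Submodule 𝕜 M) {p p' : 𝕜 → M}
    (h : PolyDer p p') (hW : ∀ t, p' t ∈ W) (t : 𝕜) : p t - p 0 ∈ W := by
  refine mem_of_forall_dual W _ fun ψ hψ => ?_
  obtain ⟨f, hf⟩ := (h.map ψ).exists_polynomial
  have h0 : f.derivative = 0 := Polynomial.funext fun t => by
    rw [← (hf t).2, hψ _ (hW t), Polynomial.eval_zero]
  rw [Polynomial.eq_C_of_derivative_eq_zero h0] at hf
  rw [map_sub, (hf t).1, (hf 0).1]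
  simp

/-- This makes the derivative of a function that is only polynomial modulo `W` well defined modulo
`W`. -/
theorem PolyDer.derivative_mem [CharZero 𝕜] (W : Submodule 𝕜 M) {p p' : 𝕜 → M}
    (h : PolyDer p p') (hW : ∀ t, p t ∈ W) (t : 𝕜) : p' t ∈ W := by
  refine mem_of_forall_dual W _ fun ψ hψ => ?_
  obtain ⟨f, hf⟩ := (h.map ψ).exists_polynomial
  have h0 : f = 0 := Polynomial.funext fun t => by
    rw [← (hf t).1, hψ _ (hW t), Polynomial.eval_zero]
  rw [(hf t).2, h0]
  simp

/-- Expanding `F` at `ξ' + (ξ - ξ')`, every term except `F ξ'` has an argument in `W`. -/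
theorem MultilinearMap.sub_mem_of_forall {ι : Type*} [Fintype ι] [DecidableEq ι]
    (F : MultilinearMap 𝕜 (fun _ : ι => M) N) (W : Submodule 𝕜 M) (W' : Submodule 𝕜 N)
    (hF : ∀ (ξ : ι → M) (j : ι), ξ j ∈ W → F ξ ∈ W') {ξ ξ' : ι → M}
    (h : ∀ i, ξ i - ξ' i ∈ W) : F ξ - F ξ' ∈ W' := by
  have e : ξ = (fun i => ξ i - ξ' i) + ξ' := by
    funext i
    simp
  rw [e, MultilinearMap.map_add_univ, ← Finset.add_sum_erase _ _ (Finset.mem_univ ∅),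
    Finset.piecewise_empty, add_sub_cancel_left]
  refine sum_mem fun s hs => ?_
  obtain ⟨j, hj⟩ := Finset.nonempty_iff_ne_empty.mpr (Finset.ne_of_mem_erase hs)
  refine hF _ j ?_
  rw [Finset.piecewise_eq_of_mem _ _ _ hj]
  exact h j

end PolyDer

/-! ### Paths in a pro-nilpotent DG Lie algebra -/

namespace ProNilpotentDGLieAlgebra

variable {𝕜 : Type u} {G : Type v} {H : Type w} [Field 𝕜]
  [AddCommGroup G] [Module 𝕜 G] [AddCommGroup H] [Module 𝕜 H]
  (g : ProNilpotentDGLieAlgebra 𝕜 G) (h : ProNilpotentDGLieAlgebra 𝕜 H)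

/-- `f` is polynomial modulo every step of the filtration. -/
def IsPath (f : 𝕜 → G) : Prop :=
  ∀ r, ∃ p p', PolyDer p p' ∧ ∀ t, f t - p t ∈ g.L r

/-- `f` is polynomial, with derivative `f'`, modulo every step of the filtration. -/
def HasDer (f f' : 𝕜 → G) : Prop :=
  ∀ r, ∃ p p', PolyDer p p' ∧ ∀ t, f t - p t ∈ g.L r ∧ f' t - p' t ∈ g.L r

variable {g h}

theorem HasDer.isPath {f f' : 𝕜 → G} (hf : g.HasDer f f') : g.IsPath f := by
  intro r
  obtain ⟨p, p', hp, h⟩ := hf r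
  exact ⟨p, p', hp, fun t => (h t).1⟩

theorem HasDer.congr {f f' k k' : 𝕜 → G} (hf : g.HasDer f f') (h : ∀ t, f t = k t)
    (h' : ∀ t, f' t = k' t) : g.HasDer k k' := by
  rwa [← funext h, ← funext h']

theorem HasDer.of_polyDer {p p' : 𝕜 → G} (h : PolyDer p p') : g.HasDer p p' :=
  fun r => ⟨p, p', h, fun t => by simp⟩

theorem HasDer.const (c : G) : g.HasDer (fun _ => c) (fun _ => 0) :=
  .of_polyDer (.const c)

theorem HasDer.id_smul (c : G) : g.HasDer (fun t => t • c) (fun _ => c) :=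
  .of_polyDer (by simpa using PolyDer.monomial (𝕜 := 𝕜) 1 c)

theorem HasDer.add {f f' k k' : 𝕜 → G} (hf : g.HasDer f f') (hk : g.HasDer k k') :
    g.HasDer (fun t => f t + k t) (fun t => f' t + k' t) := by
  intro r
  obtain ⟨p, p', hp, h⟩ := hf r
  obtain ⟨q, q', hq, h'⟩ := hk r
  refine ⟨_, _, hp.add hq, fun t => ⟨?_, ?_⟩⟩
  · rw [add_sub_add_comm]
    exact add_mem (h t).1 (h' t).1
  · rw [add_sub_add_comm]
    exact add_mem (h t).2 (h' t).2

theorem HasDer.smul {f f' : 𝕜 → G} (a : 𝕜) (hf : g.HasDer f f') :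
    g.HasDer (fun t => a • f t) (fun t => a • f' t) := by
  intro r
  obtain ⟨p, p', hp, h⟩ := hf r
  refine ⟨_, _, hp.smul a, fun t => ⟨?_, ?_⟩⟩
  · rw [← smul_sub]
    exact Submodule.smul_mem _ _ (h t).1
  · rw [← smul_sub]
    exact Submodule.smul_mem _ _ (h t).2

theorem HasDer.neg {f f' : 𝕜 → G} (hf : g.HasDer f f') :
    g.HasDer (fun t => -f t) (fun t => -f' t) := by
  simpa using hf.smul (-1)

theorem HasDer.sub {f f' k k' : 𝕜 → G} (hf : g.HasDer f f') (hk : g.HasDer k k') :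
    g.HasDer (fun t => f t - k t) (fun t => f' t - k' t) := by
  simpa [sub_eq_add_neg] using hf.add hk.neg

theorem HasDer.sum {ι : Type*} (s : Finset ι) {f f' : ι → 𝕜 → G}
    (hf : ∀ i ∈ s, g.HasDer (f i) (f' i)) :
    g.HasDer (fun t => ∑ i ∈ s, f i t) (fun t => ∑ i ∈ s, f' i t) := by
  classical
  induction s using Finset.induction_on with
  | empty => simpa using HasDer.const 0
  | insert a s ha ih =>
    simpa [Finset.sum_insert ha] using (hf a (Finset.mem_insert_self a s)).add
      (ih fun i hi => hf i (Finset.mem_insert_of_mem hi))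

theorem HasDer.map {T : G →ₗ[𝕜] G} (hT : ∀ r, ∀ x ∈ g.L r, T x ∈ g.L r) {f f' : 𝕜 → G}
    (hf : g.HasDer f f') : g.HasDer (fun t => T (f t)) (fun t => T (f' t)) := by
  intro r
  obtain ⟨p, p', hp, h⟩ := hf r
  refine ⟨_, _, hp.map T, fun t => ⟨?_, ?_⟩⟩
  · rw [← map_sub]
    exact hT _ _ (h t).1
  · rw [← map_sub]
    exact hT _ _ (h t).2

theorem HasDer.map_d {f f' : 𝕜 → G} (hf : g.HasDer f f') :
    g.HasDer (fun t => g.d (f t)) (fun t => g.d (f' t)) :=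
  hf.map g.d_mem_L

theorem bracket_mem_left {r : ℕ} {x : G} (y : G) (hx : x ∈ g.L r) : g.bracket x y ∈ g.L r :=
  g.bracket_mem_L r 0 _ _ hx (g.mem_L_zero y)

theorem bracket_mem_right {r : ℕ} (x : G) {y : G} (hy : y ∈ g.L r) : g.bracket x y ∈ g.L r := by
  simpa using g.bracket_mem_L 0 r _ _ (g.mem_L_zero x) hy

theorem bracket_mem_left_succ {r : ℕ} {x : G} (y : G) (hx : x ∈ g.L r) :
    g.bracket x y ∈ g.L (r + 1) :=
  g.bracket_mem_L r 1 _ _ hx (g.mem_L_one y)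

theorem bracket_mem_right_succ {r : ℕ} (x : G) {y : G} (hy : y ∈ g.L r) :
    g.bracket x y ∈ g.L (r + 1) := by
  simpa [add_comm] using g.bracket_mem_L 1 r _ _ (g.mem_L_one x) hy

theorem bracket_sub_mem {r : ℕ} {x x' y y' : G} (hx : x - x' ∈ g.L r) (hy : y - y' ∈ g.L r) :
    g.bracket x y - g.bracket x' y' ∈ g.L r := by
  have e : g.bracket x y - g.bracket x' y' = g.bracket (x - x') y + g.bracket x' (y - y') := by
    simp
  rw [e]
  exact add_mem (bracket_mem_left _ hx) (bracket_mem_right _ hy)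

theorem bracket_sub_mem_succ {r : ℕ} {x x' y y' : G} (hx : x - x' ∈ g.L r)
    (hy : y - y' ∈ g.L r) : g.bracket x y - g.bracket x' y' ∈ g.L (r + 1) := by
  have e : g.bracket x y - g.bracket x' y' = g.bracket (x - x') y + g.bracket x' (y - y') := by
    simp
  rw [e]
  exact add_mem (bracket_mem_left_succ _ hx) (bracket_mem_right_succ _ hy)

theorem HasDer.bracket {f f' k k' : 𝕜 → G} (hf : g.HasDer f f') (hk : g.HasDer k k') :
    g.HasDer (fun t => g.bracket (f t) (k t))
      (fun t => g.bracket (f' t) (k t) + g.bracket (f t) (k' t)) := by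
  intro r
  obtain ⟨p, p', hp, h⟩ := hf r
  obtain ⟨q, q', hq, h'⟩ := hk r
  refine ⟨_, _, hp.bilin g.bracket hq, fun t => ⟨bracket_sub_mem (h t).1 (h' t).1, ?_⟩⟩
  rw [add_sub_add_comm]
  exact add_mem (bracket_sub_mem (h t).2 (h' t).1) (bracket_sub_mem (h t).1 (h' t).2)

theorem HasDer.multilinear {n : ℕ} {F : MultilinearMap 𝕜 (fun _ : Fin n => G) H}
    (hF : ∀ (r : ℕ) (ξ : Fin n → G) (j : Fin n), ξ j ∈ g.L r → F ξ ∈ h.L r)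
    {f f' : Fin n → 𝕜 → G} (hf : ∀ i, g.HasDer (f i) (f' i)) :
    h.HasDer (fun t => F (fun i => f i t))
      (fun t => ∑ j, F (Function.update (fun i => f i t) j (f' j t))) := by
  intro r
  choose p p' hp hfp using fun i => hf i r
  refine ⟨_, _, PolyDer.multilinear F hp, fun t => ⟨?_, ?_⟩⟩
  · exact F.sub_mem_of_forall (g.L r) (h.L r) (hF r) fun i => (hfp i t).1
  · rw [← Finset.sum_sub_distrib]
    refine sum_mem fun j _ => F.sub_mem_of_forall (g.L r) (h.L r) (hF r) fun i => ?_
    by_cases hij : i = j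
    · subst hij
      simpa using (hfp i t).2
    · simpa [hij] using (hfp i t).1

theorem HasDer.isSum {f f' : ℕ → 𝕜 → G} {F F' : 𝕜 → G} (hf : ∀ n, g.HasDer (f n) (f' n))
    (hfL : ∀ n t, f n t ∈ g.L n) (hfL' : ∀ n t, f' n t ∈ g.L n)
    (hF : ∀ t, g.IsSum (fun n => f n t) (F t)) (hF' : ∀ t, g.IsSum (fun n => f' n t) (F' t)) :
    g.HasDer F F' := by
  intro r
  obtain ⟨p, p', hp, h⟩ := HasDer.sum (Finset.range r) (fun n _ => hf n) r
  refine ⟨p, p', hp, fun t => ⟨?_, ?_⟩⟩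
  · simpa using add_mem ((hF t).sub_sum_mem (fun n => hfL n t) r) (h t).1
  · simpa using add_mem ((hF' t).sub_sum_mem (fun n => hfL' n t) r) (h t).2

theorem IsPath.of_forall {f : 𝕜 → G} (hf : ∀ r, ∃ k, g.IsPath k ∧ ∀ t, f t - k t ∈ g.L r) :
    g.IsPath f := by
  intro r
  obtain ⟨k, hk, hfk⟩ := hf r
  obtain ⟨p, p', hp, h⟩ := hk r
  exact ⟨p, p', hp, fun t => by simpa using add_mem (hfk t) (h t)⟩

theorem IsPath.isSum {f : ℕ → 𝕜 → G} {F : 𝕜 → G} (hf : ∀ n, ∃ f', g.HasDer (f n) f')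
    (hfL : ∀ n t, f n t ∈ g.L n) (hF : ∀ t, g.IsSum (fun n => f n t) (F t)) : g.IsPath F := by
  choose f' hf' using hf
  exact .of_forall fun r => ⟨_, (HasDer.sum (Finset.range r) (fun n _ => hf' n)).isPath,
    fun t => (hF t).sub_sum_mem (fun n => hfL n t) r⟩

theorem IsPath.exists_homogeneous {i : ℤ} {f : 𝕜 → G} (hf : g.IsPath f)
    (hi : ∀ t, f t ∈ g.gr i) (r : ℕ) :
    ∃ p p', PolyDer p p' ∧ (∀ t, p t ∈ g.gr i ∧ p' t ∈ g.gr i) ∧ ∀ t, f t - p t ∈ g.L r := by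
  obtain ⟨p, p', hp, h⟩ := hf r
  refine ⟨_, _, hp.map (g.proj i), fun t => ⟨g.proj_mem _ _, g.proj_mem _ _⟩, fun t => ?_⟩
  rw [← g.proj_eq_self (hi t), ← map_sub]
  exact g.proj_mem_L _ _ (h t)

theorem exists_limit {i : ℤ} {f : ℕ → 𝕜 → G} (hi : ∀ n t, f n t ∈ g.gr i)
    (hf : ∀ n t, f (n + 1) t - f n t ∈ g.L n) :
    ∃ k : 𝕜 → G, (∀ t, k t ∈ g.gr i) ∧ ∀ n t, k t - f n t ∈ g.L n := by
  choose k hk h using fun t => g.complete i (fun n => f n t) (fun n => hi n t) (fun n => hf n t)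
  exact ⟨k, hk, fun n t => h t n⟩

/-! ### Differentiation and integration of paths -/

section CharZero

variable [CharZero 𝕜]

theorem HasDer.sub_mem_of_derivative_mem {f f' : 𝕜 → G} (hf : g.HasDer f f') {r : ℕ}
    (hr : ∀ t, f' t ∈ g.L r) (t : 𝕜) : f t - f 0 ∈ g.L r := by
  obtain ⟨p, p', hp, h⟩ := hf r
  have h1 := hp.sub_mem_of_derivative_mem (g.L r)
    (fun t => by simpa using sub_mem (hr t) (h t).2) t
  have e : f t - f 0 = (f t - p t) - (f 0 - p 0) + (p t - p 0) := by abel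
  rw [e]
  exact add_mem (sub_mem (h t).1 (h 0).1) h1

/-- Polynomial approximations modulo successive steps agree modulo `L n`, hence so do their
derivatives, which converge. Completeness holds degree by degree, so the approximations are first
projected to degree `i`. -/
theorem IsPath.exists_hasDer {i : ℤ} {f : 𝕜 → G} (hf : g.IsPath f) (hi : ∀ t, f t ∈ g.gr i) :
    ∃ f', g.HasDer f f' ∧ ∀ t, f' t ∈ g.gr i := by
  choose p p' hp hpi hfp using hf.exists_homogeneous hi
  have hpL : ∀ n t, p (n + 1) t - p n t ∈ g.L n := fun n t => by
    simpa using sub_mem (hfp n t) (g.mem_L_of_le n.le_succ (hfp (n + 1) t))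
  obtain ⟨f', hf'i, hf'⟩ := exists_limit (f := p') (fun n t => (hpi n t).2)
    (fun n => ((hp (n + 1)).sub (hp n)).derivative_mem (g.L n) (hpL n))
  exact ⟨f', fun r => ⟨p r, p' r, hp r, fun t => ⟨hfp r t, hf' r t⟩⟩, hf'i⟩

theorem IsPath.exists_integral {i : ℤ} {f : 𝕜 → G} (hf : g.IsPath f) (hi : ∀ t, f t ∈ g.gr i)
    {c : G} (hc : c ∈ g.gr i) : ∃ F, g.HasDer F f ∧ F 0 = c ∧ ∀ t, F t ∈ g.gr i := by
  choose p p' hp hpi hfp using hf.exists_homogeneous hi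
  have hpL : ∀ n t, p (n + 1) t - p n t ∈ g.L n := fun n t => by
    simpa using sub_mem (hfp n t) (g.mem_L_of_le n.le_succ (hfp (n + 1) t))
  choose q hq hq0 using fun n => (hp n).exists_integral
  have hqi : ∀ n t, q n t ∈ g.gr i := fun n t => by
    simpa [hq0] using (hq n).sub_mem_of_derivative_mem (g.gr i) (fun t => (hpi n t).1) t
  obtain ⟨F, hFi, hF⟩ := exists_limit (f := q) hqi fun n t => by
    simpa [hq0] using
      ((hq (n + 1)).sub (hq n)).sub_mem_of_derivative_mem (g.L n) (hpL n) t
  have hF0 : F 0 = 0 := g.separated _ fun r => by simpa [hq0] using hF r 0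
  have hD : g.HasDer F f := fun r => ⟨q r, p r, hq r, fun t => ⟨hF r t, hfp r t⟩⟩
  exact ⟨fun t => F t + c, (hD.add (HasDer.const c)).congr (fun _ => rfl) (fun t => by simp),
    by simp [hF0], fun t => add_mem (hFi t) hc⟩

end CharZero

end ProNilpotentDGLieAlgebra

/-! ### The gauge action -/

namespace ProNilpotentDGLieAlgebra

variable {𝕜 : Type u} {G : Type v} [Field 𝕜] [AddCommGroup G] [Module 𝕜 G]
  (g : ProNilpotentDGLieAlgebra 𝕜 G)

/-- The operator `∑ (ad γ)ⁿ / (n+1)! = (e^{ad γ} - 1) / ad γ`. -/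
noncomputable def dexp (γ y : G) : G :=
  Classical.epsilon (g.IsSum fun n => (((n + 1)! : ℕ) : 𝕜)⁻¹ • ((g.bracket γ) ^ n) y)

/-- The element `exp(γ)(α)`. -/
noncomputable def gauge (γ α : G) : G := α + g.dexp γ (g.bracket γ α - g.d γ)

variable {g}

theorem bracket_pow_succ (γ y : G) (n : ℕ) :
    ((g.bracket γ) ^ (n + 1)) y = g.bracket γ (((g.bracket γ) ^ n) y) := by
  rw [pow_succ']
  rfl

theorem bracket_pow_mem_L (γ : G) {y : G} {r : ℕ} (hy : y ∈ g.L r) (n : ℕ) :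
    ((g.bracket γ) ^ n) y ∈ g.L (r + n) := by
  induction n with
  | zero => simpa using hy
  | succ n ih =>
    rw [bracket_pow_succ]
    exact bracket_mem_right_succ _ ih

theorem bracket_zero_mem {γ y : G} {i : ℤ} (hγ : γ ∈ g.gr 0) (hy : y ∈ g.gr i) :
    g.bracket γ y ∈ g.gr i := by
  simpa using g.bracket_mem 0 i γ y hγ hy

theorem d_zero_mem {γ : G} (hγ : γ ∈ g.gr 0) : g.d γ ∈ g.gr 1 := by
  simpa using g.d_mem 0 γ hγ

theorem bracket_pow_mem_gr {γ y : G} {i : ℤ} (hγ : γ ∈ g.gr 0) (hy : y ∈ g.gr i) (n : ℕ) :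
    ((g.bracket γ) ^ n) y ∈ g.gr i := by
  induction n with
  | zero => simpa using hy
  | succ n ih =>
    rw [bracket_pow_succ]
    exact bracket_zero_mem hγ ih

theorem bracket_pow_sub_mem {γ γ' y y' : G} {r : ℕ} (hγ : γ' - γ ∈ g.L r) (hy : y' - y ∈ g.L r)
    (n : ℕ) : ((g.bracket γ') ^ n) y' - ((g.bracket γ) ^ n) y ∈ g.L (r + n) := by
  induction n with
  | zero => simpa using hy
  | succ n ih =>
    rw [bracket_pow_succ, bracket_pow_succ]
    have e : g.bracket γ' (((g.bracket γ') ^ n) y') - g.bracket γ (((g.bracket γ) ^ n) y) =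
        g.bracket (γ' - γ) (((g.bracket γ') ^ n) y') +
          g.bracket γ (((g.bracket γ') ^ n) y' - ((g.bracket γ) ^ n) y) := by simp
    rw [e]
    refine add_mem (g.mem_L_of_le (by omega) (g.bracket_mem_L r (1 + n) _ _ hγ
      (bracket_pow_mem_L γ' (g.mem_L_one y') n))) (bracket_mem_right_succ _ ih)

theorem exists_isSum_dexp {γ y : G} {i : ℤ} (hγ : γ ∈ g.gr 0) (hy : y ∈ g.gr i) :
    ∃ x ∈ g.gr i, g.IsSum (fun n => (((n + 1)! : ℕ) : 𝕜)⁻¹ • ((g.bracket γ) ^ n) y) x :=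
  exists_isSum (fun n => Submodule.smul_mem _ _ (bracket_pow_mem_gr hγ hy n))
    (fun n => Submodule.smul_mem _ _ (by simpa using bracket_pow_mem_L γ (g.mem_L_zero y) n))

theorem isSum_dexp {γ y : G} {i : ℤ} (hγ : γ ∈ g.gr 0) (hy : y ∈ g.gr i) :
    g.IsSum (fun n => (((n + 1)! : ℕ) : 𝕜)⁻¹ • ((g.bracket γ) ^ n) y) (g.dexp γ y) := by
  obtain ⟨x, _, hx⟩ := exists_isSum_dexp hγ hy
  exact Classical.epsilon_spec (p := g.IsSum _) ⟨x, hx⟩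

theorem dexp_mem {γ y : G} {i : ℤ} (hγ : γ ∈ g.gr 0) (hy : y ∈ g.gr i) :
    g.dexp γ y ∈ g.gr i := by
  obtain ⟨x, hxi, hx⟩ := exists_isSum_dexp hγ hy
  rwa [(isSum_dexp hγ hy).unique hx]

theorem dexp_eq_of_bracket_eq_zero {γ y : G} {i : ℤ} (hγ : γ ∈ g.gr 0) (hy : y ∈ g.gr i)
    (h : g.bracket γ y = 0) : g.dexp γ y = y := by
  refine (isSum_dexp hγ hy).unique fun r => ⟨1, fun n hn => ?_⟩
  obtain ⟨n, rfl⟩ : ∃ k, n = k + 1 := ⟨n - 1, by omega⟩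
  rw [Finset.sum_range_succ', Finset.sum_eq_zero]
  · simp
  · intro k _
    rw [pow_succ]
    simp [Module.End.mul_apply, h]

/-- To leading order `dexp` is the identity in its second argument: each term with `n ≥ 1` contains
a bracket and gains a filtration step. This is what makes the fixed-point and correction arguments
converge. -/
theorem dexp_sub_mem {γ γ' y y' : G} {i : ℤ} {r : ℕ} (hγ : γ ∈ g.gr 0) (hγ' : γ' ∈ g.gr 0)
    (hy : y ∈ g.gr i) (hy' : y' ∈ g.gr i) (h1 : γ' - γ ∈ g.L r) (h2 : y' - y ∈ g.L r) :
    g.dexp γ' y' - g.dexp γ y - (y' - y) ∈ g.L (r + 1) := by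
  have h := ((isSum_dexp hγ' hy').tail.sub (isSum_dexp hγ hy).tail).mem_L (r := r + 1) ?_
  · convert h using 1
    simp
    abel
  · intro n
    rw [← smul_sub]
    exact Submodule.smul_mem _ _
      (g.mem_L_of_le (by omega) (bracket_pow_sub_mem h1 h2 (n + 1)))

theorem gaugeField_mem {γ α : G} (hγ : γ ∈ g.gr 0) (hα : α ∈ g.gr 1) :
    g.bracket γ α - g.d γ ∈ g.gr 1 :=
  sub_mem (bracket_zero_mem hγ hα) (d_zero_mem hγ)

theorem gauge_mem {γ α : G} (hγ : γ ∈ g.gr 0) (hα : α ∈ g.gr 1) : g.gauge γ α ∈ g.gr 1 :=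
  add_mem hα (dexp_mem hγ (gaugeField_mem hγ hα))

theorem isGaugeTransform_iff {γ α β : G} (hγ : γ ∈ g.gr 0) (hα : α ∈ g.gr 1) :
    g.IsGaugeTransform γ α β ↔ β = g.gauge γ α := by
  have h := isSum_dexp hγ (gaugeField_mem hγ hα)
  constructor
  · intro h'
    rw [gauge, ← h'.unique h]
    abel
  · rintro rfl
    simpa [IsGaugeTransform, gauge] using h

theorem gauge_eq_self {γ α : G} (hγ : γ ∈ g.gr 0) (h : g.bracket γ α - g.d γ = 0) :
    g.gauge γ α = α := by
  rw [gauge, h, dexp_eq_of_bracket_eq_zero hγ (zero_mem (g.gr 0)) (by simp), add_zero]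

theorem gauge_zero (α : G) : g.gauge 0 α = α := gauge_eq_self (zero_mem _) (by simp)

theorem gauge_sub_mem {γ γ' α : G} {r : ℕ} (hγ : γ ∈ g.gr 0) (hγ' : γ' ∈ g.gr 0)
    (hα : α ∈ g.gr 1) (h : γ' - γ ∈ g.L r) :
    g.gauge γ' α - g.gauge γ α + g.d (γ' - γ) ∈ g.L (r + 1) := by
  have e : (g.bracket γ' α - g.d γ') - (g.bracket γ α - g.d γ) =
      g.bracket (γ' - γ) α - g.d (γ' - γ) := by
    simp
    abel
  have h1 := dexp_sub_mem hγ hγ' (gaugeField_mem hγ hα) (gaugeField_mem hγ' hα) h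
    (e ▸ sub_mem (bracket_mem_left α h) (g.d_mem_L _ _ h))
  rw [e] at h1
  have h2 := add_mem h1 (bracket_mem_left_succ α h)
  convert h2 using 1
  simp only [gauge]
  abel

/-! ### The derivative of the gauge action along a path -/

variable (g) in
/-- The coefficients of the power series `exp(s γ)(α)` in `s`, multiplied by `n!`. -/
def gaugeCoeff (γ α : G) : ℕ → G
  | 0 => α
  | n + 1 => g.bracket γ (gaugeCoeff γ α n) - if n = 0 then g.d γ else 0

variable (g) in
/-- The coefficients of the power series `s dexp(s γ)(y)` in `s`, multiplied by `n!`. -/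
def dexpCoeff (γ y : G) : ℕ → G
  | 0 => 0
  | n + 1 => g.bracket γ (dexpCoeff γ y n) + if n = 0 then y else 0

theorem gaugeCoeff_succ (γ α : G) (n : ℕ) :
    g.gaugeCoeff γ α (n + 1) = ((g.bracket γ) ^ n) (g.bracket γ α - g.d γ) := by
  induction n with
  | zero => simp [gaugeCoeff]
  | succ n ih => rw [bracket_pow_succ, ← ih, gaugeCoeff]; simp

theorem dexpCoeff_succ (γ y : G) (n : ℕ) :
    g.dexpCoeff γ y (n + 1) = ((g.bracket γ) ^ n) y := by
  induction n with
  | zero => simp [dexpCoeff]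
  | succ n ih => rw [bracket_pow_succ, ← ih, dexpCoeff]; simp

theorem dexpCoeff_mem_gr {γ y : G} {i : ℤ} (hγ : γ ∈ g.gr 0) (hy : y ∈ g.gr i) (n : ℕ) :
    g.dexpCoeff γ y n ∈ g.gr i := by
  cases n with
  | zero => exact zero_mem _
  | succ n =>
    rw [dexpCoeff_succ]
    exact bracket_pow_mem_gr hγ hy n

theorem gaugeCoeff_mem_L (γ α : G) (n : ℕ) : g.gaugeCoeff γ α n ∈ g.L n := by
  cases n with
  | zero => exact g.mem_L_zero _
  | succ n =>
    rw [gaugeCoeff_succ, add_comm]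
    exact bracket_pow_mem_L γ (g.mem_L_one _) n

theorem dexpCoeff_mem_L (γ y : G) (n : ℕ) : g.dexpCoeff γ y n ∈ g.L n := by
  cases n with
  | zero => exact g.mem_L_zero _
  | succ n =>
    rw [dexpCoeff_succ, add_comm]
    exact bracket_pow_mem_L γ (g.mem_L_one _) n

theorem isSum_gaugeCoeff {γ α : G} (hγ : γ ∈ g.gr 0) (hα : α ∈ g.gr 1) :
    g.IsSum (fun n => ((n ! : ℕ) : 𝕜)⁻¹ • g.gaugeCoeff γ α n) (g.gauge γ α) := by
  intro r
  obtain ⟨N, hN⟩ := isSum_dexp hγ (gaugeField_mem hγ hα) r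
  refine ⟨N + 1, fun n hn => ?_⟩
  obtain ⟨n, rfl⟩ : ∃ k, n = k + 1 := ⟨n - 1, by omega⟩
  rw [Finset.sum_range_succ']
  convert hN n (by omega) using 1
  have e0 : g.gaugeCoeff γ α 0 = α := rfl
  simp only [gaugeCoeff_succ, gauge, e0, Nat.factorial_zero, Nat.cast_one, inv_one, one_smul]
  abel

theorem isSum_dexpCoeff {γ y : G} {i : ℤ} (hγ : γ ∈ g.gr 0) (hy : y ∈ g.gr i) :
    g.IsSum (fun n => ((n ! : ℕ) : 𝕜)⁻¹ • g.dexpCoeff γ y n) (g.dexp γ y) :=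
  (isSum_dexp hγ hy).shift (by simp [dexpCoeff]) (fun n => by rw [dexpCoeff_succ])

theorem jacobi_zero {γ x : G} (y : G) (hγ : γ ∈ g.gr 0) {i : ℤ} (hx : x ∈ g.gr i) :
    g.bracket γ (g.bracket x y) = g.bracket (g.bracket γ x) y + g.bracket x (g.bracket γ y) := by
  simpa using g.jacobi 0 i γ x y hγ hx

theorem leibniz_zero {γ : G} (y : G) (hγ : γ ∈ g.gr 0) :
    g.d (g.bracket γ y) = g.bracket (g.d γ) y + g.bracket γ (g.d y) := by
  simpa using g.leibniz 0 γ y hγ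

theorem bracket_symm_zero {γ x : G} (hγ : γ ∈ g.gr 0) {i : ℤ} (hx : x ∈ g.gr i) :
    g.bracket γ x = -g.bracket x γ := by
  simpa using g.bracket_symm 0 i γ x hγ hx

theorem bracket_symm_one {x y : G} (hx : x ∈ g.gr 1) (hy : y ∈ g.gr 1) :
    g.bracket x y = g.bracket y x := by
  simpa using g.bracket_symm 1 1 x y hx hy

variable (g) in
/-- The derivative of `gaugeCoeff` when `γ` moves with velocity `y`. -/
def gaugeCoeffDer (γ y α : G) (n : ℕ) : G :=
  -g.d (g.dexpCoeff γ y n) + ∑ p ∈ Finset.HasAntidiagonal.antidiagonal n,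
    n.choose p.1 • g.bracket (g.dexpCoeff γ y p.1) (g.gaugeCoeff γ α p.2)

/-- This is the recursion of `gaugeCoeff`, differentiated. Since `ad γ` is a derivation of the
bracket, Pascal's rule produces the convolution of order `n + 1`. The recursions of the two factors
contribute corrections only at index zero. -/
theorem gaugeCoeffDer_succ {γ y α : G} (hγ : γ ∈ g.gr 0) (hy : y ∈ g.gr 0) (n : ℕ) :
    g.gaugeCoeffDer γ y α (n + 1) =
      g.bracket y (g.gaugeCoeff γ α n) + g.bracket γ (g.gaugeCoeffDer γ y α n) -
        if n = 0 then g.d y else 0 := by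
  set e := g.dexpCoeff γ y with he
  set b := g.gaugeCoeff γ α with hb
  have hes : ∀ k, g.bracket γ (e k) = e (k + 1) - if k = 0 then y else 0 := fun k => by
    rw [he, dexpCoeff, add_sub_cancel_right]
  have hbs : ∀ k, g.bracket γ (b k) = b (k + 1) + if k = 0 then g.d γ else 0 := fun k => by
    rw [hb, gaugeCoeff, sub_add_cancel]
  have hei : ∀ k, e k ∈ g.gr 0 := dexpCoeff_mem_gr hγ hy
  have h1 : g.bracket γ (g.d (e n)) = g.d (e (n + 1)) - (if n = 0 then g.d y else 0) -
      g.bracket (g.d γ) (e n) := by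
    have := leibniz_zero (g := g) (e n) hγ
    rw [hes, map_sub] at this
    rw [eq_sub_iff_add_eq, add_comm, ← this]
    split_ifs <;> simp
  have h2 : g.bracket γ (∑ p ∈ Finset.HasAntidiagonal.antidiagonal n,
      n.choose p.1 • g.bracket (e p.1) (b p.2)) =
      ∑ p ∈ Finset.HasAntidiagonal.antidiagonal (n + 1),
        (n + 1).choose p.1 • g.bracket (e p.1) (b p.2) - g.bracket y (b n) +
          g.bracket (e n) (g.d γ) := by
    rw [Finset.sum_antidiagonal_choose_succ_nsmul (fun i j => g.bracket (e i) (b j)), map_sum]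
    have e1 : g.bracket y (b n) = ∑ p ∈ Finset.HasAntidiagonal.antidiagonal n,
        n.choose p.1 • g.bracket (if p.1 = 0 then y else 0) (b p.2) := by
      rw [Finset.sum_eq_single (0, n)]
      · simp
      · rintro ⟨i, j⟩ hp hne
        have : i ≠ 0 := by
          rintro rfl
          exact hne (by simpa using hp)
        simp [this]
      · simp
    have e2 : g.bracket (e n) (g.d γ) = ∑ p ∈ Finset.HasAntidiagonal.antidiagonal n,
        n.choose p.1 • g.bracket (e p.1) (if p.2 = 0 then g.d γ else 0) := by
      rw [Finset.sum_eq_single (n, 0)]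
      · simp
      · rintro ⟨i, j⟩ hp hne
        have : j ≠ 0 := by
          rintro rfl
          exact hne (by simpa using hp)
        simp [this]
      · simp
    rw [e1, e2, ← Finset.sum_add_distrib, ← Finset.sum_sub_distrib, ← Finset.sum_add_distrib]
    refine Finset.sum_congr rfl fun p hp => ?_
    have hc : n.choose p.2 = n.choose p.1 :=
      Nat.choose_symm_of_eq_add (by
        rw [add_comm]; exact (Finset.HasAntidiagonal.mem_antidiagonal.mp hp).symm)
    rw [map_nsmul, jacobi_zero _ hγ (hei _), hes, hbs, hc, ← smul_add, ← smul_sub, ← smul_add]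
    congr 1
    simp only [map_sub, LinearMap.sub_apply, map_add]
    abel
  -- The term `[∂γ, e n]` from the Leibniz rule cancels the correction `[e n, ∂γ]` by antisymmetry.
  rw [gaugeCoeffDer, gaugeCoeffDer, map_add, map_neg, h1, h2,
    bracket_symm_zero (hei n) (d_zero_mem hγ)]
  abel

theorem hasDer_gaugeCoeff {Γ y : 𝕜 → G} (hΓ : g.HasDer Γ y) (hΓ0 : ∀ t, Γ t ∈ g.gr 0)
    (hy : ∀ t, y t ∈ g.gr 0) (α : G) (n : ℕ) :
    g.HasDer (fun t => g.gaugeCoeff (Γ t) α n) (fun t => g.gaugeCoeffDer (Γ t) (y t) α n) := by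
  induction n with
  | zero =>
    refine (HasDer.const α).congr (fun t => rfl) fun t => ?_
    simp [gaugeCoeffDer, dexpCoeff]
  | succ n ih =>
    refine ((hΓ.bracket ih).sub (k := fun t => if n = 0 then g.d (Γ t) else 0)
      (k' := fun t => if n = 0 then g.d (y t) else 0) ?_).congr (fun t => rfl) fun t => ?_
    · split_ifs
      · exact hΓ.map_d
      · exact HasDer.const 0
    · rw [gaugeCoeffDer_succ (hΓ0 t) (hy t)]

theorem gaugeCoeffDer_mem_L (γ y α : G) (n : ℕ) : g.gaugeCoeffDer γ y α n ∈ g.L n := by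
  refine add_mem (neg_mem (g.d_mem_L _ _ (dexpCoeff_mem_L _ _ _))) (sum_mem fun p hp => ?_)
  have h := g.bracket_mem_L _ _ _ _ (dexpCoeff_mem_L (g := g) γ y p.1)
    (gaugeCoeff_mem_L (g := g) γ α p.2)
  rw [Finset.HasAntidiagonal.mem_antidiagonal.mp hp] at h
  exact nsmul_mem h _

theorem IsPath.sub {f k : 𝕜 → G} (hf : g.IsPath f) (hk : g.IsPath k) :
    g.IsPath (fun t => f t - k t) := by
  intro r
  obtain ⟨p, p', hp, h⟩ := hf r
  obtain ⟨q, q', hq, h'⟩ := hk r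
  refine ⟨_, _, hp.sub hq, fun t => ?_⟩
  rw [sub_sub_sub_comm]
  exact sub_mem (h t) (h' t)

theorem gaugeEquiv_iff {α β : g.toDGLieAlgebra.MC} :
    g.GaugeEquiv α β ↔ ∃ γ ∈ g.gr 0, β.1 = g.gauge γ α.1 := by
  constructor
  · rintro ⟨γ, hγ, h⟩
    exact ⟨γ, hγ, (isGaugeTransform_iff hγ α.2.1).mp h⟩
  · rintro ⟨γ, hγ, h⟩
    exact ⟨γ, hγ, (isGaugeTransform_iff hγ α.2.1).mpr h⟩

theorem bracket_mem_two {α β : G} (hα : α ∈ g.gr 1) (hβ : β ∈ g.gr 1) :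
    g.bracket α β ∈ g.gr 2 := g.bracket_mem 1 1 α β hα hβ

theorem d_mem_two {α : G} (hα : α ∈ g.gr 1) : g.d α ∈ g.gr 2 := g.d_mem 1 α hα

variable (g) in
/-- The curvature `∂α + 1/2 [α, α]`. -/
def curv (α : G) : G := g.d α + (2 : 𝕜)⁻¹ • g.bracket α α

theorem curv_mem {α : G} (hα : α ∈ g.gr 1) : g.curv α ∈ g.gr 2 :=
  add_mem (d_mem_two hα) (Submodule.smul_mem _ _ (bracket_mem_two hα hα))

section CharZero

variable [CharZero 𝕜]

/-- Division by `n!` turns the binomial convolution into the Cauchy product of the series for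
`dexp(γ)(y)` and `exp(γ)(α)`. -/
theorem isSum_gaugeCoeffDer {γ y α : G} (hγ : γ ∈ g.gr 0) (hy : y ∈ g.gr 0) (hα : α ∈ g.gr 1) :
    g.IsSum (fun n => ((n ! : ℕ) : 𝕜)⁻¹ • g.gaugeCoeffDer γ y α n)
      (-g.d (g.dexp γ y) + g.bracket (g.dexp γ y) (g.gauge γ α)) := by
  have he := isSum_dexpCoeff hγ hy
  refine (he.map_d.neg.add (he.bracket (isSum_gaugeCoeff hγ hα)
    (fun n => Submodule.smul_mem _ _ (dexpCoeff_mem_L _ _ n))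
    (fun n => Submodule.smul_mem _ _ (gaugeCoeff_mem_L _ _ n)))).congr fun n => ?_
  rw [gaugeCoeffDer, smul_add, smul_neg, map_smul, Finset.smul_sum]
  congr 1
  refine Finset.sum_congr rfl fun p hp => ?_
  rw [map_smul, map_smul, LinearMap.smul_apply, smul_smul, ← Nat.cast_smul_eq_nsmul 𝕜, smul_smul]
  congr 1
  obtain ⟨i, j⟩ := p
  obtain rfl : i + j = n := Finset.HasAntidiagonal.mem_antidiagonal.mp hp
  have h := Nat.add_choose_mul_factorial_mul_factorial j i
  rw [add_comm j i, mul_right_comm] at h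
  have h' : (((i + j).choose i : ℕ) : 𝕜) * (i ! : ℕ) * (j ! : ℕ) = ((i + j)! : ℕ) := by
    exact_mod_cast h
  have hi : ((i ! : ℕ) : 𝕜) ≠ 0 := Nat.cast_ne_zero.mpr i.factorial_ne_zero
  have hj : ((j ! : ℕ) : 𝕜) ≠ 0 := Nat.cast_ne_zero.mpr j.factorial_ne_zero
  have hij : (((i + j)! : ℕ) : 𝕜) ≠ 0 := Nat.cast_ne_zero.mpr (i + j).factorial_ne_zero
  simp only
  field_simp
  rw [← h']
  ring

/-- The logarithmic derivative of the exponential: moving `γ` with velocity `y` moves `exp(γ)(α)`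
along the gauge field of `dexp(γ)(y)`, independently of `α`. -/
theorem hasDer_gauge {Γ y : 𝕜 → G} (hΓ : g.HasDer Γ y) (hΓ0 : ∀ t, Γ t ∈ g.gr 0)
    (hy : ∀ t, y t ∈ g.gr 0) {α : G} (hα : α ∈ g.gr 1) :
    g.HasDer (fun t => g.gauge (Γ t) α)
      (fun t => -g.d (g.dexp (Γ t) (y t)) + g.bracket (g.dexp (Γ t) (y t)) (g.gauge (Γ t) α)) :=
  HasDer.isSum (fun n => (hasDer_gaugeCoeff hΓ hΓ0 hy α n).smul _)
    (fun n _ => Submodule.smul_mem _ _ (gaugeCoeff_mem_L _ _ n))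
    (fun n _ => Submodule.smul_mem _ _ (gaugeCoeffDer_mem_L _ _ _ n))
    (fun t => isSum_gaugeCoeff (hΓ0 t) hα) (fun t => isSum_gaugeCoeffDer (hΓ0 t) (hy t) hα)

/-! ### Flows of time-dependent gauge fields -/

/-- If `f` takes values in `L r`, then `f'` takes values in `L (r + 1)`, and since `f 0 = 0` so does
`f`. Separatedness concludes. -/
theorem eq_zero_of_hasDer_bracket {η f f' : 𝕜 → G} (hf : g.HasDer f f')
    (h : ∀ t, f' t = g.bracket (η t) (f t)) (h0 : f 0 = 0) (t : 𝕜) : f t = 0 := by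
  have key : ∀ r t, f t ∈ g.L r := by
    intro r
    induction r with
    | zero => exact fun t => g.mem_L_zero _
    | succ r ih =>
      intro t
      simpa [h0] using hf.sub_mem_of_derivative_mem
        (fun t => (h t).symm ▸ bracket_mem_right_succ (η t) (ih t)) t
  exact g.separated _ fun r => key r t

variable (g) in
/-- `β` flows along the time-dependent gauge field `η`. -/
def IsFlow (η β : 𝕜 → G) : Prop :=
  g.HasDer β (fun t => -g.d (η t) + g.bracket (η t) (β t))

theorem IsFlow.eq {η β β' : 𝕜 → G} (h : g.IsFlow η β) (h' : g.IsFlow η β') (h0 : β 0 = β' 0)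
    (t : 𝕜) : β t = β' t :=
  sub_eq_zero.mp <| eq_zero_of_hasDer_bracket (η := η) (f := fun t => β t - β' t)
    (HasDer.sub h h') (fun t => by simp) (by simp [h0]) t

variable (g) in
/-- `Γ` is a path in degree zero whose exponentials form a flow along `η`. -/
structure IsLogFlow (η Γ y : 𝕜 → G) : Prop where
  hasDer : g.HasDer Γ y
  mem : ∀ t, Γ t ∈ g.gr 0
  derivative_mem : ∀ t, y t ∈ g.gr 0
  dexp_eq : ∀ t, g.dexp (Γ t) (y t) = η t

theorem IsLogFlow.isFlow {η Γ y : 𝕜 → G} (h : g.IsLogFlow η Γ y) {α : G} (hα : α ∈ g.gr 1) :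
    g.IsFlow η (fun t => g.gauge (Γ t) α) :=
  (hasDer_gauge h.hasDer h.mem h.derivative_mem hα).congr (fun _ => rfl)
    fun t => by rw [h.dexp_eq]

theorem bracket_self_zero {γ : G} (hγ : γ ∈ g.gr 0) : g.bracket γ γ = 0 := by
  have h : (2 : 𝕜) • g.bracket γ γ = 0 := by
    rw [two_smul]
    nth_rewrite 1 [bracket_symm_zero hγ hγ]
    simp
  simpa using h

theorem isLogFlow_smul {γ : G} (hγ : γ ∈ g.gr 0) : g.IsLogFlow (fun _ => γ) (fun t => t • γ)
    (fun _ => γ) where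
  hasDer := .id_smul γ
  mem _ := Submodule.smul_mem _ _ hγ
  derivative_mem _ := hγ
  dexp_eq t := dexp_eq_of_bracket_eq_zero (Submodule.smul_mem _ _ hγ) hγ
    (by simp [bracket_self_zero hγ])

/-- Both `exp(-tγ)(exp(γ)(α))` and `exp((1 - t)γ)(α)` flow along `-γ` from `exp(γ)(α)`; they are
compared at `t = 1`. -/
theorem gauge_neg_gauge {γ α : G} (hγ : γ ∈ g.gr 0) (hα : α ∈ g.gr 1) :
    g.gauge (-γ) (g.gauge γ α) = α := by
  have h1 := (isLogFlow_smul (neg_mem hγ)).isFlow (gauge_mem hγ hα)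
  have h2 : g.IsLogFlow (fun _ => -γ) (fun t => γ - t • γ) (fun _ => -γ) :=
    { hasDer := ((HasDer.const γ).sub (HasDer.id_smul γ)).congr (fun _ => rfl) (by simp)
      mem := fun t => sub_mem hγ (Submodule.smul_mem _ _ hγ)
      derivative_mem := fun _ => neg_mem hγ
      dexp_eq := fun t => by
        refine dexp_eq_of_bracket_eq_zero (sub_mem hγ (Submodule.smul_mem _ _ hγ)) (neg_mem hγ) ?_
        simp [bracket_self_zero hγ] }
  have := h1.eq (h2.isFlow hα) (by simp [gauge_zero]) 1
  simpa [gauge_zero] using this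

theorem IsPath.dexp {Γ y : 𝕜 → G} (hΓ : g.IsPath Γ) (hy : g.IsPath y) (hΓ0 : ∀ t, Γ t ∈ g.gr 0)
    (hy0 : ∀ t, y t ∈ g.gr 0) : g.IsPath (fun t => g.dexp (Γ t) (y t)) := by
  obtain ⟨Γ', hΓ', -⟩ := hΓ.exists_hasDer hΓ0
  obtain ⟨y', hy', -⟩ := hy.exists_hasDer hy0
  refine IsPath.isSum (fun n => ?_) (fun n t => Submodule.smul_mem _ _ ?_)
    (fun t => isSum_dexp (hΓ0 t) (hy0 t))
  · have : ∃ k, g.HasDer (fun t => ((g.bracket (Γ t)) ^ n) (y t)) k := by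
      induction n with
      | zero => exact ⟨y', hy'⟩
      | succ n ih =>
        obtain ⟨k, hk⟩ := ih
        exact ⟨_, (hΓ'.bracket hk).congr (fun t => (bracket_pow_succ _ _ _).symm) fun _ => rfl⟩
    obtain ⟨k, hk⟩ := this
    exact ⟨_, hk.smul _⟩
  · simpa using bracket_pow_mem_L (Γ t) (g.mem_L_zero (y t)) n

/-- Every time-dependent gauge field has a flow by exponentials with given initial value. -/
theorem exists_isLogFlow {η : 𝕜 → G} (hη : g.IsPath η) (hη0 : ∀ t, η t ∈ g.gr 0) {c : G}
    (hc : c ∈ g.gr 0) : ∃ Γ y, g.IsLogFlow η Γ y ∧ Γ 0 = c := by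
  let S := {y : 𝕜 → G // g.IsPath y ∧ ∀ t, y t ∈ g.gr 0}
  choose I hI hI0 hIm using fun y : S => y.2.1.exists_integral y.2.2 hc
  -- A fixed point `y` of `T` satisfies `dexp(∫ y)(y) = η`. As `dexp` is the identity to leading
  -- order, `T` improves agreement by one filtration step, so its iterates converge.
  let T : S → S := fun y => ⟨fun t => η t - (g.dexp (I y t) (y.1 t) - y.1 t),
    hη.sub (((hI y).isPath.dexp y.2.1 (hIm y) y.2.2).sub y.2.1),
    fun t => sub_mem (hη0 t) (sub_mem (dexp_mem (hIm y t) (y.2.2 t)) (y.2.2 t))⟩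
  have hIL : ∀ (y z : S) (r : ℕ), (∀ t, y.1 t - z.1 t ∈ g.L r) →
      ∀ t, I y t - I z t ∈ g.L r := fun y z r h t => by
    simpa [hI0] using ((hI y).sub (hI z)).sub_mem_of_derivative_mem h t
  have hT : ∀ (y z : S) (r : ℕ), (∀ t, y.1 t - z.1 t ∈ g.L r) →
      ∀ t, (T y).1 t - (T z).1 t ∈ g.L (r + 1) := fun y z r h t => by
    have := dexp_sub_mem (hIm z t) (hIm y t) (z.2.2 t) (y.2.2 t) (hIL y z r h t) (h t)
    convert neg_mem this using 1
    simp only [T]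
    abel
  let s : ℕ → S := fun n => T^[n] ⟨η, hη, hη0⟩
  have hss : ∀ n, s (n + 1) = T (s n) := fun n => Function.iterate_succ_apply' T n _
  have hs : ∀ n t, (s (n + 1)).1 t - (s n).1 t ∈ g.L n := by
    intro n
    induction n with
    | zero => exact fun t => g.mem_L_zero _
    | succ n ih =>
      rw [hss (n + 1)]
      nth_rewrite 2 [hss n]
      exact hT _ _ n ih
  obtain ⟨y, hy0, hy⟩ := exists_limit (f := fun n => (s n).1) (fun n => (s n).2.2) hs
  let Y : S := ⟨y, .of_forall fun r => ⟨_, (s r).2.1, hy r⟩, hy0⟩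
  have hfix : ∀ t, (T Y).1 t = y t := by
    intro t
    refine eq_of_sub_mem (g := g) fun r => ?_
    have h1 := hT Y (s r) r (hy r) t
    rw [← hss] at h1
    have h2 := sub_mem h1 (hy (r + 1) t)
    refine g.mem_L_of_le r.le_succ ?_
    convert h2 using 1
    abel
  refine ⟨I Y, y, ⟨hI Y, hIm Y, hy0, fun t => ?_⟩, hI0 Y⟩
  have := hfix t
  simp only [T, Y] at this
  rw [sub_eq_iff_eq_add] at this
  rw [this]
  abel

/-- The logarithm depends continuously on the field and the initial value. If the data agree modulo
`L q`, then `dexp_sub_mem` gives `y' - y ≡ η' - η` modulo `L (q + 1)`, and integration passes to `Γ'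
- Γ`. -/
theorem IsLogFlow.sub_mem {η η' Γ Γ' y y' : 𝕜 → G} (h : g.IsLogFlow η Γ y)
    (h' : g.IsLogFlow η' Γ' y') {r : ℕ} (hη : ∀ t, η' t - η t ∈ g.L r)
    (h0 : Γ' 0 - Γ 0 ∈ g.L r) (t : 𝕜) : Γ' t - Γ t ∈ g.L r ∧ y' t - y t ∈ g.L r := by
  have key : ∀ q ≤ r, ∀ t, Γ' t - Γ t ∈ g.L q ∧ y' t - y t ∈ g.L q := by
    intro q
    induction q with
    | zero => exact fun _ t => ⟨g.mem_L_zero _, g.mem_L_zero _⟩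
    | succ q ih =>
      intro hq
      have ih := ih (by omega)
      have hy : ∀ t, y' t - y t ∈ g.L (q + 1) := fun t => by
        have := dexp_sub_mem (h.mem t) (h'.mem t) (h.derivative_mem t) (h'.derivative_mem t)
          (ih t).1 (ih t).2
        rw [h.dexp_eq, h'.dexp_eq] at this
        simpa using _root_.sub_mem (g.mem_L_of_le hq (hη t)) this
      refine fun t => ⟨?_, hy t⟩
      simpa using add_mem ((h'.hasDer.sub h.hasDer).sub_mem_of_derivative_mem hy t)
        (g.mem_L_of_le hq h0)
  exact key r le_rfl t

/-- To leading order logarithms add: perturbing the field by a constant `c` and the initial value,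
both in `L r`, changes `Γ t` by the sum of the initial change and `t • c`. -/
theorem IsLogFlow.sub_sub_mem {η η' Γ Γ' y y' : 𝕜 → G} (h : g.IsLogFlow η Γ y)
    (h' : g.IsLogFlow η' Γ' y') {r : ℕ} {c : G} (hc : c ∈ g.L r)
    (hη : ∀ t, η' t - η t - c ∈ g.L (r + 1))
    (h0 : Γ' 0 - Γ 0 ∈ g.L r) (t : 𝕜) :
    Γ' t - Γ t - (Γ' 0 - Γ 0) - t • c ∈ g.L (r + 1) := by
  have h1 := h.sub_mem h' (r := r)
    (fun t => by simpa using add_mem (g.mem_L_of_le r.le_succ (hη t)) hc) h0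
  have hy : ∀ t, y' t - y t - c ∈ g.L (r + 1) := fun t => by
    have := dexp_sub_mem (h.mem t) (h'.mem t) (h.derivative_mem t) (h'.derivative_mem t)
      (h1 t).1 (h1 t).2
    rw [h.dexp_eq, h'.dexp_eq] at this
    convert _root_.sub_mem (hη t) this using 1
    abel
  have := ((h'.hasDer.sub h.hasDer).sub (.id_smul c)).sub_mem_of_derivative_mem hy t
  convert this using 1
  simp
  abel

/-! ### Gauge equivalence -/

/-- The composition of two gauge transformations is a gauge transformation. -/
theorem exists_gauge_gauge {γ γ' : G} (hγ : γ ∈ g.gr 0) (hγ' : γ' ∈ g.gr 0) :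
    ∃ δ ∈ g.gr 0, ∀ α ∈ g.gr 1, g.gauge γ' (g.gauge γ α) = g.gauge δ α := by
  -- The path `Γ` starts at `γ` and is driven by the constant field `γ'`, so `exp(Γ t)(α)` and
  -- `exp(tγ')(exp(γ)(α))` are the same flow. Its construction does not involve `α`, so `Γ 1` serves
  -- all `α`.
  obtain ⟨Γ, y, h, h0⟩ := exists_isLogFlow (HasDer.const γ').isPath (fun _ => hγ') hγ
  refine ⟨Γ 1, h.mem 1, fun α hα => ?_⟩
  have := ((isLogFlow_smul hγ').isFlow (gauge_mem hγ hα)).eq (h.isFlow hα)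
    (by simp [h0, gauge_zero]) 1
  simpa using this

variable (g) in
theorem equivalence_gaugeEquiv : Equivalence g.GaugeEquiv where
  refl α := gaugeEquiv_iff.mpr ⟨0, zero_mem _, (gauge_zero _).symm⟩
  symm {α β} h := by
    obtain ⟨γ, hγ, h⟩ := gaugeEquiv_iff.mp h
    exact gaugeEquiv_iff.mpr ⟨-γ, neg_mem hγ, by rw [h, gauge_neg_gauge hγ α.2.1]⟩
  trans {α β δ} h h' := by
    obtain ⟨γ, hγ, h⟩ := gaugeEquiv_iff.mp h
    obtain ⟨γ', hγ', h'⟩ := gaugeEquiv_iff.mp h'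
    obtain ⟨ε, hε, hεα⟩ := exists_gauge_gauge hγ hγ'
    exact gaugeEquiv_iff.mpr ⟨ε, hε, by rw [h', h, hεα _ α.2.1]⟩

/-- Along the flow of `γ` the curvature `F` satisfies the linear equation `F' = [γ, F]`, so it stays
zero. -/
theorem curv_gauge {γ α : G} (hγ : γ ∈ g.gr 0) (hα : α ∈ g.gr 1) (h : g.curv α = 0) :
    g.curv (g.gauge γ α) = 0 := by
  set β := fun t : 𝕜 => g.gauge (t • γ) α with hβdef
  have hβ : g.IsFlow (fun _ => γ) β := (isLogFlow_smul hγ).isFlow hα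
  have hβ1 : ∀ t, β t ∈ g.gr 1 := fun t => gauge_mem (Submodule.smul_mem _ _ hγ) hα
  have hD := HasDer.add (HasDer.map_d hβ) ((HasDer.bracket hβ hβ).smul (2 : 𝕜)⁻¹)
  have := eq_zero_of_hasDer_bracket (η := fun _ => γ) hD (fun t => ?_)
    (by simpa [hβdef, gauge_zero, curv] using h) 1
  · simpa [hβdef, curv] using this
  · have hv : -g.d γ + g.bracket γ (β t) ∈ g.gr 1 :=
      add_mem (neg_mem (d_zero_mem hγ)) (bracket_zero_mem hγ (hβ1 t))
    rw [bracket_symm_one hv (hβ1 t), ← two_smul 𝕜, smul_smul, inv_mul_cancel₀ two_ne_zero, one_smul]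
    simp only [map_add, map_neg, map_smul, g.d_d, leibniz_zero _ hγ, jacobi_zero _ hγ (hβ1 t)]
    rw [bracket_symm_one (bracket_zero_mem hγ (hβ1 t)) (hβ1 t),
      bracket_symm_one (d_zero_mem hγ) (hβ1 t), ← two_smul 𝕜 (g.bracket (β t) _), smul_smul,
      inv_mul_cancel₀ two_ne_zero, one_smul]
    abel

end CharZero

end ProNilpotentDGLieAlgebra

/-! ### Signs of permutations of elements of degrees zero and one -/

theorem sign_eq_prod_inversions {n : ℕ} (σ : Equiv.Perm (Fin n)) :
    Equiv.Perm.sign σ =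
      ∏ p : Fin n × Fin n with p.1 < p.2 ∧ σ p.2 < σ p.1, (-1 : ℤˣ) := by
  rw [σ.sign_eq_prod_prod_Ioi, Finset.prod_filter, Fintype.prod_prod_type]
  refine Finset.prod_congr rfl fun i _ => ?_
  rw [← Finset.prod_filter, ← Finset.prod_filter_mul_prod_filter_not (Finset.Ioi i)
    (fun j => σ i < σ j), Finset.prod_congr rfl (g := fun _ => (1 : ℤˣ)), Finset.prod_const_one,
    one_mul]
  · refine Finset.prod_congr ?_ ?_
    · ext j
      simp only [Finset.mem_filter, Finset.mem_Ioi, Finset.mem_univ, true_and]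
      refine and_congr_right fun hij => ?_
      rw [not_lt]
      exact ⟨fun h => lt_of_le_of_ne h (fun e => hij.ne' (σ.injective e)), le_of_lt⟩
    · intro j hj
      rw [if_neg (not_lt.mpr (Finset.mem_filter.mp hj).2.2.le)]
  · intro j hj
    rw [if_pos (Finset.mem_filter.mp hj).2]

theorem chiSign_eq_prod {n : ℕ} (σ : Equiv.Perm (Fin n)) (deg : Fin n → ℤ) :
    chiSign σ deg = ∏ p : Fin n × Fin n with p.1 < p.2 ∧ σ p.2 < σ p.1,
      (-1) * (deg (σ p.1) * deg (σ p.2)).negOnePow := by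
  rw [chiSign, koszulSign, sign_eq_prod_inversions, Finset.prod_mul_distrib]

/-- In degree one the Koszul sign of each inversion cancels its permutation sign, so the components
of `Φ` are symmetric there. -/
theorem chiSign_one {n : ℕ} (σ : Equiv.Perm (Fin n)) : chiSign σ (fun _ => 1) = 1 := by
  rw [chiSign_eq_prod]
  exact Finset.prod_eq_one fun p _ => by simp

/-- Only inversions involving the degree zero element contribute `-1`. It has index `0` and is moved
to place `σ⁻¹ 0`, so these inversions are exactly its pairs with the earlier entries. -/
theorem chiSign_update_zero {m : ℕ} (σ : Equiv.Perm (Fin (m + 1))) :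
    chiSign σ (Function.update (fun _ => 1) 0 0) = (-1) ^ (σ⁻¹ 0 : ℕ) := by
  rw [chiSign_eq_prod, Finset.prod_filter, Fintype.prod_prod_type]
  generalize hk : σ⁻¹ 0 = k
  have hσk : σ k = 0 := by rw [← hk]; simp
  have h : ∀ i j : Fin (m + 1), (if i < j ∧ σ j < σ i then
      (-1 : ℤˣ) * ((Function.update (fun _ => (1 : ℤ)) 0 0 : Fin (m + 1) → ℤ) (σ i) *
        (Function.update (fun _ => (1 : ℤ)) 0 0 : Fin (m + 1) → ℤ) (σ j)).negOnePow else 1) =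
      if j = k then (if i < k then -1 else 1) else 1 := by
    intro i j
    by_cases hj : j = k
    · subst hj
      by_cases hi : i < j
      · have : σ i ≠ 0 := by
          rintro e
          exact hi.ne (σ.injective (e.trans hσk.symm))
        simp [hi, hσk, Fin.pos_iff_ne_zero.mpr this]
      · simp [hi]
    · have hj' : σ j ≠ 0 := by
        rintro e
        exact hj (σ.injective (e.trans hσk.symm))
      rw [if_neg hj]
      split_ifs with h
      · have hi' : σ i ≠ 0 := by
          rintro e
          rw [e] at h
          exact absurd h.2 (by simp)
        simp [hi', hj']
      · rfl
  simp only [h, Finset.prod_ite_eq', Finset.mem_univ, if_true]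
  rw [Finset.prod_ite, Finset.prod_const_one, mul_one, Finset.prod_const]
  congr 1
  have e : Finset.univ.filter (fun x : Fin (m + 1) => x < k) = Finset.Iio (k) := by
    ext x
    simp
  rw [e, Fin.card_Iio]

theorem sum_perm_inv_zero {M : Type*} [AddCommMonoid M] {m : ℕ} (f : Fin (m + 1) → M) :
    ∑ σ : Equiv.Perm (Fin (m + 1)), f (σ⁻¹ 0) = m ! • ∑ j, f j := by
  rw [← Equiv.sum_comp (Equiv.inv (Equiv.Perm (Fin (m + 1)))) (fun σ => f (σ⁻¹ 0))]
  simp only [Equiv.inv_apply, inv_inv]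
  rw [← Equiv.sum_comp Equiv.Perm.decomposeFin.symm, Fintype.sum_prod_type]
  simp [Equiv.Perm.decomposeFin_symm_apply_zero, Fintype.card_perm, Finset.smul_sum]

theorem update_perm_apply {M : Type*} {m : ℕ} (x y : M) (σ : Equiv.Perm (Fin (m + 1)))
    (i : Fin (m + 1)) : (Function.update (fun _ => y) 0 x : Fin (m + 1) → M) (σ i) =
      (Function.update (fun _ => y) (σ⁻¹ 0) x : Fin (m + 1) → M) i := by
  simp only [Function.update_apply, Equiv.Perm.eq_inv_iff_eq]

theorem update_zero_eq_cons {M : Type*} {m : ℕ} (x y : M) :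
    (Function.update (fun _ => y) 0 x : Fin (m + 1) → M) = Fin.cons x (fun _ => y) := by
  have : (fun _ => y : Fin (m + 1) → M) = Fin.cons y (fun _ => y) := by
    funext i
    refine Fin.cases ?_ (fun i => ?_) i <;> simp
  rw [this, Fin.update_cons_zero]

theorem units_smul_eq {𝕜 M : Type*} [Field 𝕜] [AddCommGroup M] [Module 𝕜 M] (n : ℤˣ) (x : M) :
    n • x = ((n : ℤ) : 𝕜) • x := by
  rw [Units.smul_def, Int.cast_smul_eq_zsmul]

/-! ### Antisymmetry with at most one argument of degree zero -/

section Antisymmetry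

variable {𝕜 : Type u} {G : Type v} {H : Type w} [Field 𝕜] [AddCommGroup G] [Module 𝕜 G]
  [AddCommGroup H] [Module 𝕜 H] {g : DGLieAlgebra 𝕜 G} {h : DGLieAlgebra 𝕜 H}
  (Φ : LInftyMorphism g h)

theorem LInftyMorphism.app_update_one {m : ℕ} {x α : G} (hx : x ∈ g.gr 1) (hα : α ∈ g.gr 1)
    (j : Fin (m + 1)) : Φ.app (m + 1) (Function.update (fun _ => α) j x) =
      Φ.app (m + 1) (Fin.cons x (fun _ => α)) := by
  rw [← update_zero_eq_cons, Φ.antisymm (m + 1) (fun _ => 1) (Function.update (fun _ => α) 0 x)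
    (Equiv.swap 0 j), chiSign_one, one_smul]
  · congr 1
    funext i
    rw [update_perm_apply]
    simp [Equiv.swap_inv]
  · intro i
    by_cases hi : i = 0 <;> simp [hi, hx, hα]

theorem update_zero_mem {m : ℕ} {γ α : G} (hγ : γ ∈ g.gr 0) (hα : α ∈ g.gr 1)
    (i : Fin (m + 1)) : (Function.update (fun _ => α) 0 γ : Fin (m + 1) → G) i ∈
      g.gr ((Function.update (fun _ => 1) 0 0 : Fin (m + 1) → ℤ) i) := by
  by_cases hi : i = 0 <;> simp [hi, hγ, hα]

theorem LInftyMorphism.app_update_zero {m : ℕ} {γ α : G} (hγ : γ ∈ g.gr 0) (hα : α ∈ g.gr 1)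
    (j : Fin (m + 1)) : Φ.app (m + 1) (Fin.cons γ (fun _ => α)) =
      (-1 : 𝕜) ^ (j : ℕ) • Φ.app (m + 1) (Function.update (fun _ => α) j γ) := by
  rw [← update_zero_eq_cons, Φ.antisymm (m + 1) (Function.update (fun _ => 1) 0 0)
    (Function.update (fun _ => α) 0 γ) (Equiv.swap 0 j) (update_zero_mem hγ hα),
    chiSign_update_zero, units_smul_eq (𝕜 := 𝕜)]
  congr 1
  · simp [Equiv.swap_inv]
  · congr 1
    funext i
    rw [update_perm_apply]
    simp [Equiv.swap_inv]

end Antisymmetry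

/-! ### The relations of an `L∞`-morphism on elements of degrees zero and one -/

theorem negOnePow_natCast_smul {𝕜 M : Type*} [Field 𝕜] [AddCommGroup M] [Module 𝕜 M] (n : ℕ)
    (x : M) : (n : ℤ).negOnePow • x = (-1 : 𝕜) ^ n • x := by
  rw [units_smul_eq (𝕜 := 𝕜), Int.negOnePow_def, zpow_natCast]
  simp

section Relations

variable {𝕜 : Type u} {G : Type v} {H : Type w} [Field 𝕜] [AddCommGroup G] [Module 𝕜 G]
  [AddCommGroup H] [Module 𝕜 H] {g : DGLieAlgebra 𝕜 G} {h : DGLieAlgebra 𝕜 H}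
  (Φ : LInftyMorphism g h)

/-- The summand of `lInftyProductTerm` with arities `s` and `t`. -/
noncomputable def lInftyProductSummand (h : DGLieAlgebra 𝕜 H)
    (Φ : (k : ℕ) → MultilinearMap 𝕜 (fun _ : Fin k => G) H)
    (n : ℕ) (deg : Fin n → ℤ) (ξ : Fin n → G) (s t : ℕ) (hst : s + t = n) : H :=
  ((s ! * t ! : ℕ) : 𝕜)⁻¹ • ∑ τ : Equiv.Perm (Fin n),
    (chiSign τ deg * ((s : ℤ) - 1).negOnePow
        * (((t : ℤ) - 1) * ∑ i, deg (τ (Fin.cast hst (Fin.castAdd t i)))).negOnePow) •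
      h.bracket (Φ s (fun i => ξ (τ (Fin.cast hst (Fin.castAdd t i)))))
        (Φ t (fun i => ξ (τ (Fin.cast hst (Fin.natAdd s i)))))

/-- The summands with an empty block vanish because `Φ⁰ = 0`; the others are indexed by the arities
minus one. -/
theorem LInftyMorphism.productTerm_eq {k : ℕ} {deg : Fin (k + 2) → ℤ} {ξ : Fin (k + 2) → G}
    {T : ℕ × ℕ → H} (hT : ∀ a b (hab : a + 1 + (b + 1) = k + 2),
      lInftyProductSummand h Φ.app (k + 2) deg ξ (a + 1) (b + 1) hab = T (a, b)) :
    lInftyProductTerm h Φ.app (k + 2) deg ξ =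
      (2 : 𝕜)⁻¹ • ∑ q ∈ Finset.HasAntidiagonal.antidiagonal k, T q := by
  let F : ℕ × ℕ → H := fun p => if hp : p.1 + p.2 = k + 2 then
    lInftyProductSummand h Φ.app (k + 2) deg ξ p.1 p.2 hp else 0
  have h1 : lInftyProductTerm h Φ.app (k + 2) deg ξ = (2 : 𝕜)⁻¹ •
      ∑ p : Finset.HasAntidiagonal.antidiagonal (k + 2), F p.1 := by
    unfold lInftyProductTerm
    congr 1
    refine Finset.sum_congr rfl fun p _ => ?_
    simp only [F]
    rw [dif_pos (Finset.HasAntidiagonal.mem_antidiagonal.mp p.2)]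
    rfl
  rw [h1, Finset.sum_coe_sort _ F, Finset.Nat.sum_antidiagonal_succ, Finset.Nat.sum_antidiagonal_succ']
  have e1 : F (0, k + 2) = 0 := by simp [F, lInftyProductSummand, Φ.app_zero]
  have e2 : F (k + 2, 0) = 0 := by simp [F, lInftyProductSummand, Φ.app_zero]
  rw [e1, e2, zero_add, zero_add]
  congr 1
  refine Finset.sum_congr rfl fun q hq => ?_
  have hq' := Finset.HasAntidiagonal.mem_antidiagonal.mp hq
  simp only [F]
  rw [dif_pos (by omega)]
  exact hT _ _ _

theorem LInftyMorphism.productTerm_one (deg : Fin 1 → ℤ) (ξ : Fin 1 → G) :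
    lInftyProductTerm h Φ.app 1 deg ξ = 0 := by
  unfold lInftyProductTerm
  rw [Finset.sum_eq_zero, smul_zero]
  rintro ⟨⟨s, t⟩, hp⟩ -
  have hst : s + t = 1 := Finset.HasAntidiagonal.mem_antidiagonal.mp hp
  rw [Finset.sum_eq_zero, smul_zero]
  intro τ _
  rcases Nat.eq_zero_or_pos s with rfl | hs
  · simp [Φ.app_zero]
  · obtain rfl : t = 0 := by omega
    simp [Φ.app_zero]

theorem LInftyMorphism.app_const_mem {α : G} (hα : α ∈ g.gr 1) (k : ℕ) :
    Φ.app k (fun _ => α) ∈ h.gr 1 := by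
  simpa using Φ.degree k (fun _ => 1) (fun _ => α) (fun _ => hα)

theorem LInftyMorphism.app_cons_mem {i : ℤ} {x α : G} (hx : x ∈ g.gr i) (hα : α ∈ g.gr 1)
    (k : ℕ) : Φ.app (k + 1) (Fin.cons x (fun _ => α)) ∈ h.gr i := by
  have := Φ.degree (k + 1) (Fin.cons i (fun _ => 1)) (Fin.cons x (fun _ => α)) (by
    intro j
    refine Fin.cases ?_ (fun j => ?_) j <;> simpa)
  simpa [Fin.sum_univ_succ] using this

theorem chiSign_update_zero_smul {M : Type*} [AddCommGroup M] [Module 𝕜 M] {m : ℕ}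
    (σ : Equiv.Perm (Fin (m + 1))) (x : M) :
    chiSign σ (Function.update (fun _ => 1) 0 0) • x = (-1 : 𝕜) ^ (σ⁻¹ 0 : ℕ) • x := by
  rw [chiSign_update_zero, units_smul_eq (𝕜 := 𝕜)]
  simp

/-- The alternating sum of the terms in which `γ` takes one of the places of `α` in
`Φ(x, α, …, α)`. -/
def LInftyMorphism.altSum (x γ α : G) (m : ℕ) : H :=
  ∑ j : Fin m, (-1 : 𝕜) ^ (j : ℕ) •
    Φ.app (m + 1) (Fin.cons x (Function.update (fun _ => α) j γ))

section CharZero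

variable [CharZero 𝕜]

theorem LInftyMorphism.diffTerm_const (m : ℕ) (α : G) :
    lInftyDiffTerm g Φ.app m (fun _ => 1) (fun _ => α) =
      ((m + 1 : ℕ) : 𝕜) • Φ.app (m + 1) (Fin.cons (g.d α) (fun _ => α)) := by
  have hm : ((m ! : ℕ) : 𝕜) ≠ 0 := Nat.cast_ne_zero.mpr m.factorial_ne_zero
  simp only [lInftyDiffTerm, chiSign_one, one_smul, Finset.sum_const, Finset.card_univ,
    Fintype.card_perm, Fintype.card_fin]
  rw [← Nat.cast_smul_eq_nsmul 𝕜, smul_smul, Nat.factorial_succ]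
  congr 1
  push_cast
  field_simp

theorem LInftyMorphism.bracketTerm_const (m : ℕ) (α : G) :
    lInftyBracketTerm g Φ.app (m + 1) (fun _ => 1) (fun _ => α) =
      ((m + 2 : 𝕜) * (m + 1) / 2) • Φ.app (m + 1) (Fin.cons (g.bracket α α) (fun _ => α)) := by
  have hm : ((m ! : ℕ) : 𝕜) ≠ 0 := Nat.cast_ne_zero.mpr m.factorial_ne_zero
  simp only [lInftyBracketTerm, chiSign_one, one_smul, Finset.sum_const, Finset.card_univ,
    Fintype.card_perm, Fintype.card_fin]
  rw [← Nat.cast_smul_eq_nsmul 𝕜, smul_smul, Nat.factorial_succ (m + 1), Nat.factorial_succ m]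
  congr 1
  push_cast
  field_simp
  norm_num
  ring

theorem LInftyMorphism.productTerm_const (k : ℕ) (α : G) :
    lInftyProductTerm h Φ.app (k + 2) (fun _ => 1) (fun _ => α) =
      (2 : 𝕜)⁻¹ • ∑ q ∈ Finset.HasAntidiagonal.antidiagonal k,
        ((-1 : 𝕜) ^ (q.1 + q.2 * (q.1 + 1)) * (((k + 2)! : ℕ) : 𝕜) *
          (((q.1 + 1)! : ℕ) : 𝕜)⁻¹ * (((q.2 + 1)! : ℕ) : 𝕜)⁻¹) •
          h.bracket (Φ.app (q.1 + 1) (fun _ => α)) (Φ.app (q.2 + 1) (fun _ => α)) := by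
  refine Φ.productTerm_eq fun a b hab => ?_
  have hs : ((((a + 1 : ℕ) : ℤ) - 1).negOnePow * ((((b + 1 : ℕ) : ℤ) - 1) *
      ∑ i : Fin (a + 1), 1).negOnePow) = ((a + b * (a + 1) : ℕ) : ℤ).negOnePow := by
    rw [← Int.negOnePow_add]
    simp
  simp only [lInftyProductSummand, chiSign_one, one_mul, hs, negOnePow_natCast_smul (𝕜 := 𝕜)]
  simp only [Finset.sum_const, Finset.card_univ, Fintype.card_perm, Fintype.card_fin]
  rw [← Nat.cast_smul_eq_nsmul 𝕜, smul_smul, smul_smul]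
  congr 1
  push_cast
  rw [mul_inv]
  ring

/-- Permutations are grouped by the place of `γ`. Place `0` gives `∂γ`; at place `j + 1` the
differential hits an `α`, and the shift by one explains the minus sign. -/
theorem LInftyMorphism.diffTerm_update (m : ℕ) (γ α : G) :
    lInftyDiffTerm g Φ.app m (Function.update (fun _ => 1) 0 0)
        (Function.update (fun _ => α) 0 γ) =
      Φ.app (m + 1) (Fin.cons (g.d γ) (fun _ => α)) - Φ.altSum (g.d α) γ α m := by
  have hm : ((m ! : ℕ) : 𝕜) ≠ 0 := Nat.cast_ne_zero.mpr m.factorial_ne_zero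
  simp only [lInftyDiffTerm, chiSign_update_zero_smul (𝕜 := 𝕜), update_perm_apply]
  rw [sum_perm_inv_zero (fun j : Fin (m + 1) => (-1 : 𝕜) ^ (j : ℕ) • Φ.app (m + 1)
    (Fin.cons (g.d ((Function.update (fun _ => α) j γ : Fin (m + 1) → G) 0))
      fun i => (Function.update (fun _ => α) j γ : Fin (m + 1) → G) i.succ)),
    ← Nat.cast_smul_eq_nsmul 𝕜, smul_smul, inv_mul_cancel₀ hm, one_smul, Fin.sum_univ_succ,
    LInftyMorphism.altSum, sub_eq_add_neg, ← Finset.sum_neg_distrib]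
  congr 1
  · simp
  · refine Finset.sum_congr rfl fun j _ => ?_
    rw [Fin.val_succ, pow_succ, mul_neg_one, neg_smul]
    have e1 : (Function.update (fun _ => α) j.succ γ : Fin (m + 1) → G) 0 = α :=
      Function.update_of_ne (Fin.succ_ne_zero j).symm _ _
    have e2 : (fun i : Fin m => (Function.update (fun _ => α) j.succ γ : Fin (m + 1) → G) i.succ) =
        Function.update (fun _ => α) j γ := by
      funext i
      simp [Function.update_apply]
    rw [e1, e2]

/-- With `γ` in place `0` or `1` the two contributions agree, since `-[α, γ] = [γ, α]`. In later
places `γ` leaves `[α, α]` in front, and the shift by two leaves the sign unchanged. -/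
theorem LInftyMorphism.bracketTerm_update {i : ℕ} {γ α : G} (hγ : γ ∈ g.gr 0)
    (hα : α ∈ g.gr 1) :
    lInftyBracketTerm g Φ.app (i + 1) (Function.update (fun _ => 1) 0 0)
        (Function.update (fun _ => α) 0 γ) =
      ((i + 1 : ℕ) : 𝕜) • (Φ.app (i + 1) (Fin.cons (g.bracket γ α) (fun _ => α)) +
        (2 : 𝕜)⁻¹ • Φ.altSum (g.bracket α α) γ α i) := by
  have hm : ((i ! : ℕ) : 𝕜) ≠ 0 := Nat.cast_ne_zero.mpr i.factorial_ne_zero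
  have hsymm : g.bracket α γ = (-1 : 𝕜) • g.bracket γ α := by
    simpa using g.bracket_symm 1 0 α γ hα hγ
  simp only [lInftyBracketTerm, chiSign_update_zero_smul (𝕜 := 𝕜), update_perm_apply]
  rw [sum_perm_inv_zero (fun j : Fin (i + 2) => (-1 : 𝕜) ^ (j : ℕ) • Φ.app (i + 1)
    (Fin.cons (g.bracket ((Function.update (fun _ => α) j γ : Fin (i + 2) → G) 0)
        ((Function.update (fun _ => α) j γ : Fin (i + 2) → G) 1))
      fun l => (Function.update (fun _ => α) j γ : Fin (i + 2) → G) l.succ.succ)),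
    ← Nat.cast_smul_eq_nsmul 𝕜, smul_smul, Fin.sum_univ_succ, Fin.sum_univ_succ]
  have e0 : ∀ j : Fin i, (-1 : 𝕜) ^ (j.succ.succ : ℕ) • Φ.app (i + 1)
      (Fin.cons (g.bracket ((Function.update (fun _ => α) j.succ.succ γ : Fin (i + 2) → G) 0)
        ((Function.update (fun _ => α) j.succ.succ γ : Fin (i + 2) → G) 1))
      fun l => (Function.update (fun _ => α) j.succ.succ γ : Fin (i + 2) → G) l.succ.succ) =
      (-1 : 𝕜) ^ (j : ℕ) • Φ.app (i + 1)
        (Fin.cons (g.bracket α α) (Function.update (fun _ => α) j γ)) := by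
    intro j
    rw [Fin.val_succ, Fin.val_succ, pow_add, pow_add, mul_assoc]
    congr 1
    · norm_num
    have ea : (Function.update (fun _ => α) j.succ.succ γ : Fin (i + 2) → G) 0 = α :=
      Function.update_of_ne (Fin.succ_ne_zero _).symm _ _
    have eb : (Function.update (fun _ => α) j.succ.succ γ : Fin (i + 2) → G) 1 = α :=
      Function.update_of_ne (by
        rw [← Fin.succ_zero_eq_one, Ne, Fin.succ_inj]
        exact (Fin.succ_ne_zero _).symm) _ _
    have ec : (fun l : Fin i =>
        (Function.update (fun _ => α) j.succ.succ γ : Fin (i + 2) → G) l.succ.succ) =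
        Function.update (fun _ => α) j γ := by
      funext l
      simp [Function.update_apply]
    rw [ea, eb, ec]
  have e1 : (-1 : 𝕜) ^ ((Fin.succ 0 : Fin (i + 2)) : ℕ) • Φ.app (i + 1)
      (Fin.cons (g.bracket ((Function.update (fun _ => α) (Fin.succ 0) γ : Fin (i + 2) → G) 0)
        ((Function.update (fun _ => α) (Fin.succ 0) γ : Fin (i + 2) → G) 1))
      fun l => (Function.update (fun _ => α) (Fin.succ 0) γ : Fin (i + 2) → G) l.succ.succ) =
      Φ.app (i + 1) (Fin.cons (g.bracket γ α) (fun _ => α)) := by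
    have ea : (Function.update (fun _ => α) (Fin.succ 0) γ : Fin (i + 2) → G) 0 = α := by simp
    have eb : (Function.update (fun _ => α) (Fin.succ 0) γ : Fin (i + 2) → G) 1 = γ := by simp
    have ec : (fun l : Fin i =>
        (Function.update (fun _ => α) (Fin.succ 0) γ : Fin (i + 2) → G) l.succ.succ) =
        fun _ => α := by
      funext l
      exact Function.update_of_ne (by rw [Ne, Fin.succ_inj]; exact Fin.succ_ne_zero _) _ _
    rw [ea, eb, ec, hsymm]
    have := (Φ.app (i + 1)).cons_smul (fun _ => α) (-1) (g.bracket γ α)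
    rw [this, smul_smul]
    simp
  have e2 : (-1 : 𝕜) ^ ((0 : Fin (i + 2)) : ℕ) • Φ.app (i + 1)
      (Fin.cons (g.bracket ((Function.update (fun _ => α) 0 γ : Fin (i + 2) → G) 0)
        ((Function.update (fun _ => α) 0 γ : Fin (i + 2) → G) 1))
      fun l => (Function.update (fun _ => α) 0 γ : Fin (i + 2) → G) l.succ.succ) =
      Φ.app (i + 1) (Fin.cons (g.bracket γ α) (fun _ => α)) := by
    simp
  rw [e1, e2]
  simp only [e0]
  rw [← LInftyMorphism.altSum, ← add_assoc, ← two_smul 𝕜, smul_add, smul_smul, smul_add, smul_smul]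
  congr 2
  · rw [Nat.factorial_succ i]
    push_cast
    field_simp
    norm_num
  · rw [Nat.factorial_succ i]
    push_cast
    field_simp
    norm_num

end CharZero

end Relations

section Relations

variable {𝕜 : Type u} {G : Type v} {H : Type w} [Field 𝕜] [AddCommGroup G] [Module 𝕜 G]
  [AddCommGroup H] [Module 𝕜 H] {g : DGLieAlgebra 𝕜 G} {h : DGLieAlgebra 𝕜 H}
  (Φ : LInftyMorphism g h)

theorem sum_fin_eq_of_add_eq {M : Type*} [AddCommMonoid M] {s t n : ℕ} (hst : s + t = n)
    (f : Fin n → M) : ∑ j, f j = ∑ i : Fin s, f (Fin.cast hst (Fin.castAdd t i)) +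
      ∑ i : Fin t, f (Fin.cast hst (Fin.natAdd s i)) := by
  subst hst
  simpa using Fin.sum_univ_add f

theorem update_castAdd_castAdd {M : Type*} {s t n : ℕ} (hst : s + t = n) (x y : M) (i : Fin s) :
    (fun l : Fin s => (Function.update (fun _ => y) (Fin.cast hst (Fin.castAdd t i)) x :
      Fin n → M) (Fin.cast hst (Fin.castAdd t l))) = Function.update (fun _ => y) i x := by
  funext l
  simp [Function.update_apply, Fin.ext_iff]

theorem update_natAdd_natAdd {M : Type*} {s t n : ℕ} (hst : s + t = n) (x y : M) (i : Fin t) :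
    (fun l : Fin t => (Function.update (fun _ => y) (Fin.cast hst (Fin.natAdd s i)) x :
      Fin n → M) (Fin.cast hst (Fin.natAdd s l))) = Function.update (fun _ => y) i x := by
  funext l
  simp [Function.update_apply, Fin.ext_iff]

theorem update_castAdd_natAdd {M : Type*} {s t n : ℕ} (hst : s + t = n) (x y : M) (i : Fin s) :
    (fun l : Fin t => (Function.update (fun _ => y) (Fin.cast hst (Fin.castAdd t i)) x :
      Fin n → M) (Fin.cast hst (Fin.natAdd s l))) = fun _ => y := by
  funext l
  have : s + (l : ℕ) ≠ i := by omega
  simp [Fin.ext_iff, this]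

theorem update_natAdd_castAdd {M : Type*} {s t n : ℕ} (hst : s + t = n) (x y : M) (i : Fin t) :
    (fun l : Fin s => (Function.update (fun _ => y) (Fin.cast hst (Fin.natAdd s i)) x :
      Fin n → M) (Fin.cast hst (Fin.castAdd t l))) = fun _ => y := by
  funext l
  have : (l : ℕ) ≠ s + i := by omega
  simp [Fin.ext_iff, this]

theorem add_choose_two_eq (a b : ℕ) :
    (a + b).choose 2 = a.choose 2 + b.choose 2 + a * b := by
  induction b with
  | zero => simp
  | succ b ih =>
    rw [← add_assoc, Nat.choose_succ_succ' (a + b) 1, Nat.choose_succ_succ' b 1, ih]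
    simp only [Nat.choose_one_right]
    ring

theorem neg_one_pow_eq_of_even {𝕜 : Type*} [Field 𝕜] {m n : ℕ} (h : Even (m + n)) :
    (-1 : 𝕜) ^ m = (-1) ^ n := by
  have h1 : (-1 : 𝕜) ^ m * (-1) ^ n = 1 := by rw [← pow_add, h.neg_one_pow]
  have h2 : (-1 : 𝕜) ^ n * (-1) ^ n = 1 := by rw [← pow_add, Even.neg_one_pow ⟨n, rfl⟩]
  have h3 : (-1 : 𝕜) ^ n ≠ 0 := pow_ne_zero _ (by simp)
  exact mul_right_cancel₀ h3 (h1.trans h2.symm)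

/-! ### The coefficients of the direct image and of its derivatives -/

/-- The terms of the series `Φ_*(α)`. -/
def LInftyMorphism.pushTerm (α : G) (j : ℕ) : H :=
  ((-1 : 𝕜) ^ (j.choose 2) * (((j + 1)! : ℕ) : 𝕜)⁻¹) • Φ.app (j + 1) (fun _ => α)

/-- The terms of the derivative of the series `Φ_*(α)` in the direction `x`. -/
def LInftyMorphism.linTerm (x α : G) (j : ℕ) : H :=
  ((-1 : 𝕜) ^ (j.choose 2) * ((j ! : ℕ) : 𝕜)⁻¹) • Φ.app (j + 1) (Fin.cons x fun _ => α)

theorem LInftyMorphism.linTerm_linear (α : G) (j : ℕ) :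
    IsLinearMap 𝕜 (fun x => Φ.linTerm x α j) where
  map_add x y := by
    simp only [linTerm]
    rw [(Φ.app (j + 1)).cons_add, smul_add]
  map_smul c x := by
    simp only [linTerm]
    rw [(Φ.app (j + 1)).cons_smul, smul_comm]

section CharZero

variable [CharZero 𝕜]

/-- All places of `γ` within one block contribute equally: moving `γ` to the front of its block
cancels the sign of its place. If `γ` is in the second block, the bracket is reversed, so that the
second term is the first with `a` and `b` exchanged. -/
theorem LInftyMorphism.productSummand_update {k a b : ℕ} (hab : a + 1 + (b + 1) = k + 2)
    {γ α : G} (hγ : γ ∈ g.gr 0) (hα : α ∈ g.gr 1) :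
    lInftyProductSummand h Φ.app (k + 2) (Function.update (fun _ => 1) 0 0)
        (Function.update (fun _ => α) 0 γ) (a + 1) (b + 1) hab =
      ((-1 : 𝕜) ^ (a * (b + 1)) * (((k + 1)! : ℕ) : 𝕜) * ((a ! : ℕ) : 𝕜)⁻¹ *
        (((b + 1)! : ℕ) : 𝕜)⁻¹) • h.bracket (Φ.app (a + 1) (Fin.cons γ fun _ => α))
          (Φ.app (b + 1) (fun _ => α)) +
      ((-1 : 𝕜) ^ (b * (a + 1)) * (((k + 1)! : ℕ) : 𝕜) * ((b ! : ℕ) : 𝕜)⁻¹ *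
        (((a + 1)! : ℕ) : 𝕜)⁻¹) • h.bracket (Φ.app (b + 1) (Fin.cons γ fun _ => α))
          (Φ.app (a + 1) (fun _ => α)) := by
  set X := h.bracket (Φ.app (a + 1) (Fin.cons γ fun _ => α)) (Φ.app (b + 1) (fun _ => α))
  set Y := h.bracket (Φ.app (b + 1) (Fin.cons γ fun _ => α)) (Φ.app (a + 1) (fun _ => α))
  have hY : h.bracket (Φ.app (a + 1) (fun _ => α)) (Φ.app (b + 1) (Fin.cons γ fun _ => α)) =
      -Y := by
    simpa using h.bracket_symm 1 0 _ _ (Φ.app_const_mem hα (a + 1)) (Φ.app_cons_mem hγ hα b)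
  let d : Fin (k + 2) → Fin (k + 2) → ℤ := fun j => Function.update (fun _ => 1) j 0
  let e : Fin (k + 2) → Fin (k + 2) → G := fun j => Function.update (fun _ => α) j γ
  let F : Fin (k + 2) → H := fun j => (-1 : 𝕜) ^ (j : ℕ) •
    ((((a + 1 : ℕ) : ℤ) - 1).negOnePow *
      ((((b + 1 : ℕ) : ℤ) - 1) * ∑ i, d j (Fin.cast hab (Fin.castAdd (b + 1) i))).negOnePow) •
      h.bracket (Φ.app (a + 1) (fun i => e j (Fin.cast hab (Fin.castAdd (b + 1) i))))
        (Φ.app (b + 1) (fun i => e j (Fin.cast hab (Fin.natAdd (a + 1) i))))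
  have h1 : lInftyProductSummand h Φ.app (k + 2) (Function.update (fun _ => 1) 0 0)
        (Function.update (fun _ => α) 0 γ) (a + 1) (b + 1) hab =
      (((a + 1)! * (b + 1)! : ℕ) : 𝕜)⁻¹ • ∑ τ : Equiv.Perm (Fin (k + 2)), F (τ⁻¹ 0) := by
    unfold lInftyProductSummand
    congr 1
    refine Finset.sum_congr rfl fun τ _ => ?_
    rw [mul_assoc, mul_smul, chiSign_update_zero_smul (𝕜 := 𝕜)]
    simp only [update_perm_apply]
    rfl
  have hF1 : ∀ i : Fin (a + 1), F (Fin.cast hab (Fin.castAdd (b + 1) i)) =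
      (-1 : 𝕜) ^ (a * (b + 1)) • X := by
    intro i
    have hd := update_castAdd_castAdd hab (0 : ℤ) 1 i
    -- One of the `a + 1` arguments is `γ`, of degree zero, so the total degree is `a`.
    have hs : ∑ l : Fin (a + 1), (Function.update (fun _ => (1 : ℤ)) i 0 : Fin (a + 1) → ℤ) l =
        a := by
      rw [Finset.sum_update_of_mem (Finset.mem_univ i)]
      simp [Finset.card_sdiff]
    have hn : ((((a + 1 : ℕ) : ℤ) - 1).negOnePow * ((((b + 1 : ℕ) : ℤ) - 1) * (a : ℤ)).negOnePow)
        = ((a * (b + 1) : ℕ) : ℤ).negOnePow := by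
      rw [← Int.negOnePow_add]
      congr 1
      push_cast
      ring
    simp only [F, d, e]
    rw [update_castAdd_castAdd hab γ α i, update_castAdd_natAdd, hd, hs, hn,
      negOnePow_natCast_smul (𝕜 := 𝕜), smul_comm]
    congr 1
    rw [← LinearMap.smul_apply, ← map_smul]
    congr 2
    rw [Φ.app_update_zero hγ hα i]
    simp
  have hF2 : ∀ i : Fin (b + 1), F (Fin.cast hab (Fin.natAdd (a + 1) i)) =
      (-1 : 𝕜) ^ (b * (a + 1)) • Y := by
    intro i
    have hn : ((((a + 1 : ℕ) : ℤ) - 1).negOnePow *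
        ((((b + 1 : ℕ) : ℤ) - 1) * ∑ _l : Fin (a + 1), (1 : ℤ)).negOnePow) =
          ((a + b * (a + 1) : ℕ) : ℤ).negOnePow := by
      rw [← Int.negOnePow_add]
      congr 1
      simp
    simp only [F, d, e]
    rw [update_natAdd_natAdd, update_natAdd_castAdd hab γ α i,
      update_natAdd_castAdd hab (0 : ℤ) 1 i, hn,
      negOnePow_natCast_smul (𝕜 := 𝕜)]
    have hz : (-1 : 𝕜) ^ (i : ℕ) • h.bracket (Φ.app (a + 1) (fun _ => α))
        (Φ.app (b + 1) (Function.update (fun _ => α) i γ)) = -Y := by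
      rw [← map_smul, ← Φ.app_update_zero hγ hα i, hY]
    rw [show ((Fin.cast hab (Fin.natAdd (a + 1) i) : Fin (k + 2)) : ℕ) = a + 1 + i from rfl,
      pow_add, mul_smul, smul_comm ((-1 : 𝕜) ^ (i : ℕ)), hz, smul_smul, smul_neg, ← neg_smul]
    congr 1
    have e1 : (-1 : 𝕜) ^ a * (-1) ^ a = 1 := by rw [← pow_add, Even.neg_one_pow ⟨a, rfl⟩]
    calc -((-1 : 𝕜) ^ (a + 1) * (-1) ^ (a + b * (a + 1)))
        = ((-1 : 𝕜) ^ a * (-1) ^ a) * (-1) ^ (b * (a + 1)) := by ring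
      _ = _ := by rw [e1, one_mul]
  rw [h1, sum_perm_inv_zero, sum_fin_eq_of_add_eq hab]
  simp only [hF1, hF2, Finset.sum_const, Finset.card_univ, Fintype.card_fin]
  have ha : ((a ! : ℕ) : 𝕜) ≠ 0 := Nat.cast_ne_zero.mpr a.factorial_ne_zero
  have hb : ((b ! : ℕ) : 𝕜) ≠ 0 := Nat.cast_ne_zero.mpr b.factorial_ne_zero
  have ha' : ((a : 𝕜) + 1) ≠ 0 := Nat.cast_add_one_ne_zero a
  have hb' : ((b : 𝕜) + 1) ≠ 0 := Nat.cast_add_one_ne_zero b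
  simp only [← Nat.cast_smul_eq_nsmul 𝕜, smul_add, smul_smul]
  congr 2
  · rw [Nat.factorial_succ a]
    push_cast
    field_simp
  · rw [Nat.factorial_succ b]
    push_cast
    field_simp

/-- The two terms of each summand are exchanged by swapping the arities, so the sum doubles and
absorbs the factor `1/2`. -/
theorem LInftyMorphism.productTerm_update (k : ℕ) {γ α : G} (hγ : γ ∈ g.gr 0)
    (hα : α ∈ g.gr 1) :
    lInftyProductTerm h Φ.app (k + 2) (Function.update (fun _ => 1) 0 0)
        (Function.update (fun _ => α) 0 γ) =
      ∑ q ∈ Finset.HasAntidiagonal.antidiagonal k,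
        ((-1 : 𝕜) ^ (q.1 * (q.2 + 1)) * (((k + 1)! : ℕ) : 𝕜) * ((q.1 ! : ℕ) : 𝕜)⁻¹ *
          (((q.2 + 1)! : ℕ) : 𝕜)⁻¹) • h.bracket (Φ.app (q.1 + 1) (Fin.cons γ fun _ => α))
            (Φ.app (q.2 + 1) (fun _ => α)) := by
  let U : ℕ × ℕ → H := fun q =>
    ((-1 : 𝕜) ^ (q.1 * (q.2 + 1)) * (((k + 1)! : ℕ) : 𝕜) * ((q.1 ! : ℕ) : 𝕜)⁻¹ *
          (((q.2 + 1)! : ℕ) : 𝕜)⁻¹) • h.bracket (Φ.app (q.1 + 1) (Fin.cons γ fun _ => α))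
            (Φ.app (q.2 + 1) (fun _ => α))
  rw [Φ.productTerm_eq (T := fun q => U q + U q.swap)
    (fun a b hab => Φ.productSummand_update hab hγ hα), Finset.sum_add_distrib,
    Finset.Nat.sum_antidiagonal_swap, ← two_smul 𝕜, smul_smul, inv_mul_cancel₀ two_ne_zero,
    one_smul]

theorem LInftyMorphism.d_pushTerm_zero {α : G} (hα : α ∈ g.gr 1) :
    h.d (Φ.pushTerm α 0) = Φ.linTerm (g.d α) α 0 := by
  have h1 := Φ.relation 0 (fun _ => 1) (fun _ => α) (fun _ => hα)
  rw [Φ.diffTerm_const, Φ.productTerm_one] at h1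
  simp only [pushTerm, linTerm]
  simpa [lInftyBracketTerm, ← sub_eq_add_neg, sub_eq_zero] using h1

/-- This is the relation of arity `k + 2` on copies of `α`, scaled by the coefficient of `Φ_*` in
that arity. The signs `(-1)^(j.choose 2)` are the ones that turn the product term into a Cauchy
product, by `add_choose_two_eq`. -/
theorem LInftyMorphism.d_pushTerm_succ {α : G} (hα : α ∈ g.gr 1) (k : ℕ) :
    h.d (Φ.pushTerm α (k + 1)) + (2 : 𝕜)⁻¹ • ∑ q ∈ Finset.HasAntidiagonal.antidiagonal k,
      h.bracket (Φ.pushTerm α q.1) (Φ.pushTerm α q.2) =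
      (-1 : 𝕜) ^ (k + 1) • Φ.linTerm (g.d α) α (k + 1) +
        (2 : 𝕜)⁻¹ • (-1 : 𝕜) ^ k • Φ.linTerm (g.bracket α α) α k := by
  have h1 := Φ.relation (k + 1) (fun _ => 1) (fun _ => α) (fun _ => hα)
  rw [Φ.diffTerm_const, Φ.bracketTerm_const, Φ.productTerm_const] at h1
  have hk : ((k ! : ℕ) : 𝕜) ≠ 0 := Nat.cast_ne_zero.mpr k.factorial_ne_zero
  have hk1 : ((k : 𝕜) + 1) ≠ 0 := Nat.cast_add_one_ne_zero k
  have hk2 : ((k : 𝕜) + 1 + 1) ≠ 0 := by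
    simpa using (Nat.cast_add_one_ne_zero (k + 1) : ((k + 1 : ℕ) : 𝕜) + 1 ≠ 0)
  have hc : (k + 1).choose 2 = k.choose 2 + k := by
    rw [Nat.choose_succ_succ' k 1, Nat.choose_one_right, add_comm]
  have hsum : ((-1 : 𝕜) ^ ((k + 1).choose 2) * (((k + 2)! : ℕ) : 𝕜)⁻¹) •
      ∑ q ∈ Finset.HasAntidiagonal.antidiagonal k,
        ((-1 : 𝕜) ^ (q.1 + q.2 * (q.1 + 1)) * (((k + 2)! : ℕ) : 𝕜) *
          (((q.1 + 1)! : ℕ) : 𝕜)⁻¹ * (((q.2 + 1)! : ℕ) : 𝕜)⁻¹) •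
          h.bracket (Φ.app (q.1 + 1) (fun _ => α)) (Φ.app (q.2 + 1) (fun _ => α)) =
      ∑ q ∈ Finset.HasAntidiagonal.antidiagonal k,
        h.bracket (Φ.pushTerm α q.1) (Φ.pushTerm α q.2) := by
    rw [Finset.smul_sum]
    refine Finset.sum_congr rfl fun q hq => ?_
    obtain ⟨a, b⟩ := q
    obtain rfl : a + b = k := Finset.HasAntidiagonal.mem_antidiagonal.mp hq
    have hf : (((a + b + 2)! : ℕ) : 𝕜) ≠ 0 := Nat.cast_ne_zero.mpr (Nat.factorial_ne_zero _)
    have hs : (-1 : 𝕜) ^ ((a + b + 1).choose 2 + (a + b * (a + 1))) =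
        (-1) ^ (a.choose 2 + b.choose 2) := by
      refine neg_one_pow_eq_of_even ?_
      rw [hc, add_choose_two_eq]
      exact ⟨a.choose 2 + b.choose 2 + a * b + a + b, by ring⟩
    simp only [pushTerm, map_smul, LinearMap.smul_apply, smul_smul]
    congr 1
    rw [pow_add, pow_add _ (a.choose 2)] at hs
    calc _ = ((-1 : 𝕜) ^ ((a + b + 1).choose 2) * (-1) ^ (a + b * (a + 1))) *
          ((((a + b + 2)! : ℕ) : 𝕜)⁻¹ * ((a + b + 2)! : ℕ)) * ((((a + 1)! : ℕ) : 𝕜)⁻¹ *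
          (((b + 1)! : ℕ) : 𝕜)⁻¹) := by ring
      _ = _ := by rw [hs, inv_mul_cancel₀ hf]; ring
  have h2 := congrArg (fun x => ((-1 : 𝕜) ^ ((k + 1).choose 2) * (((k + 2)! : ℕ) : 𝕜)⁻¹) • x) h1
  simp only [smul_add, smul_sub, smul_zero] at h2
  rw [smul_comm _ (2 : 𝕜)⁻¹, hsum, smul_smul, smul_smul, smul_smul] at h2
  rw [pushTerm, map_smul, linTerm, linTerm, smul_smul, smul_smul, smul_smul]
  have c1 : (-1 : 𝕜) ^ ((k + 1).choose 2) * (((k + 2)! : ℕ) : 𝕜)⁻¹ * ((-1) ^ (k + 1 + 1) *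
      ((k + 1 + 1 : ℕ) : 𝕜)) =
      -((-1 : 𝕜) ^ (k + 1) * ((-1) ^ ((k + 1).choose 2) * (((k + 1)! : ℕ) : 𝕜)⁻¹)) := by
    rw [Nat.factorial_succ (k + 1), Nat.factorial_succ k]
    push_cast
    field_simp
    ring
  have c2 : (-1 : 𝕜) ^ ((k + 1).choose 2) * (((k + 2)! : ℕ) : 𝕜)⁻¹ *
      ((k + 2 : 𝕜) * (k + 1) / 2) =
      (2 : 𝕜)⁻¹ * ((-1) ^ k * ((-1 : 𝕜) ^ (k.choose 2) * ((k ! : ℕ) : 𝕜)⁻¹)) := by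
    rw [Nat.factorial_succ (k + 1), Nat.factorial_succ k, hc, pow_add]
    push_cast
    field_simp
    ring
  rw [← mul_assoc] at c1
  rw [c1, c2, neg_smul] at h2
  rw [mul_assoc (2 : 𝕜)⁻¹]
  rw [← sub_eq_zero, ← h2]
  abel

theorem LInftyMorphism.d_linTerm_zero {γ α : G} (hγ : γ ∈ g.gr 0) (hα : α ∈ g.gr 1) :
    h.d (Φ.linTerm γ α 0) = Φ.linTerm (g.d γ) α 0 := by
  have h1 := Φ.relation 0 (Function.update (fun _ => 1) 0 0) (Function.update (fun _ => α) 0 γ)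
    (update_zero_mem hγ hα)
  rw [Φ.diffTerm_update, Φ.productTerm_one, update_zero_eq_cons] at h1
  simp only [linTerm]
  simpa [lInftyBracketTerm, altSum, ← sub_eq_add_neg, sub_eq_zero] using h1

/-- This is the relation of arity `k + 2` on `(γ, α, …, α)`. The terms with `altSum` are arranged so
that they telescope in `k` once `∂α = -1/2 [α, α]`. -/
theorem LInftyMorphism.d_linTerm_succ {γ α : G} (hγ : γ ∈ g.gr 0) (hα : α ∈ g.gr 1) (k : ℕ) :
    h.d ((-1 : 𝕜) ^ (k + 1) • Φ.linTerm γ α (k + 1)) -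
      ∑ q ∈ Finset.HasAntidiagonal.antidiagonal k,
        h.bracket ((-1 : 𝕜) ^ q.1 • Φ.linTerm γ α q.1) (Φ.pushTerm α q.2) =
      Φ.linTerm (g.d γ) α (k + 1) - Φ.linTerm (g.bracket γ α) α k -
        (((-1 : 𝕜) ^ ((k + 1).choose 2) * (((k + 1)! : ℕ) : 𝕜)⁻¹) •
          Φ.altSum (g.d α) γ α (k + 1) +
        (2 : 𝕜)⁻¹ • ((-1 : 𝕜) ^ (k.choose 2) * ((k ! : ℕ) : 𝕜)⁻¹) •
          Φ.altSum (g.bracket α α) γ α k) := by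
  have h1 := Φ.relation (k + 1) (Function.update (fun _ => 1) 0 0)
    (Function.update (fun _ => α) 0 γ) (update_zero_mem hγ hα)
  rw [Φ.diffTerm_update, Φ.bracketTerm_update hγ hα, Φ.productTerm_update k hγ hα,
    update_zero_eq_cons] at h1
  have hk : ((k ! : ℕ) : 𝕜) ≠ 0 := Nat.cast_ne_zero.mpr k.factorial_ne_zero
  have hk1 : ((k : 𝕜) + 1) ≠ 0 := Nat.cast_add_one_ne_zero k
  have hc : (k + 1).choose 2 = k.choose 2 + k := by
    rw [Nat.choose_succ_succ' k 1, Nat.choose_one_right, add_comm]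
  set s : 𝕜 := (-1) ^ (k + 1) * ((-1) ^ ((k + 1).choose 2) * (((k + 1)! : ℕ) : 𝕜)⁻¹) with hs
  have hsum : s • ∑ q ∈ Finset.HasAntidiagonal.antidiagonal k,
        ((-1 : 𝕜) ^ (q.1 * (q.2 + 1)) * (((k + 1)! : ℕ) : 𝕜) * ((q.1 ! : ℕ) : 𝕜)⁻¹ *
          (((q.2 + 1)! : ℕ) : 𝕜)⁻¹) • h.bracket (Φ.app (q.1 + 1) (Fin.cons γ fun _ => α))
            (Φ.app (q.2 + 1) (fun _ => α)) =
      -∑ q ∈ Finset.HasAntidiagonal.antidiagonal k,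
        h.bracket ((-1 : 𝕜) ^ q.1 • Φ.linTerm γ α q.1) (Φ.pushTerm α q.2) := by
    rw [Finset.smul_sum, ← Finset.sum_neg_distrib]
    refine Finset.sum_congr rfl fun q hq => ?_
    obtain ⟨a, b⟩ := q
    obtain rfl : a + b = k := Finset.HasAntidiagonal.mem_antidiagonal.mp hq
    have hf : (((a + b + 1)! : ℕ) : 𝕜) ≠ 0 := Nat.cast_ne_zero.mpr (Nat.factorial_ne_zero _)
    have hs' : (-1 : 𝕜) ^ (a + b + ((a + b + 1).choose 2 + a * (b + 1))) =
        (-1) ^ (a + (a.choose 2 + b.choose 2)) := by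
      refine neg_one_pow_eq_of_even ?_
      rw [hc, add_choose_two_eq]
      exact ⟨a.choose 2 + b.choose 2 + a * b + a + b + a, by ring⟩
    simp only [pushTerm, linTerm, map_smul, LinearMap.smul_apply, smul_smul]
    rw [← neg_smul]
    congr 1
    calc _ = -((-1 : 𝕜) ^ (a + b + ((a + b + 1).choose 2 + a * (b + 1)))) *
          ((((a + b + 1)! : ℕ) : 𝕜)⁻¹ * ((a + b + 1)! : ℕ)) * (((a ! : ℕ) : 𝕜)⁻¹ *
          (((b + 1)! : ℕ) : 𝕜)⁻¹) := by rw [hs]; ring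
      _ = _ := by rw [hs', inv_mul_cancel₀ hf]; ring
  have h2 := congrArg (fun x => s • x) h1
  simp only [smul_add, smul_sub, smul_zero] at h2
  rw [hsum] at h2
  simp only [smul_smul] at h2
  rw [map_smul, linTerm, linTerm, linTerm, map_smul, smul_smul, smul_smul, ← hs]
  have c1 : s * (-1) ^ (k + 1 + 1) = -((-1) ^ ((k + 1).choose 2) * (((k + 1)! : ℕ) : 𝕜)⁻¹) := by
    have e1 : (-1 : 𝕜) ^ k * (-1) ^ k = 1 := by rw [← pow_add, Even.neg_one_pow ⟨k, rfl⟩]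
    calc _ = -(((-1 : 𝕜) ^ k * (-1) ^ k) *
          ((-1) ^ ((k + 1).choose 2) * (((k + 1)! : ℕ) : 𝕜)⁻¹)) := by rw [hs]; ring
      _ = _ := by rw [e1, one_mul]
  have c2 : s * ((k + 1 : ℕ) : 𝕜) = -((-1) ^ (k.choose 2) * ((k ! : ℕ) : 𝕜)⁻¹) := by
    have e1 : (-1 : 𝕜) ^ k * (-1) ^ k = 1 := by rw [← pow_add, Even.neg_one_pow ⟨k, rfl⟩]
    have e2 : (((k + 1)! : ℕ) : 𝕜)⁻¹ * ((k + 1 : ℕ) : 𝕜) = ((k ! : ℕ) : 𝕜)⁻¹ := by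
      rw [Nat.factorial_succ k]
      push_cast
      field_simp
    calc _ = -(((-1 : 𝕜) ^ k * (-1) ^ k) *
          ((-1) ^ (k.choose 2) * ((((k + 1)! : ℕ) : 𝕜)⁻¹ * ((k + 1 : ℕ) : 𝕜)))) := by
            rw [hs, hc]; ring
      _ = _ := by rw [e1, one_mul, e2]
  have c3 : s * (((k + 1 : ℕ) : 𝕜) * 2⁻¹) =
      -((2 : 𝕜)⁻¹ * ((-1) ^ (k.choose 2) * ((k ! : ℕ) : 𝕜)⁻¹)) := by
    rw [← mul_assoc, c2]
    ring
  rw [c1, c2, c3] at h2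
  simp only [neg_smul] at h2
  rw [← sub_eq_zero, ← h2]
  abel

end CharZero

end Relations

/-! ### The direct image of degree one elements -/

section Push

variable {𝕜 : Type u} {G : Type v} {H : Type w} [Field 𝕜] [AddCommGroup G] [Module 𝕜 G]
  [AddCommGroup H] [Module 𝕜 H] {g : ProNilpotentDGLieAlgebra 𝕜 G}
  {h : ProNilpotentDGLieAlgebra 𝕜 H} {Φ : LInftyMorphism g.toDGLieAlgebra h.toDGLieAlgebra}

namespace ProNilpotentDGLieAlgebra

theorem isSum_succ_sub {f : ℕ → G} (hf : ∀ n, f n ∈ g.L n) :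
    g.IsSum (fun n => f (n + 1) - f n) (-f 0) := by
  refine fun r => ⟨r, fun n hn => ?_⟩
  rw [Finset.sum_range_sub, neg_sub_left, sub_add_cancel]
  exact neg_mem (g.mem_L_of_le hn (hf n))

end ProNilpotentDGLieAlgebra

open ProNilpotentDGLieAlgebra

namespace LInftyMorphism

/-- The `k` arguments other than `ξ j` lie in `L 1` and each contributes one filtration step. -/
theorem IsFiltered.app_mem (hΦ : Φ.IsFiltered) {k r : ℕ} {ξ : Fin (k + 1) → G} (j : Fin (k + 1))
    (hξ : ξ j ∈ g.L r) : Φ.app (k + 1) ξ ∈ h.L (r + k) := by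
  -- Filteredness speaks of steps `≥ 1` only; for `r = 0` the stronger case `r = 1` applies to every
  -- element.
  wlog hr : 1 ≤ r generalizing r
  · exact h.mem_L_of_le (by omega) (this (g.mem_L_one (ξ j)) le_rfl)
  have := hΦ (k + 1) (Function.update (fun _ => 1) j r) ξ (by omega) (fun i => ?_) (fun i => ?_)
  · rw [Finset.sum_update_of_mem (Finset.mem_univ j)] at this
    simpa [Finset.card_sdiff] using this
  · by_cases hi : i = j
    · subst hi; simpa
    · simp [hi]
  · by_cases hi : i = j
    · subst hi; simpa
    · simpa [hi] using g.mem_L_one _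

theorem linTerm_zero (x α : G) : Φ.linTerm x α 0 = Φ.linear x := by
  simp only [linTerm, linear]
  simp
  congr 1
  funext i
  rw [Fin.fin_one_eq_zero i]
  rfl

theorem pushTerm_zero (α : G) : Φ.pushTerm α 0 = Φ.linear α := by
  simp [pushTerm, linear]

theorem pushTerm_mem_gr {α : G} (hα : α ∈ g.gr 1) (j : ℕ) : Φ.pushTerm α j ∈ h.gr 1 :=
  Submodule.smul_mem _ _ (Φ.app_const_mem hα _)

theorem linTerm_mem_gr {i : ℤ} {x α : G} (hx : x ∈ g.gr i) (hα : α ∈ g.gr 1) (j : ℕ) :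
    Φ.linTerm x α j ∈ h.gr i :=
  Submodule.smul_mem _ _ (Φ.app_cons_mem hx hα _)

theorem IsFiltered.pushTerm_mem_L (hΦ : Φ.IsFiltered) (α : G) (j : ℕ) :
    Φ.pushTerm α j ∈ h.L j :=
  Submodule.smul_mem _ _ (by simpa using hΦ.app_mem (r := 0) 0 (g.mem_L_zero _))

theorem IsFiltered.linTerm_mem_L_add (hΦ : Φ.IsFiltered) {r : ℕ} {x : G} (hx : x ∈ g.L r) (α : G)
    (j : ℕ) : Φ.linTerm x α j ∈ h.L (r + j) :=
  Submodule.smul_mem _ _ (hΦ.app_mem 0 (by simpa using hx))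

theorem IsFiltered.linTerm_mem_L (hΦ : Φ.IsFiltered) (x α : G) (j : ℕ) :
    Φ.linTerm x α j ∈ h.L j := by
  simpa using hΦ.linTerm_mem_L_add (g.mem_L_zero x) α j

variable (Φ) in
/-- The sum `Φ_*(α)`. -/
noncomputable def push (α : G) : H := Classical.epsilon (h.IsSum (Φ.pushTerm α))

variable (Φ) in
/-- The gauge field along `Φ_*(α)` induced by the gauge field `γ` along `α`. -/
noncomputable def pushField (γ α : G) : H :=
  Classical.epsilon (h.IsSum fun j => (-1 : 𝕜) ^ j • Φ.linTerm γ α j)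

theorem IsFiltered.exists_isSum_push (hΦ : Φ.IsFiltered) {α : G} (hα : α ∈ g.gr 1) :
    ∃ x ∈ h.gr 1, h.IsSum (Φ.pushTerm α) x :=
  exists_isSum (pushTerm_mem_gr hα) (hΦ.pushTerm_mem_L α)

theorem IsFiltered.isSum_push (hΦ : Φ.IsFiltered) {α : G} (hα : α ∈ g.gr 1) :
    h.IsSum (Φ.pushTerm α) (Φ.push α) := by
  obtain ⟨x, _, hx⟩ := hΦ.exists_isSum_push hα
  exact Classical.epsilon_spec (p := h.IsSum _) ⟨x, hx⟩

theorem IsFiltered.push_mem (hΦ : Φ.IsFiltered) {α : G} (hα : α ∈ g.gr 1) :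
    Φ.push α ∈ h.gr 1 := by
  obtain ⟨x, hxi, hx⟩ := hΦ.exists_isSum_push hα
  rwa [(hΦ.isSum_push hα).unique hx]

theorem IsFiltered.exists_isSum_pushField (hΦ : Φ.IsFiltered) {γ α : G} (hγ : γ ∈ g.gr 0)
    (hα : α ∈ g.gr 1) : ∃ x ∈ h.gr 0, h.IsSum (fun j => (-1 : 𝕜) ^ j • Φ.linTerm γ α j) x :=
  exists_isSum (fun j => Submodule.smul_mem _ _ (linTerm_mem_gr hγ hα j))
    (fun j => Submodule.smul_mem _ _ (hΦ.linTerm_mem_L γ α j))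

theorem IsFiltered.isSum_pushField (hΦ : Φ.IsFiltered) {γ α : G} (hγ : γ ∈ g.gr 0)
    (hα : α ∈ g.gr 1) :
    h.IsSum (fun j => (-1 : 𝕜) ^ j • Φ.linTerm γ α j) (Φ.pushField γ α) := by
  obtain ⟨x, _, hx⟩ := hΦ.exists_isSum_pushField hγ hα
  exact Classical.epsilon_spec (p := h.IsSum _) ⟨x, hx⟩

theorem IsFiltered.pushField_mem (hΦ : Φ.IsFiltered) {γ α : G} (hγ : γ ∈ g.gr 0)
    (hα : α ∈ g.gr 1) : Φ.pushField γ α ∈ h.gr 0 := by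
  obtain ⟨x, hxi, hx⟩ := hΦ.exists_isSum_pushField hγ hα
  rwa [(hΦ.isSum_pushField hγ hα).unique hx]

theorem IsFiltered.app_sub_mem (hΦ : Φ.IsFiltered) {k r : ℕ} {ξ ξ' : Fin (k + 1) → G}
    (hξ : ∀ i, ξ i - ξ' i ∈ g.L r) : Φ.app (k + 1) ξ - Φ.app (k + 1) ξ' ∈ h.L (r + k) :=
  (Φ.app (k + 1)).sub_mem_of_forall (g.L r) (h.L (r + k)) (fun _ j hj => hΦ.app_mem j hj) hξ

/-- Components of arity at least two gain a filtration step, so `Φ_*` is `Φ¹` to leading order. -/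
theorem IsFiltered.push_sub_mem (hΦ : Φ.IsFiltered) {α α' : G} {r : ℕ} (hα : α ∈ g.gr 1)
    (hα' : α' ∈ g.gr 1) (hr : α' - α ∈ g.L r) :
    Φ.push α' - Φ.push α - Φ.linear (α' - α) ∈ h.L (r + 1) := by
  have := ((hΦ.isSum_push hα').tail.sub (hΦ.isSum_push hα).tail).mem_L (r := r + 1) fun n => ?_
  · rw [pushTerm_zero, pushTerm_zero] at this
    rw [map_sub]
    convert this using 1
    abel
  · rw [pushTerm, pushTerm, ← smul_sub]
    exact Submodule.smul_mem _ _ (h.mem_L_of_le (by omega) (hΦ.app_sub_mem (fun _ => hr)))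

theorem IsFiltered.pushField_sub_mem (hΦ : Φ.IsFiltered) {γ γ' α α' : G} {r : ℕ}
    (hγ : γ ∈ g.gr 0) (hγ' : γ' ∈ g.gr 0) (hα : α ∈ g.gr 1) (hα' : α' ∈ g.gr 1)
    (h1 : γ' - γ ∈ g.L r) (h2 : α' - α ∈ g.L r) :
    Φ.pushField γ' α' - Φ.pushField γ α - Φ.linear (γ' - γ) ∈ h.L (r + 1) := by
  have := ((hΦ.isSum_pushField hγ' hα').tail.sub (hΦ.isSum_pushField hγ hα).tail).mem_L
    (r := r + 1) fun n => ?_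
  · simp only [linTerm_zero, pow_zero, one_smul] at this
    rw [map_sub]
    convert this using 1
    abel
  · rw [linTerm, linTerm, ← smul_sub, ← smul_sub]
    refine Submodule.smul_mem _ _ (Submodule.smul_mem _ _
      (h.mem_L_of_le (by omega) (hΦ.app_sub_mem (r := r) (fun i => ?_))))
    refine Fin.cases ?_ (fun i => ?_) i
    · simpa using h1
    · simpa using h2

theorem altSum_smul (c : 𝕜) (x γ α : G) (m : ℕ) :
    Φ.altSum (c • x) γ α m = c • Φ.altSum x γ α m := by
  rw [altSum, altSum, Finset.smul_sum]
  refine Finset.sum_congr rfl fun j _ => ?_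
  rw [(Φ.app (m + 1)).cons_smul, smul_comm]

theorem IsFiltered.altSum_mem_L (hΦ : Φ.IsFiltered) (x γ α : G) (m : ℕ) :
    Φ.altSum x γ α m ∈ h.L m :=
  sum_mem fun _ _ => Submodule.smul_mem _ _
    (by simpa using hΦ.app_mem (r := 0) 0 (g.mem_L_zero _))

theorem IsFiltered.isPath_pushField (hΦ : Φ.IsFiltered) {γ : G} {α α' : 𝕜 → G}
    (hγ : γ ∈ g.gr 0) (hα : g.HasDer α α') (h1 : ∀ t, α t ∈ g.gr 1) :
    h.IsPath (fun t => Φ.pushField γ (α t)) := by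
  refine IsPath.isSum (fun j => ?_)
    (fun j t => Submodule.smul_mem _ _ (hΦ.linTerm_mem_L γ (α t) j))
    (fun t => hΦ.isSum_pushField hγ (h1 t))
  have := HasDer.multilinear (F := Φ.app (j + 1)) (h := h)
    (f := Fin.cons (fun _ => γ) (fun _ => α)) (f' := Fin.cons (fun _ => 0) (fun _ => α'))
    (fun r ξ i hi => h.mem_L_of_le (by omega) (hΦ.app_mem i hi)) (fun i => by
      refine Fin.cases ?_ (fun i => ?_) i
      · exact HasDer.const γ
      · exact hα)
  refine ⟨_, ((this.smul ((-1 : 𝕜) ^ (j.choose 2) * ((j ! : ℕ) : 𝕜)⁻¹)).smul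
    ((-1 : 𝕜) ^ j)).congr (fun t => ?_) fun _ => rfl⟩
  rw [linTerm]
  congr 3
  funext i
  refine Fin.cases ?_ (fun i => ?_) i <;> rfl

section CharZero

variable [CharZero 𝕜]

/-- Summing the relations on copies of `α` over all arities assembles `∂α` and `1/2 [α, α]` into the
curvature. The bracket terms of index `k` belong to arity `k + 2`, hence the use of tails. -/
theorem IsFiltered.isSum_curv_push (hΦ : Φ.IsFiltered) {α : G} (hα : α ∈ g.gr 1) :
    h.IsSum (fun j => (-1 : 𝕜) ^ j • Φ.linTerm (g.curv α) α j) (h.curv (Φ.push α)) := by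
  have hP := hΦ.isSum_push hα
  have hB := (hP.bracket hP (hΦ.pushTerm_mem_L α) (hΦ.pushTerm_mem_L α)).smul (2 : 𝕜)⁻¹
  have hex : ∀ x ∈ g.gr 2, ∃ y ∈ h.gr 2, h.IsSum (fun j => (-1 : 𝕜) ^ j • Φ.linTerm x α j) y :=
    fun x hx => exists_isSum (fun j => Submodule.smul_mem _ _ (linTerm_mem_gr hx hα j))
      (fun j => Submodule.smul_mem _ _ (hΦ.linTerm_mem_L x α j))
  obtain ⟨y₁, -, h₁⟩ := hex _ (d_mem_two hα)
  obtain ⟨y₂, -, h₂⟩ := hex _ (bracket_mem_two hα hα)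
  have e1 := (hP.map_d.tail.add hB).congr (Φ.d_pushTerm_succ hα)
  have e2 := e1.unique (h₁.tail.add (h₂.smul (2 : 𝕜)⁻¹))
  rw [Φ.d_pushTerm_zero hα, pow_zero, one_smul] at e2
  have e3 : h.curv (Φ.push α) = y₁ + (2 : 𝕜)⁻¹ • y₂ := by
    rw [curv]
    have := congrArg (fun z => z + Φ.linTerm (g.d α) α 0) e2
    convert this using 1 <;> abel
  rw [e3]
  refine (h₁.add (h₂.smul (2 : 𝕜)⁻¹)).congr fun n => ?_
  rw [curv, (Φ.linTerm_linear α n).map_add, (Φ.linTerm_linear α n).map_smul, smul_add,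
    smul_comm (2 : 𝕜)⁻¹]

theorem IsFiltered.curv_push_sub_mem (hΦ : Φ.IsFiltered) {α : G} (hα : α ∈ g.gr 1) {r : ℕ}
    (hr : g.curv α ∈ g.L r) :
    h.curv (Φ.push α) - Φ.linear (g.curv α) ∈ h.L (r + 1) := by
  have := (hΦ.isSum_curv_push hα).tail.mem_L (r := r + 1) fun n =>
    Submodule.smul_mem _ _ (h.mem_L_of_le (by omega) (hΦ.linTerm_mem_L_add hr α (n + 1)))
  simpa [linTerm_zero] using this

theorem IsFiltered.curv_push (hΦ : Φ.IsFiltered) {α : G} (hα : α ∈ g.gr 1)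
    (h0 : g.curv α = 0) : h.curv (Φ.push α) = 0 := by
  refine h.separated _ fun r => h.mem_L_of_le r.le_succ ?_
  simpa [h0] using hΦ.curv_push_sub_mem hα (r := r) (by rw [h0]; exact zero_mem _)

/-- The derivative of `Φ_*` at a Maurer-Cartan element sends the gauge vector of `γ` to the gauge
vector of `pushField` at `Φ_*(α)`. This infinitesimal form of equivariance is integrated in
`isFlow_push`. -/
theorem IsFiltered.isSum_linTerm_gaugeField (hΦ : Φ.IsFiltered) {γ α : G} (hγ : γ ∈ g.gr 0)
    (hα : α ∈ g.gr 1) (h0 : g.curv α = 0) :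
    h.IsSum (Φ.linTerm (-g.d γ + g.bracket γ α) α)
      (-h.d (Φ.pushField γ α) + h.bracket (Φ.pushField γ α) (Φ.push α)) := by
  have hP := hΦ.isSum_push hα
  have hη := hΦ.isSum_pushField hγ hα
  have hB := hη.bracket hP (fun j => Submodule.smul_mem _ _ (hΦ.linTerm_mem_L γ α j))
    (hΦ.pushTerm_mem_L α)
  have hex : ∀ x ∈ g.gr 1, ∃ y ∈ h.gr 1, h.IsSum (Φ.linTerm x α) y :=
    fun x hx => exists_isSum (linTerm_mem_gr hx hα) (hΦ.linTerm_mem_L x α)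
  obtain ⟨y₁, -, h₁⟩ := hex _ (d_zero_mem hγ)
  obtain ⟨y₂, -, h₂⟩ := hex _ (bracket_zero_mem hγ hα)
  -- After substituting `∂α = -1/2 [α, α]`, the unwanted terms become `-(Z (n + 1) - Z n)`. They sum
  -- to zero because `Z 0` is an empty sum.
  set Z : ℕ → H := fun m => (-(2 : 𝕜)⁻¹) • ((-1 : 𝕜) ^ (m.choose 2) * ((m ! : ℕ) : 𝕜)⁻¹) •
    Φ.altSum (g.bracket α α) γ α m with hZ
  have hZs := isSum_succ_sub (g := h) (f := Z) fun m =>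
    Submodule.smul_mem _ _ (Submodule.smul_mem _ _ (hΦ.altSum_mem_L _ _ _ _))
  have hZ0 : Z 0 = 0 := by simp [hZ, altSum]
  have hd : g.d α = (-(2 : 𝕜)⁻¹) • g.bracket α α := by
    rw [neg_smul]
    exact eq_neg_of_add_eq_zero_left h0
  have e1 := ((hη.map_d.tail.sub hB).congr (Φ.d_linTerm_succ hγ hα)).unique
    (((h₁.tail.sub h₂).sub hZs).congr fun n => by
      rw [hd, altSum_smul, smul_comm _ (-(2 : 𝕜)⁻¹)]
      simp only [hZ, neg_smul]
      abel)
  rw [hZ0, pow_zero, one_smul, Φ.d_linTerm_zero hγ hα] at e1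
  have e2 : -h.d (Φ.pushField γ α) + h.bracket (Φ.pushField γ α) (Φ.push α) = -y₁ + y₂ := by
    have := congrArg (fun z => -(z + Φ.linTerm (g.d γ) α 0)) e1
    convert this using 1
    · abel
    · simp
      abel
  rw [e2]
  refine (h₁.neg.add h₂).congr fun n => ?_
  rw [(Φ.linTerm_linear α n).map_add, (Φ.linTerm_linear α n).map_neg]

theorem IsFiltered.hasDer_pushTerm (hΦ : Φ.IsFiltered) {α α' : 𝕜 → G} (hα : g.HasDer α α')
    (h1 : ∀ t, α t ∈ g.gr 1) (h1' : ∀ t, α' t ∈ g.gr 1) (j : ℕ) :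
    h.HasDer (fun t => Φ.pushTerm (α t) j) (fun t => Φ.linTerm (α' t) (α t) j) := by
  have := (HasDer.multilinear (F := Φ.app (j + 1)) (h := h)
    (fun r ξ i hi => h.mem_L_of_le (by omega) (hΦ.app_mem i hi)) (fun _ => hα)).smul
      ((-1 : 𝕜) ^ (j.choose 2) * (((j + 1)! : ℕ) : 𝕜)⁻¹)
  refine this.congr (fun _ => rfl) fun t => ?_
  simp only [Φ.app_update_one (h1' t) (h1 t), Finset.sum_const, Finset.card_univ, Fintype.card_fin]
  rw [← Nat.cast_smul_eq_nsmul 𝕜, smul_smul, linTerm]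
  congr 1
  have hj : ((j ! : ℕ) : 𝕜) ≠ 0 := Nat.cast_ne_zero.mpr j.factorial_ne_zero
  have hj1 : ((j : 𝕜) + 1) ≠ 0 := Nat.cast_add_one_ne_zero j
  rw [Nat.factorial_succ j]
  push_cast
  field_simp

/-- The direct image of a flow along a constant gauge field is a flow. -/
theorem IsFiltered.isFlow_push (hΦ : Φ.IsFiltered) {γ : G} {α : 𝕜 → G} (hγ : γ ∈ g.gr 0)
    (hα : g.IsFlow (fun _ => γ) α) (h1 : ∀ t, α t ∈ g.gr 1) (h0 : ∀ t, g.curv (α t) = 0) :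
    h.IsFlow (fun t => Φ.pushField γ (α t)) (fun t => Φ.push (α t)) :=
  HasDer.isSum (hΦ.hasDer_pushTerm hα h1 fun t =>
      add_mem (neg_mem (d_zero_mem hγ)) (bracket_zero_mem hγ (h1 t)))
    (fun j t => hΦ.pushTerm_mem_L (α t) j) (fun j t => hΦ.linTerm_mem_L _ (α t) j)
    (fun t => hΦ.isSum_push (h1 t)) (fun t => hΦ.isSum_linTerm_gaugeField hγ (h1 t) (h0 t))

/-- `Γ 1` is a gauge transformation from `Φ_*(α)` to `Φ_*(exp(γ)(α))`. -/
theorem IsFiltered.exists_isLogFlow_push (hΦ : Φ.IsFiltered) {γ α : G} (hγ : γ ∈ g.gr 0)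
    (hα : α ∈ g.gr 1) (h0 : g.curv α = 0) :
    ∃ Γ y, h.IsLogFlow (fun t => Φ.pushField γ (g.gauge (t • γ) α)) Γ y ∧ Γ 0 = 0 ∧
      Φ.push (g.gauge γ α) = h.gauge (Γ 1) (Φ.push α) := by
  have hflow : g.IsFlow (fun _ => γ) (fun t => g.gauge (t • γ) α) :=
    (isLogFlow_smul hγ).isFlow hα
  have hmem : ∀ t : 𝕜, g.gauge (t • γ) α ∈ g.gr 1 := fun t =>
    gauge_mem (Submodule.smul_mem _ _ hγ) hα
  obtain ⟨Γ, y, hΓ, hΓ0⟩ := exists_isLogFlow (hΦ.isPath_pushField hγ hflow hmem)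
    (fun t => hΦ.pushField_mem hγ (hmem t)) (zero_mem _)
  refine ⟨Γ, y, hΓ, hΓ0, ?_⟩
  have := (hΦ.isFlow_push hγ hflow hmem fun t =>
    curv_gauge (Submodule.smul_mem _ _ hγ) hα h0).eq (hΓ.isFlow (hΦ.push_mem hα))
    (by simp [hΓ0, ProNilpotentDGLieAlgebra.gauge_zero]) 1
  simpa using this

end CharZero

end LInftyMorphism

end Push

/-! ### Lifting along a filtered `L∞`-quasi-isomorphism -/

section Lifting

variable {𝕜 : Type u} {G : Type v} {H : Type w} [Field 𝕜] [AddCommGroup G] [Module 𝕜 G]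
  [AddCommGroup H] [Module 𝕜 H] {g : ProNilpotentDGLieAlgebra 𝕜 G}
  {h : ProNilpotentDGLieAlgebra 𝕜 H} {Φ : LInftyMorphism g.toDGLieAlgebra h.toDGLieAlgebra}

open ProNilpotentDGLieAlgebra

theorem TotalCohomology.exists_primitive {M N : Type*} [AddCommGroup M] [Module 𝕜 M]
    [AddCommGroup N] [Module 𝕜 N] {D : M →ₗ[𝕜] M} {E : N →ₗ[𝕜] N} {f : M →ₗ[𝕜] N}
    {hf : ∀ x, f (D x) = E (f x)} (hinj : Function.Injective (TotalCohomology.map D E f hf))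
    {x : M} (hx : D x = 0) {y : N} (hy : f x = E y) : ∃ k, D k = x := by
  have h0 : TotalCohomology.map D E f hf (Submodule.Quotient.mk ⟨x, hx⟩) = 0 :=
    (Submodule.Quotient.mk_eq_zero _).mpr ⟨y, hy.symm⟩
  have h1 := hinj (h0.trans (map_zero _).symm)
  exact (Submodule.Quotient.mk_eq_zero _).mp h1

theorem TotalCohomology.exists_lift {M N : Type*} [AddCommGroup M] [Module 𝕜 M]
    [AddCommGroup N] [Module 𝕜 N] {D : M →ₗ[𝕜] M} {E : N →ₗ[𝕜] N} {f : M →ₗ[𝕜] N}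
    {hf : ∀ x, f (D x) = E (f x)} (hsurj : Function.Surjective (TotalCohomology.map D E f hf))
    {y : N} (hy : E y = 0) : ∃ z e, D z = 0 ∧ y - f z = E e := by
  obtain ⟨c, hc⟩ := hsurj (Submodule.Quotient.mk ⟨y, hy⟩)
  obtain ⟨⟨z, hz⟩, rfl⟩ := Submodule.Quotient.mk_surjective _ c
  obtain ⟨e, he⟩ := (Submodule.Quotient.eq _).mp hc.symm
  exact ⟨z, e, hz, he.symm⟩

/-! ### Acyclicity of the cone and successive approximation -/

namespace LInftyMorphism

theorem linear_mem_gr {i : ℤ} {x : G} (hx : x ∈ g.gr i) : Φ.linear x ∈ h.gr i := by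
  simpa [linear] using Φ.degree 1 (fun _ => i) (fun _ => x) (fun _ => hx)

theorem proj_linear (i : ℤ) (x : G) : h.proj i (Φ.linear x) = Φ.linear (g.proj i x) := by
  induction x using g.gr_induction with
  | mem j x hx =>
    rw [g.proj_of_mem _ hx, h.proj_of_mem _ (linear_mem_gr hx)]
    split_ifs <;> simp
  | zero => simp
  | add x y hx hy => simp [hx, hy]

theorem grMk_eq_zero_iff (g : ProNilpotentDGLieAlgebra 𝕜 G) (r : ℕ) (x : g.L r) :
    (Submodule.Quotient.mk x : g.Gr r) = 0 ↔ x.1 ∈ g.L (r + 1) := by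
  rw [Submodule.Quotient.mk_eq_zero]
  rfl

theorem grMk_eq_iff (g : ProNilpotentDGLieAlgebra 𝕜 G) (r : ℕ) (x y : g.L r) :
    (Submodule.Quotient.mk x : g.Gr r) = Submodule.Quotient.mk y ↔ x.1 - y.1 ∈ g.L (r + 1) := by
  rw [Submodule.Quotient.eq]
  rfl

/-- The cone of the map induced on a graded piece is acyclic. -/
theorem IsFilteredQuasiIso.exists_lift (hΦ : Φ.IsFilteredQuasiIso) {r : ℕ} (hr : 1 ≤ r) {i : ℤ}
    {x : G} {u : H} (hx : x ∈ g.L r) (hxi : x ∈ g.gr (i + 1)) (hu : u ∈ h.L r)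
    (hui : u ∈ h.gr i) (hdx : g.d x ∈ g.L (r + 1))
    (hxu : Φ.linear x - h.d u ∈ h.L (r + 1)) :
    ∃ k ∈ g.gr i, ∃ e ∈ h.gr (i - 1), k ∈ g.L r ∧ e ∈ h.L r ∧ x - g.d k ∈ g.L (r + 1) ∧
      Φ.linear k - u - h.d e ∈ h.L (r + 1) := by
  obtain ⟨hF, hQ⟩ := hΦ
  obtain ⟨hinj, hsurj⟩ := hQ r hr
  -- Injectivity in cohomology: `Φ¹ x` is exact on the graded piece, so `x` is. The primitive need
  -- not be compatible with `u`.
  obtain ⟨k₀, hk₀⟩ := TotalCohomology.exists_primitive hinj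
    (x := Submodule.Quotient.mk ⟨x, hx⟩) (y := Submodule.Quotient.mk ⟨u, hu⟩)
    ((grMk_eq_zero_iff g r ⟨g.d x, g.d_mem_L _ _ hx⟩).mpr hdx)
    ((grMk_eq_iff h r ⟨Φ.linear x, hF.linear_mem r x hx⟩ ⟨h.d u, h.d_mem_L _ _ hu⟩).mpr hxu)
  obtain ⟨⟨k₀, hk₀L⟩, rfl⟩ := Submodule.Quotient.mk_surjective _ k₀
  replace hk₀ : x - g.d k₀ ∈ g.L (r + 1) := (grMk_eq_iff g r
    ⟨x, hx⟩ ⟨g.d k₀, g.d_mem_L _ _ hk₀L⟩).mp hk₀.symm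
  have hy : Φ.linear k₀ - u ∈ h.L r := sub_mem (hF.linear_mem r k₀ hk₀L) hu
  have hdy : h.d (Φ.linear k₀ - u) ∈ h.L (r + 1) := by
    have := sub_mem hxu (hF.linear_mem (r + 1) _ hk₀)
    rw [map_sub, ← Φ.linear_d]
    rw [map_sub] at this
    convert this using 1
    abel
  -- The defect `Φ¹ k₀ - u` is a cocycle. By surjectivity it is cohomologous to `Φ¹ z` with `z` a
  -- cocycle, and `k₀ - z` is the corrected primitive.
  obtain ⟨z, e, hz, hze⟩ := TotalCohomology.exists_lift hsurj
    (y := Submodule.Quotient.mk ⟨_, hy⟩)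
    ((grMk_eq_zero_iff h r ⟨_, h.d_mem_L _ _ hy⟩).mpr hdy)
  obtain ⟨⟨z, hzL⟩, rfl⟩ := Submodule.Quotient.mk_surjective _ z
  obtain ⟨⟨e, heL⟩, rfl⟩ := Submodule.Quotient.mk_surjective _ e
  replace hz : g.d z ∈ g.L (r + 1) :=
    (grMk_eq_zero_iff g r ⟨g.d z, g.d_mem_L _ _ hzL⟩).mp hz
  replace hze : Φ.linear k₀ - u - Φ.linear z - h.d e ∈ h.L (r + 1) := (grMk_eq_iff h r
    (⟨_, hy⟩ - ⟨Φ.linear z, hF.linear_mem r z hzL⟩) ⟨h.d e, h.d_mem_L _ _ heL⟩).mp hze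
  -- The hypothesis concerns total cohomology, so the components of the right degrees are extracted
  -- here.
  refine ⟨g.proj i (k₀ - z), g.proj_mem _ _, h.proj (i - 1) e, h.proj_mem _ _,
    g.proj_mem_L _ _ (sub_mem hk₀L hzL), h.proj_mem_L _ _ heL, ?_, ?_⟩
  · rw [← g.proj_d, ← g.proj_eq_self hxi, ← map_sub]
    refine g.proj_mem_L _ _ ?_
    rw [map_sub, ← sub_add]
    exact add_mem hk₀ hz
  · have e1 : h.d (h.proj (i - 1) e) = h.proj i (h.d e) := by
      rw [← h.proj_d, sub_add_cancel]
    rw [← proj_linear, e1, ← h.proj_eq_self hui, ← map_sub, ← map_sub]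
    refine h.proj_mem_L _ _ ?_
    rw [map_sub]
    convert hze using 1
    abel

/-- Successive approximation by dependent choice. No continuity of `P` is assumed: the limit comes
with approximants satisfying `P n`, and the limiting identity is left to the application. -/
theorem exists_limit_pair {i j : ℤ} {P : ℕ → G → H → Prop}
    (h0 : ∃ a ∈ g.gr i, ∃ b ∈ h.gr j, P 0 a b)
    (hs : ∀ n, ∀ a ∈ g.gr i, ∀ b ∈ h.gr j, P n a b → ∃ a' ∈ g.gr i, ∃ b' ∈ h.gr j,
      a' - a ∈ g.L n ∧ b' - b ∈ h.L n ∧ P (n + 1) a' b') :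
    ∃ a ∈ g.gr i, ∃ b ∈ h.gr j, ∀ n, ∃ a' ∈ g.gr i, ∃ b' ∈ h.gr j,
      P n a' b' ∧ a - a' ∈ g.L n ∧ b - b' ∈ h.L n := by
  obtain ⟨a₀, ha₀, b₀, hb₀, h0⟩ := h0
  let S : ℕ → Type _ := fun n => {p : G × H // p.1 ∈ g.gr i ∧ p.2 ∈ h.gr j ∧ P n p.1 p.2}
  have step : ∀ n (p : S n), ∃ q : S (n + 1), q.1.1 - p.1.1 ∈ g.L n ∧ q.1.2 - p.1.2 ∈ h.L n := by
    rintro n ⟨⟨a, b⟩, ha, hb, hp⟩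
    obtain ⟨a', ha', b', hb', h1, h2, h3⟩ := hs n a ha b hb hp
    exact ⟨⟨⟨a', b'⟩, ha', hb', h3⟩, h1, h2⟩
  choose next hnext using step
  let s : ∀ n, S n := fun n => Nat.rec ⟨⟨a₀, b₀⟩, ha₀, hb₀, h0⟩ next n
  obtain ⟨a, ha, haL⟩ := g.complete i (fun n => (s n).1.1) (fun n => (s n).2.1)
    (fun n => (hnext n (s n)).1)
  obtain ⟨b, hb, hbL⟩ := h.complete j (fun n => (s n).1.2) (fun n => (s n).2.2.1)
    (fun n => (hnext n (s n)).2)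
  exact ⟨a, ha, b, hb, fun n => ⟨_, (s n).2.1, _, (s n).2.2.1, (s n).2.2.2, haL n, hbL n⟩⟩

theorem curv_sub_mem {α α' : G} {r : ℕ} (hr : α' - α ∈ g.L r) :
    g.curv α' - g.curv α - g.d (α' - α) ∈ g.L (r + 1) := by
  have := Submodule.smul_mem _ (2 : 𝕜)⁻¹ (bracket_sub_mem_succ hr hr)
  rw [smul_sub] at this
  rw [curv, curv, map_sub]
  convert this using 1
  abel

theorem mem_of_sub_sub_mem {r : ℕ} {x y z : G} (h1 : x - y - z ∈ g.L (r + 1)) (h2 : z ∈ g.L r) :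
    x - y ∈ g.L r := by
  simpa using add_mem (g.mem_L_of_le r.le_succ h1) h2

section CharZero

variable [CharZero 𝕜]

/-- Every Maurer-Cartan element of the target is gauge equivalent to a direct image. -/
theorem IsFilteredQuasiIso.exists_push_eq_gauge (hΦ : Φ.IsFilteredQuasiIso) {β : H}
    (hβ : β ∈ h.gr 1) (hβ0 : h.curv β = 0) :
    ∃ α ∈ g.gr 1, g.curv α = 0 ∧ ∃ γ ∈ h.gr 0, Φ.push α = h.gauge γ β := by
  have hF := hΦ.1
  obtain ⟨α, hα, γ, hγ, hlim⟩ := exists_limit_pair (g := g) (h := h) (i := 1) (j := 0)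
    (P := fun n α γ => g.curv α ∈ g.L (n + 1) ∧ h.gauge γ β - Φ.push α ∈ h.L (n + 1))
    -- The invariant lives in `L (n + 1)`: it is vacuous at `n = 0` because `L 1` is everything, and
    -- the cone is acyclic only for `r ≥ 1`.
    ⟨0, zero_mem _, 0, zero_mem _, by simpa using g.mem_L_one _, by simpa using h.mem_L_one _⟩
    (by
      rintro n α hα γ hγ ⟨h1, h2⟩
      set r := n + 1
      set u := h.gauge γ β - Φ.push α with hu
      have hui : u ∈ h.gr 1 := sub_mem (gauge_mem hγ hβ) (hF.push_mem hα)
      have hdF : g.d (g.curv α) ∈ g.L (r + 1) := by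
        -- The Bianchi identity. The cubic term `[[α, α], α]` vanishes by the Jacobi identity, `3`
        -- being invertible.
        have e1 : g.d (g.curv α) = g.bracket (g.curv α) α := by
          have hj := g.jacobi 1 1 α α α hα hα
          simp at hj
          have hj3 : g.bracket (g.bracket α α) α = g.bracket α (g.bracket α α) +
            g.bracket α (g.bracket α α) := by
            nth_rewrite 1 [hj]
            abel
          have hs : g.bracket α (g.bracket α α) = -g.bracket (g.bracket α α) α := by
            simpa [show Int.negOnePow 2 = 1 from rfl] using g.bracket_symm 1 2 α _ hα (bracket_mem_two hα hα)
          have hz : g.bracket (g.bracket α α) α = 0 := by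
            rw [hs] at hj3
            have : (3 : 𝕜) • g.bracket (g.bracket α α) α = 0 := by
              rw [show (3 : 𝕜) = 1 + 1 + 1 by norm_num, add_smul, add_smul, one_smul]
              nth_rewrite 1 [hj3]
              abel
            simpa using this
          have hl := g.leibniz 1 α α hα
          have hs2 : g.bracket α (g.d α) = -g.bracket (g.d α) α := by
            simpa [show Int.negOnePow 2 = 1 from rfl] using g.bracket_symm 1 2 α _ hα (d_mem_two hα)
          rw [hs2] at hl
          simp only [curv, map_add, map_smul, g.d_d, hl, LinearMap.add_apply,
            LinearMap.smul_apply, hz]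
          simp only [Int.negOnePow_one, Units.neg_smul, one_smul, neg_neg, zero_add, smul_zero,
            add_zero]
          rw [← two_smul 𝕜, smul_smul, inv_mul_cancel₀ two_ne_zero, one_smul]
        rw [e1]
        exact bracket_mem_left_succ _ h1
      have hcu : h.curv (Φ.push α) + h.d u ∈ h.L (r + 1) := by
        have := curv_sub_mem (g := h) h2
        rw [curv_gauge hγ hβ hβ0] at this
        convert neg_mem this using 1
        abel
      have hFu : Φ.linear (-g.curv α) - h.d u ∈ h.L (r + 1) := by
        have := sub_mem (hF.curv_push_sub_mem hα h1) hcu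
        rw [map_neg]
        convert this using 1
        abel
      -- The cone cocycle is `(-F, u)`, with `F` the curvature of `α`. Replacing `α` by `α + a`
      -- changes `F` by `∂a`, and replacing `γ` by `γ - e` changes `u` by `∂e - Φ¹ a`, modulo `L (r
      -- + 1)`; both errors cancel.
      obtain ⟨a, ha, e, he, haL, heL, h3, h4⟩ := hΦ.exists_lift (i := 1) (by omega)
        (neg_mem h1) (neg_mem (curv_mem hα)) h2 hui
        (by rw [map_neg]; exact neg_mem hdF) hFu
      refine ⟨α + a, add_mem hα ha, γ - e, sub_mem hγ he,
        by simpa using g.mem_L_of_le n.le_succ haL,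
        by simpa using neg_mem (h.mem_L_of_le n.le_succ heL), ?_, ?_⟩
      · have := curv_sub_mem (g := g) (α := α) (α' := α + a) (r := r) (by simpa using haL)
        rw [add_sub_cancel_left] at this
        convert sub_mem this h3 using 1
        abel
      · have h5 := hF.push_sub_mem hα (add_mem hα ha) (r := r) (by simpa using haL)
        have h6 := gauge_sub_mem hγ (sub_mem hγ he) hβ (r := r) (by simpa using neg_mem heL)
        rw [add_sub_cancel_left] at h5
        rw [show γ - e - γ = -e by abel, map_neg] at h6
        convert sub_mem (sub_mem h6 h5) h4 using 1
        rw [hu]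
        abel)
  refine ⟨α, hα, g.separated _ fun n => ?_, γ, hγ, eq_of_sub_mem (g := h) fun n => ?_⟩
  · obtain ⟨α', _, _, _, ⟨h1, _⟩, h2, _⟩ := hlim n
    have h3 := mem_of_sub_sub_mem (curv_sub_mem h2) (g.d_mem_L _ _ h2)
    simpa using add_mem h3 (g.mem_L_of_le n.le_succ h1)
  · obtain ⟨α', hα', γ', hγ', ⟨-, h1⟩, h2, h3⟩ := hlim n
    have h4 := mem_of_sub_sub_mem (hF.push_sub_mem hα' hα h2) (hF.linear_mem _ _ h2)
    have h5 := sub_mem (h.mem_L_of_le n.le_succ (gauge_sub_mem hγ' hγ hβ h3)) (h.d_mem_L _ _ h3)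
    have h6 := sub_mem (sub_mem h4 h5) (h.mem_L_of_le n.le_succ h1)
    convert h6 using 1
    abel

/-- The gauge field of `γ` at `b` is minus the twisted differential `∂ + [b, ·]` applied to `γ`.
This differential squares to zero for Maurer-Cartan `b`, so its boundaries fix `b`. -/
theorem gauge_stabilizer {b e : H} (hb : b ∈ h.gr 1) (hb0 : h.curv b = 0) (he : e ∈ h.gr (-1)) :
    h.d e + h.bracket b e ∈ h.gr 0 ∧ h.gauge (h.d e + h.bracket b e) b = b := by
  have hde : h.d e ∈ h.gr 0 := by simpa using h.d_mem (-1) e he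
  have hbe : h.bracket b e ∈ h.gr 0 := by simpa using h.bracket_mem 1 (-1) b e hb he
  refine ⟨add_mem hde hbe, gauge_eq_self (add_mem hde hbe) ?_⟩
  have hd : h.d b = -((2 : 𝕜)⁻¹ • h.bracket b b) := eq_neg_of_add_eq_zero_left hb0
  have hl : h.d (h.bracket b e) = h.bracket (h.d b) e - h.bracket b (h.d e) := by
    simpa [sub_eq_add_neg] using h.leibniz 1 b e hb
  have hj : h.bracket b (h.bracket b e) = h.bracket (h.bracket b b) e -
      h.bracket b (h.bracket b e) := by
    simpa [sub_eq_add_neg] using h.jacobi 1 1 b b e hb hb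
  have hj2 : (2 : 𝕜)⁻¹ • h.bracket (h.bracket b b) e = h.bracket b (h.bracket b e) := by
    rw [← eq_sub_iff_add_eq.mp hj, ← two_smul 𝕜, smul_smul, inv_mul_cancel₀ two_ne_zero, one_smul]
  rw [map_add, LinearMap.add_apply, bracket_symm_zero hde hb, bracket_symm_zero hbe hb, map_add,
    h.d_d, hl, hd, map_neg, LinearMap.neg_apply, map_smul, LinearMap.smul_apply, hj2]
  abel

/-- Maurer-Cartan elements with gauge equivalent direct images are gauge equivalent. -/
theorem IsFilteredQuasiIso.exists_gauge_eq (hΦ : Φ.IsFilteredQuasiIso) {α α' : G}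
    (hα : α ∈ g.gr 1) (hα0 : g.curv α = 0) (hα' : α' ∈ g.gr 1) (hα'0 : g.curv α' = 0) {γ : H}
    (hγ : γ ∈ h.gr 0) (hγα : Φ.push α' = h.gauge γ (Φ.push α)) :
    ∃ κ ∈ g.gr 0, α' = g.gauge κ α := by
  have hF := hΦ.1
  set b := Φ.push α with hbdef
  have hb : b ∈ h.gr 1 := hF.push_mem hα
  have hb0 : h.curv b = 0 := hF.curv_push hα hα0
  -- `Γ κ 1` is the logarithm of a gauge transformation from `Φ_*(α)` to `Φ_*(exp(κ)(α))`.
  choose Γ y hΓ hΓ0 hΓ1 using fun κ : g.gr 0 => hF.exists_isLogFlow_push κ.2 hα hα0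
  -- `Δ e 1` is the logarithm of `exp(γ)` composed with the stabilizer element attached to `e`. It
  -- takes `b` to `Φ_*(α')` for every `e`, which gives room for the degree `-1` correction.
  choose Δ z hΔ hΔ0 using fun e : h.gr (-1) => exists_isLogFlow (g := h) (η := fun _ => γ)
    (HasDer.const γ).isPath (fun _ => hγ) (gauge_stabilizer hb hb0 e.2).1
  have hΔ1 : ∀ e, h.gauge (Δ e 1) b = h.gauge γ b := fun e => by
    have h1 := (hΔ e).isFlow hb
    have h2 := ((isLogFlow_smul hγ).isFlow hb).eq h1
      (by simp [hΔ0, (gauge_stabilizer hb hb0 e.2).2, ProNilpotentDGLieAlgebra.gauge_zero]) 1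
    simpa using h2.symm
  obtain ⟨κ, hκ, _, _, hlim⟩ := exists_limit_pair (g := g) (h := h) (i := 0) (j := -1)
    (P := fun n κ e => ∃ (hκ : κ ∈ g.gr 0) (he : e ∈ h.gr (-1)),
      α' - g.gauge κ α ∈ g.L (n + 1) ∧ Δ ⟨e, he⟩ 1 - Γ ⟨κ, hκ⟩ 1 ∈ h.L (n + 1))
    ⟨0, zero_mem _, 0, zero_mem _, zero_mem _, zero_mem _, by simpa using g.mem_L_one _,
      by simpa using h.mem_L_one _⟩
    (by
      rintro n κ - e - ⟨hκ, he, h1, h2⟩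
      set r := n + 1
      set x := α' - g.gauge κ α with hx
      set u := Δ ⟨e, he⟩ 1 - Γ ⟨κ, hκ⟩ 1 with hu
      have hκα : g.gauge κ α ∈ g.gr 1 := gauge_mem hκ hα
      have hdx : g.d x ∈ g.L (r + 1) := by
        have := curv_sub_mem (g := g) h1
        rw [hα'0, curv_gauge hκ hα hα0] at this
        simpa only [sub_self, zero_sub, neg_neg] using neg_mem this
      -- `Φ_*(α') - Φ_*(exp(κ)(α))` is `Φ¹ x` by the leading term of `Φ_*`, and `-∂u` by that of the
      -- gauge action, modulo `L (r + 1)`. So `(x, -u)` is a cocycle of the cone.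
      have hxu : Φ.linear x - h.d (-u) ∈ h.L (r + 1) := by
        have h3 := hF.push_sub_mem hκα hα' h1
        have h4 := gauge_sub_mem ((hΓ ⟨κ, hκ⟩).mem 1) ((hΔ ⟨e, he⟩).mem 1) hb h2
        rw [hΔ1, ← hΓ1, ← hγα] at h4
        convert sub_mem h4 h3 using 1
        rw [map_neg]
        abel
      obtain ⟨k, hk, ε, hε, hkL, hεL, h5, h6⟩ := hΦ.exists_lift (i := 0) (by omega) h1
        (by simpa using sub_mem hα' hκα) (neg_mem h2)
        (neg_mem (sub_mem ((hΔ ⟨e, he⟩).mem 1) ((hΓ ⟨κ, hκ⟩).mem 1))) hdx hxu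
      rw [zero_sub] at hε
      have hκ' : κ - k ∈ g.gr 0 := sub_mem hκ hk
      have he' : e - ε ∈ h.gr (-1) := sub_mem he hε
      have hκL : κ - k - κ ∈ g.L r := by simpa using neg_mem hkL
      refine ⟨κ - k, hκ', e - ε, he', g.mem_L_of_le n.le_succ hκL,
        by simpa using neg_mem (h.mem_L_of_le n.le_succ hεL), hκ', he', ?_, ?_⟩
      · have h7 := gauge_sub_mem hκ hκ' hα hκL
        rw [show κ - k - κ = -k by abel, map_neg] at h7
        convert sub_mem h5 h7 using 1
        rw [hx]
        abel
      -- Passing to `κ - k` changes the pushed field by the constant `-Φ¹ k` to leading order, hence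
      -- also `Γ` at time one. Passing to `e - ε` changes `Δ` only through its initial value, by
      -- `-∂ε - [b, ε]`, whose bracket is of higher order.
      · have h8 := (hΓ ⟨κ, hκ⟩).sub_sub_mem (hΓ ⟨κ - k, hκ'⟩) (r := r)
          (c := Φ.linear (κ - k - κ)) (hF.linear_mem _ _ hκL) (fun t => by
            have hs : t • (κ - k) - t • κ ∈ g.L r := by
              rw [← smul_sub]
              exact Submodule.smul_mem _ _ hκL
            have hg := gauge_sub_mem (Submodule.smul_mem _ t hκ) (Submodule.smul_mem _ t hκ') hα hs
            have hg' := sub_mem (g.mem_L_of_le r.le_succ hg) (g.d_mem_L _ _ hs)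
            rw [add_sub_cancel_right] at hg'
            exact hF.pushField_sub_mem hκ hκ' (gauge_mem (Submodule.smul_mem _ t hκ) hα)
              (gauge_mem (Submodule.smul_mem _ t hκ') hα) hκL hg')
          (by simp [hΓ0]) 1
        have hΔd : Δ ⟨e - ε, he'⟩ 0 - Δ ⟨e, he⟩ 0 = -h.d ε - h.bracket b ε := by
          rw [hΔ0, hΔ0]
          simp only [map_sub]
          abel
        have h9 := (hΔ ⟨e, he⟩).sub_sub_mem (hΔ ⟨e - ε, he'⟩) (r := r) (c := 0) (zero_mem _)
          (fun t => by simp) (by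
            rw [hΔd]
            exact sub_mem (neg_mem (h.d_mem_L _ _ hεL)) (bracket_mem_right _ hεL)) 1
        rw [hΔd] at h9
        rw [hΓ0, hΓ0, show κ - k - κ = -k by abel, map_neg] at h8
        have h10 := add_mem (sub_mem (sub_mem h9 h8) (bracket_mem_right_succ b hεL)) h6
        convert h10 using 1
        rw [hu]
        simp
        abel)
  refine ⟨κ, hκ, eq_of_sub_mem (g := g) fun n => ?_⟩
  obtain ⟨κ', hκ', _, _, ⟨_, _, h1, _⟩, h2, _⟩ := hlim n
  have h3 := sub_mem (g.mem_L_of_le n.le_succ (gauge_sub_mem hκ' hκ hα h2)) (g.d_mem_L _ _ h2)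
  rw [add_sub_cancel_right] at h3
  simpa using sub_mem (g.mem_L_of_le n.le_succ h1) h3

end CharZero

end LInftyMorphism

end Lifting

/-! ### Assembly of the theorem -/

theorem lemma2p6 {𝕜 : Type u} {G : Type v} {H : Type w} [Field 𝕜] [CharZero 𝕜]
    [AddCommGroup G] [Module 𝕜 G] [AddCommGroup H] [Module 𝕜 H]
    (g : ProNilpotentDGLieAlgebra 𝕜 G) (h : ProNilpotentDGLieAlgebra 𝕜 H)
    (Φ : LInftyMorphism g.toDGLieAlgebra h.toDGLieAlgebra) (hΦ : Φ.IsFilteredQuasiIso) :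
    Equivalence g.GaugeEquiv ∧ Equivalence h.GaugeEquiv ∧
      ∃ Φstar : g.toDGLieAlgebra.MC → h.toDGLieAlgebra.MC,
        (∀ α, Φ.IsPushforward α.1 (Φstar α).1) ∧
        ∃ hstar : ∀ α β, g.GaugeEquiv α β → h.GaugeEquiv (Φstar α) (Φstar β),
          Function.Bijective (Quot.map Φstar hstar) := by
  have hF := hΦ.1
  refine ⟨g.equivalence_gaugeEquiv, h.equivalence_gaugeEquiv,
    fun α => ⟨Φ.push α.1, hF.push_mem α.2.1, hF.curv_push α.2.1 α.2.2⟩,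
    fun α => hF.isSum_push α.2.1, fun α β hαβ => ?_, ?_, ?_⟩
  · obtain ⟨γ, hγ, hβ⟩ := ProNilpotentDGLieAlgebra.gaugeEquiv_iff.mp hαβ
    obtain ⟨Γ, y, hΓ, -, hΓ1⟩ := hF.exists_isLogFlow_push hγ α.2.1 α.2.2
    exact ProNilpotentDGLieAlgebra.gaugeEquiv_iff.mpr ⟨Γ 1, hΓ.mem 1, by simp only [hβ, hΓ1]⟩
  · rintro ⟨α⟩ ⟨α'⟩ hαα'
    -- Equality in `Quot` only gives the generated equivalence relation, which is `∼` itself.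
    have h1 := h.equivalence_gaugeEquiv.eqvGen_iff.mp (Quot.eqvGen_exact hαα')
    obtain ⟨γ, hγ, h2⟩ := ProNilpotentDGLieAlgebra.gaugeEquiv_iff.mp h1
    exact Quot.sound (ProNilpotentDGLieAlgebra.gaugeEquiv_iff.mpr
      (hΦ.exists_gauge_eq α.2.1 α.2.2 α'.2.1 α'.2.2 hγ h2))
  · rintro ⟨β⟩
    obtain ⟨α, hα, hα0, γ, hγ, h1⟩ := hΦ.exists_push_eq_gauge β.2.1 β.2.2
    exact ⟨Quot.mk _ ⟨α, hα, hα0⟩, (Quot.sound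
      (ProNilpotentDGLieAlgebra.gaugeEquiv_iff.mpr ⟨γ, hγ, h1⟩)).symm⟩
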